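/- Let $(\Delta,\mathcal F,\mathbb P)$ be a probability space, let $\mathcal X\subset\mathbb R^n$ be compact and convex, let $J:\mathbb R^n\to\mathbb R$ be lower semicontinuous (possibly non-convex), and let $g:\mathbb R^n\times\Delta\to\mathbb R$ be such that $g(\cdot,\delta)$ is convex and lower semicontinuous for every $\delta$ and $g(x,\cdot)$ is measurable for every $x$. For $\epsilon\in(0,1)$ let $\mathrm{CCP}(\epsilon)$ be the program $\min_{x\in\mathcal X}J(x)$ subject to $\mathbb P(\{\delta: g(x,\delta)\le 0\})\ge 1-\epsilon$. For a set $A\subseteq\mathcal X$ let $V(A):=\sup_{x\in A}\mathbb P(\{\delta: g(x,\delta)>0\})$, with $V(\varnothing)=0$. For $k=1,\dots,M$ let $c_k\in\mathbb R^n$ and let $\mathcal C_k\subseteq\mathbb R^n$ be closed and convex. For a multi-sample $\omega=(\delta^{(1)},\dots,\delta^{(L)})\in\Delta^L$, let $\mathrm{SP}_k[\omega]$ be the convex scenario program $$\min_{x\in\mathcal C_k\cap\mathcal X} c_k^\top x\quad\text{subject to}\quad g(x,\delta^{(i)})\le 0,\ i=1,\dots,L.$$ Assume that, for every $L\ge1$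 and every $\omega\in\Delta^L$, $\mathrm{SP}_k[\omega]$ has at most one optimizer, possibly after a tie-break rule that minimizes finitely many given convex lower semicontinuous functions successively over the set of optimizers. Let $x_k^\star(\omega)$ be this optimizer, with $x_k^\star(\omega):=\varnothing$ if $\mathrm{SP}_k[\omega]$ is infeasible. The $i$-th sample is a support constraint of $\mathrm{SP}_k[\omega]$ if its removal changes the solution, and Helly's dimension of $\mathrm{SP}_k$ is the least integer $\zeta$ such that, for every $L\ge1$, $\mathrm{SP}_k[\omega]$ has at most $\zeta$ support constraints for $\mathbb P^L$-almost every $\omega\in\Delta^L$. Let $\zeta$ be an upper bound for Helly's dimension of each of $\mathrm{SP}_1,\dots,\mathrm{SP}_M$, and let $$\mathbb X_M(\omega):=\mathrm{conv}\left(\{x_1^\star(\omega),\dots,x_M^\star(\omega)\}\right).$$ Then for all $\epsilon,\beta\in(0,1)$, if $$N\ \ge\ \frac{\frac{e}{e-1}\min\{n+1,M\}}{\epsilon}\left(\zeta-1+\ln\left(\frac M\beta\right)\right),$$ then $\mathbb P^N(\{\omega\in\Delta^N: V(\mathbb X_M(\omega))>\epsilon\})\le\beta$ and $\mathbb P^N(\{\omega\in\Delta^N: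 V(\mathbb X_M(\omega))\le\epsilon\})\ge 1-\beta$. Moreover, with probability at least $1-\beta$, every feasible solution of the program $\min_{x\in\mathcal X}J(x)$ subject to $x\in\mathbb X_M(\omega)$ is feasible for $\mathrm{CCP}(\epsilon)$. -/

import Mathlib

open MeasureTheory

noncomputable section

/-- The data of a chance constrained program in `ℝⁿ`: admissible set, (possibly non-convex) cost,
and constraint function `g x δ`, where the uncertainty `δ` ranges over `Δ`. -/
structure ChanceProgram (n : ℕ) (Δ : Type*) where
  /-- the admissible set -/
  adm : Set (EuclideanSpace ℝ (Fin n))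
  /-- the cost `J` -/
  cost : EuclideanSpace ℝ (Fin n) → ℝ
  /-- the constraint function `g` -/
  g : EuclideanSpace ℝ (Fin n) → Δ → ℝ

/-- The data, besides the admissible set and the constraint function, of a convex scenario program:
a cost vector `c`, an additional constraint set `C`, and a finite list of tie-break functions that
are minimized one after the other (the empty list means that no tie-break rule is used). -/
structure ConvexScenario (n : ℕ) where
  /-- the cost vector -/
  c : EuclideanSpace ℝ (Fin n)
  /-- the additional constraint set -/
  C : Set (EuclideanSpace ℝ (Fin n))
  /-- the tie-break functions -/
  tie : List (EuclideanSpace ℝ (Fin n) → ℝ)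

/-- The set of minimizers of `f` over `S`. -/
def argminOn {α : Type*} (f : α → ℝ) (S : Set α) : Set α :=
  {x | x ∈ S ∧ ∀ y ∈ S, f x ≤ f y}

namespace ConvexScenario

variable {n : ℕ}

/-- `C` is convex (and closed), and the tie-break functions are convex and lower semicontinuous. -/
structure IsRegular (S : ConvexScenario n) : Prop where
  convex_C : Convex ℝ S.C
  closed_C : IsClosed S.C
  convex_tie : ∀ φ ∈ S.tie, ConvexOn ℝ Set.univ φ
  lsc_tie : ∀ φ ∈ S.tie, LowerSemicontinuous φ

end ConvexScenario

namespace ChanceProgram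

variable {n : ℕ} {Δ : Type*}

/-- The standing regularity assumption. -/
structure IsRegular [MeasurableSpace Δ] (Q : ChanceProgram n Δ) : Prop where
  compact_adm : IsCompact Q.adm
  convex_adm : Convex ℝ Q.adm
  convex_g : ∀ δ, ConvexOn ℝ Set.univ (fun x => Q.g x δ)
  lsc_g : ∀ δ, LowerSemicontinuous (fun x => Q.g x δ)
  measurable_g : ∀ x, Measurable (Q.g x)
  lsc_cost : LowerSemicontinuous Q.cost

/-- The probability of violation `V(S) = sup_{x ∈ S} P {δ | g x δ > 0}` of a set `S`
(equal to `0` for the empty set). -/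
def violation [MeasurableSpace Δ] (Q : ChanceProgram n Δ) (P : Measure Δ)
    (S : Set (EuclideanSpace ℝ (Fin n))) : ENNReal :=
  ⨆ x ∈ S, P {δ | 0 < Q.g x δ}

/-- The feasible set of `CCP(ε) : min J(x)` over `x` in the admissible set, subject to
`P {δ | g x δ ≤ 0} ≥ 1 - ε`. -/
def chanceFeasible [MeasurableSpace Δ] (Q : ChanceProgram n Δ) (P : Measure Δ) (ε : ℝ) :
    Set (EuclideanSpace ℝ (Fin n)) :=
  {x | x ∈ Q.adm ∧ ENNReal.ofReal (1 - ε) ≤ P {δ | Q.g x δ ≤ 0}}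

/-- The feasible set of the scenario program of `S` for a multi-sample `ω`, indexed by `ι`. -/
def scenarioFeasible (Q : ChanceProgram n Δ) (S : ConvexScenario n) {ι : Type*} (ω : ι → Δ) :
    Set (EuclideanSpace ℝ (Fin n)) :=
  {x | x ∈ S.C ∩ Q.adm ∧ ∀ i, Q.g x (ω i) ≤ 0}

/-- The optimizers of the scenario program `min cᵀx` for the multi-sample `ω`, after the tie-break
functions have been minimized one after the other. This set is empty if the program is infeasible,
and it is the singleton `{x⋆(ω)}` if the program is feasible with unique optimizer. -/
def optimizers (Q : ChanceProgram n Δ) (S : ConvexScenario n) {ι : Type*} (ω : ι → Δ) :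
    Set (EuclideanSpace ℝ (Fin n)) :=
  S.tie.foldl (fun A φ => argminOn φ A)
    (argminOn (fun x => inner ℝ S.c x) (Q.scenarioFeasible S ω))

/-- The support constraints of the scenario program for the multi-sample `ω`: the indices of those
samples whose removal changes the solution (infeasibility counting as the empty solution). When the
optimizer is unique, this is the same as a strict decrease of the optimal value. -/
def supportConstraints (Q : ChanceProgram n Δ) (S : ConvexScenario n) {ι : Type*} (ω : ι → Δ) :
    Set ι :=
  {i | Q.optimizers S (fun j : {j : ι // j ≠ i} => ω j) ≠ Q.optimizers S ω}

/-- Helly's dimension of the scenario program: the least `ζ` such that, for every `N ≥ 1`, the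
essential supremum over `ω ∈ Δᴺ` of the number of support constraints is at most `ζ`
(`⊤` if there is no such integer). -/
def hellyDim [MeasurableSpace Δ] (Q : ChanceProgram n Δ) (P : Measure Δ) (S : ConvexScenario n) :
    ℕ∞ :=
  sInf {ζ : ℕ∞ | ∀ N : ℕ, 1 ≤ N →
    ∀ᵐ ω ∂(Measure.pi fun _ : Fin N => P), (Q.supportConstraints S ω).encard ≤ ζ}

/-- The set `X_M(ω) = conv {x₁⋆(ω), …, x_M⋆(ω)}`, infeasible programs contributing no point. -/
def optimizerHull (Q : ChanceProgram n Δ) {M : ℕ} (S : Fin M → ConvexScenario n) {ι : Type*}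
    (ω : ι → Δ) : Set (EuclideanSpace ℝ (Fin n)) :=
  convexHull ℝ (⋃ k, Q.optimizers (S k) ω)

/-- The feasible set of the approximating program `min J(x)` over `x` in the admissible set,
subject to `x ∈ X_M(ω)`. -/
def approxFeasible (Q : ChanceProgram n Δ) {M : ℕ} (S : Fin M → ConvexScenario n) {ι : Type*}
    (ω : ι → Δ) : Set (EuclideanSpace ℝ (Fin n)) :=
  {x | x ∈ Q.adm ∧ x ∈ Q.optimizerHull S ω}

end ChanceProgram

end

/-! By Carathéodory, a point of the hull is a convex combination of at most m = min{n+1, M}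
optimizers, and by convexity of g(·,δ) every δ violated by that point is violated by one of them. So
V(X_M) is at most m times the largest risk of an optimizer. A union bound over the M programs, with
ε/m and β/M, reduces the theorem to a single program: P^N(risk > ε) ≤ exp(ζ - 1 - (1 - 1/e)Nε),
which is `measure_risk_gt_le_exp`.

Nondegeneracy is not assumed, so this tail bound comes from counting. Draw N independent blocks of n
samples; a word picks one sample per block, and it is heavy if in every block at least r samples
violate its solution. All words have the same probability of being heavy, so n^N times that
probability is the expected number of heavy words. Risk above ε makes a word heavy with probability
close to one when r/n is near ε and n is large. Hence a deterministic bound b(r/n)·n^N on the number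
of heavy words bounds the tail of the risk by b(ε) (`measure_risk_gt_le`).

Almost surely the sampled constraints form an LP-type problem of dimension ζ, because a minimal
subset with a given value consists of support constraints only. Its heavy words are counted by
linear algebra. A heavy word s has a basis on ζ positions Q. Off Q, its letter can be traded for
violators through a vector whose moments of degree below r vanish, and trading raises the value.
This gives one vector per heavy word, triangular with respect to the value and hence independent,
whose moment transform lies in a space spanned by point masses with fewer than ζ low exponents and
by slices of moment tensors of heavy basis words (`exists_vector_of_heavy`, `card_heavy_le_add`). A
spanning argument on ζ+1 positions shows that enough basis words are not heavy
(`pow_le_sum_card_not_heavy`). With F_k(x) the binomial distribution function at k, the outcome for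
ζ ≥ 1 and N > ζ is b = F_{ζ-1}/(ζ+1) + ζF_ζ/(ζ+1). Dimension one has the better bound (1-x)^N.

It remains to show b(ε) ≤ exp(ζ - 1 - (1 - 1/e)Nε). For ζ ≥ 3, F_ζ alone is small enough, by
induction from ζ = 3; for ζ = 2 the mixture itself is needed. The decrements in N of both sides are
compared: maximizing over N leaves inequalities in x alone, which become polynomial ones
(`key_inequality_three`, `key_inequality_two`). Large x is handled by Chernoff bounds. The cases ζ =
0 and ζ = N = 2 follow from the bound ζ/(N+1) on the expected risk. -/

/-! ### LP-type problems and heavy words. -/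

/-- A monotone map `idx` from finite sets of constraints to a linear order behaves like the optimal
value of an optimization problem of combinatorial dimension at most `ζ`: whether a constraint is
violated depends on the value only, and every value is attained on at most `ζ` constraints. -/
structure IsLPType {Y J : Type*} [DecidableEq Y] [LinearOrder J] (idx : Finset Y → J) (ζ : ℕ) :
    Prop where
  mono : ∀ ⦃T T' : Finset Y⦄, T ⊆ T' → idx T ≤ idx T'
  loc : ∀ ⦃T T' : Finset Y⦄ (y : Y), idx T = idx T' → idx T < idx (insert y T) →
    idx T' < idx (insert y T')
  dim : ∀ T : Finset Y, ∃ B ⊆ T, B.card ≤ ζ ∧ idx B = idx T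

/-- The constraints formed by the letters of the word `s` at the positions in `Q`. -/
def wordSet {κ Λ : Type*} [DecidableEq κ] [DecidableEq Λ] (Q : Finset κ) (s : κ → Λ) :
    Finset (κ × Λ) :=
  Q.image fun k => (k, s k)

/-- Every block contains at least `r` constraints that are violated by the solution of `T`. -/
def Heavy {κ Λ J : Type*} [DecidableEq κ] [DecidableEq Λ] [Fintype Λ] [LinearOrder J]
    (idx : Finset (κ × Λ) → J) (r : ℕ) (T : Finset (κ × Λ)) : Prop :=
  ∀ k : κ, r ≤ (Finset.univ.filter fun i : Λ => idx T < idx (insert (k, i) T)).card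

theorem mem_wordSet {κ Λ : Type*} [DecidableEq κ] [DecidableEq Λ] {Q : Finset κ} {s : κ → Λ}
    {k : κ} {i : Λ} : (k, i) ∈ wordSet Q s ↔ k ∈ Q ∧ s k = i := by
  simp only [wordSet, Finset.mem_image, Prod.mk.injEq]
  constructor
  · rintro ⟨a, ha, rfl, rfl⟩; exact ⟨ha, rfl⟩
  · rintro ⟨h, rfl⟩; exact ⟨k, h, rfl, rfl⟩

theorem wordSet_mono {κ Λ : Type*} [DecidableEq κ] [DecidableEq Λ] {Q Q' : Finset κ} {s : κ → Λ}
    (h : Q ⊆ Q') : wordSet Q s ⊆ wordSet Q' s :=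
  Finset.image_subset_image h

theorem wordSet_congr {κ Λ : Type*} [DecidableEq κ] [DecidableEq Λ] {Q : Finset κ} {s t : κ → Λ}
    (h : ∀ k ∈ Q, s k = t k) : wordSet Q s = wordSet Q t := by
  ext ⟨k, i⟩
  simp only [mem_wordSet]
  constructor
  · rintro ⟨h1, h2⟩; exact ⟨h1, by rw [← h k h1]; exact h2⟩
  · rintro ⟨h1, h2⟩; exact ⟨h1, by rw [h k h1]; exact h2⟩

namespace IsLPType

variable {Y J : Type*} [DecidableEq Y] [LinearOrder J] {idx : Finset Y → J} {ζ : ℕ}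

/-- Locality moves the violation from T to its basis B, and monotonicity from B to any T' containing
B and y. This is how trading a letter for a violator raises the value while a basis is kept. -/
theorem lt_of_violated (h : IsLPType idx ζ) {T B T' : Finset Y} {y : Y} (hB : idx B = idx T)
    (hy : idx T < idx (insert y T)) (hBT' : B ⊆ T') (hyT' : y ∈ T') : idx T < idx T' := by
  rw [← hB]
  exact lt_of_lt_of_le (h.loc y hB.symm hy)
    (h.mono (Finset.insert_subset hyT' hBT'))

end IsLPType

section Heavy

variable {κ Λ J : Type*} [DecidableEq κ] [DecidableEq Λ] [LinearOrder J]
  {idx : Finset (κ × Λ) → J} {ζ r : ℕ}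

/-- Violation depends on the value only. Consequently a heavy and a non-heavy set never share their
value, which turns weak inequalities between values into strict ones below. -/
theorem Heavy.congr [Fintype Λ] (h : IsLPType idx ζ) {T T' : Finset (κ × Λ)} (hTT' : idx T = idx T')
    (hT : Heavy idx r T) : Heavy idx r T' := by
  intro k
  refine (hT k).trans (Finset.card_le_card ?_)
  intro i hi
  simp only [Finset.mem_filter, Finset.mem_univ, true_and] at hi ⊢
  exact h.loc _ hTT' hi

/-- A basis of a word is found on any prescribed number of positions that is large enough. -/
theorem IsLPType.exists_positions (h : IsLPType idx ζ) {P : Finset κ} (s : κ → Λ)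
    (hP : ζ ≤ P.card) : ∃ Q ⊆ P, Q.card = ζ ∧ idx (wordSet Q s) = idx (wordSet P s) := by
  obtain ⟨B, hBs, hBc, hB⟩ := h.dim (wordSet P s)
  have h1 : B.image Prod.fst ⊆ P := by
    intro k hk
    obtain ⟨⟨k', i⟩, hki, rfl⟩ := Finset.mem_image.1 hk
    exact (mem_wordSet.1 (hBs hki)).1
  obtain ⟨Q, hQ1, hQ2, hQ3⟩ := Finset.exists_subsuperset_card_eq h1
    (Finset.card_image_le.trans hBc) hP
  refine ⟨Q, hQ2, hQ3, le_antisymm (h.mono (wordSet_mono hQ2)) ?_⟩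
  rw [← hB]
  refine h.mono fun ⟨k, i⟩ hki => ?_
  exact mem_wordSet.2 ⟨hQ1 (Finset.mem_image.2 ⟨_, hki, rfl⟩), (mem_wordSet.1 (hBs hki)).2⟩

end Heavy

/-! ### Adapted bases, triangular families and vectors with vanishing moments. -/

section LinearAlgebra

/-- Vectors indexed by a finite set have a basis that is adapted to a given ranking. -/
theorem exists_adapted_basis {ι J V : Type*} [Fintype ι] [LinearOrder J] [AddCommGroup V]
    [Module ℝ V] (f : ι → J) (a : ι → V) :
    ∃ S : Finset ι, LinearIndepOn ℝ a (S : Set ι) ∧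
      ∀ i, a i ∈ Submodule.span ℝ (a '' {s | s ∈ S ∧ f i ≤ f s}) := by
  classical
  suffices H : ∀ t : Finset ι, ∃ S ⊆ t, LinearIndepOn ℝ a (S : Set ι) ∧
      ∀ i ∈ t, a i ∈ Submodule.span ℝ (a '' {s | s ∈ S ∧ f i ≤ f s}) by
    obtain ⟨S, -, h1, h2⟩ := H Finset.univ
    exact ⟨S, h1, fun i => h2 i (Finset.mem_univ i)⟩
  intro t
  -- Greedy selection in decreasing order of `f`: each new index has the smallest rank so far, and
  -- its vector is kept only if it lies outside the span of the vectors already chosen.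
  refine Finset.induction_on_min_value f t ⟨∅, subset_rfl, by simp, by simp⟩ ?_
  · intro x s hx hmin ih
    obtain ⟨S, hSs, hli, hsp⟩ := ih
    by_cases hmem : a x ∈ Submodule.span ℝ (a '' (S : Set ι))
    · refine ⟨S, hSs.trans (Finset.subset_insert _ _), hli, ?_⟩
      intro i hi
      rcases Finset.mem_insert.1 hi with rfl | hi
      · refine Submodule.span_mono (Set.image_mono ?_) hmem
        exact fun y hy => ⟨hy, hmin y (hSs hy)⟩
      · exact hsp i hi
    · refine ⟨insert x S, Finset.insert_subset_insert _ hSs, ?_, ?_⟩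
      · rw [Finset.coe_insert]
        exact hli.insert hmem
      · intro i hi
        rcases Finset.mem_insert.1 hi with rfl | hi
        · exact Submodule.subset_span ⟨i, ⟨Finset.mem_insert_self _ _, le_rfl⟩, rfl⟩
        · refine Submodule.span_mono (Set.image_mono ?_) (hsp i hi)
          exact fun y hy => ⟨Finset.mem_insert_of_mem hy.1, hy.2⟩

/-- In a vanishing combination, take an index with nonzero coefficient and least `f (e i)`. At the
coordinate `e i` only that one term survives. -/
theorem linearIndependent_of_triangular {ι β J : Type*} [Finite ι] [LinearOrder J]
    (f : β → J) (e : ι → β) (he : Function.Injective e) (v : ι → β → ℝ)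
    (h1 : ∀ i, v i (e i) = 1)
    (h2 : ∀ i b, v i b ≠ 0 → b = e i ∨ f (e i) < f b) : LinearIndependent ℝ v := by
  classical
  have := Fintype.ofFinite ι
  rw [Fintype.linearIndependent_iff]
  intro c hc
  by_contra! hne
  obtain ⟨i0, hi0⟩ := hne
  obtain ⟨i, hi, hmin⟩ := Finset.exists_min_image (Finset.univ.filter fun i => c i ≠ 0)
    (fun i => f (e i)) ⟨i0, by simpa using hi0⟩
  have h := congrFun hc (e i)
  rw [Finset.sum_apply, Finset.sum_eq_single i] at h
  · simp only [Pi.smul_apply, h1, smul_eq_mul, mul_one, Pi.zero_apply] at h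
    exact (Finset.mem_filter.1 hi).2 h
  · intro j _ hji
    by_contra hne
    simp only [Pi.smul_apply, smul_eq_mul, mul_eq_zero, not_or] at hne
    rcases h2 j (e i) hne.2 with h | h
    · exact hji (he h).symm
    · exact absurd h (not_lt.2 (hmin j (by simpa using hne.1)))
  · simp

/-- The Vandermonde matrix with nodes `0, 1, …, n - 1` has a two-sided inverse. -/
theorem exists_vandermonde_inverse (n : ℕ) : ∃ D : Fin n → Fin n → ℝ,
    (∀ i j : Fin n, ∑ x : Fin n, D x j * ((x : ℕ) : ℝ) ^ (i : ℕ) = if i = j then 1 else 0) ∧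
    (∀ x y : Fin n, ∑ i : Fin n, D x i * ((y : ℕ) : ℝ) ^ (i : ℕ) = if y = x then 1 else 0) := by
  set V := Matrix.vandermonde (fun x : Fin n => ((x : ℕ) : ℝ)) with hV
  have hdet : IsUnit V.det := by
    rw [isUnit_iff_ne_zero, hV, Matrix.det_vandermonde_ne_zero_iff]
    intro a b h
    exact Fin.ext (Nat.cast_injective (R := ℝ) h)
  refine ⟨fun x i => V⁻¹ i x, ?_, ?_⟩
  · intro i j
    have h := congrFun (congrFun (Matrix.nonsing_inv_mul V hdet) j) i
    rw [Matrix.mul_apply, Matrix.one_apply] at h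
    rw [show (if i = j then (1 : ℝ) else 0) = if j = i then 1 else 0 by simp [eq_comm], ← h]
    simp [hV, Matrix.vandermonde_apply]
  · intro x y
    have h := congrFun (congrFun (Matrix.mul_nonsing_inv V hdet) y) x
    rw [Matrix.mul_apply, Matrix.one_apply] at h
    rw [← h]
    exact Finset.sum_congr rfl fun i _ => by simp [hV, Matrix.vandermonde_apply, mul_comm]

/-- A letter can be replaced by letters from any set of `r` other letters, up to a vector that is
orthogonal to the polynomials of degree less than `r`. -/
theorem exists_annihilator {n r : ℕ} (V : Finset (Fin n)) (hV : r ≤ V.card) (x : Fin n)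
    (hx : x ∉ V) : ∃ l : Fin n → ℝ, l x = 1 ∧ (∀ y, l y ≠ 0 → y = x ∨ y ∈ V) ∧
      ∀ i < r, ∑ y, l y * ((y : ℕ) : ℝ) ^ i = 0 := by
  classical
  have hinj : Set.InjOn (fun y : Fin n => ((y : ℕ) : ℝ)) V := by
    intro a _ b _ h
    exact Fin.ext (Nat.cast_injective (R := ℝ) h)
  -- The vector is evaluation at x minus the Lagrange interpolation formula with nodes V, which is
  -- exact on X^i for i < r ≤ |V|.
  refine ⟨fun y => if y = x then 1 else if y ∈ V then
    - (Lagrange.basis V (fun y : Fin n => ((y : ℕ) : ℝ)) y).eval ((x : ℕ) : ℝ) else 0,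
    by simp, ?_, ?_⟩
  · intro y hy
    by_contra! h
    simp [h.1, h.2] at hy
  · intro i hi
    have key : Lagrange.interpolate V (fun y : Fin n => ((y : ℕ) : ℝ))
        (fun y => ((Polynomial.X : Polynomial ℝ) ^ i).eval ((y : ℕ) : ℝ)) = Polynomial.X ^ i := by
      symm
      refine Lagrange.eq_interpolate hinj ?_
      rw [Polynomial.degree_X_pow]
      exact_mod_cast lt_of_lt_of_le hi hV
    have key2 := congrArg (Polynomial.eval ((x : ℕ) : ℝ)) key
    rw [Lagrange.interpolate_apply, Polynomial.eval_finsetSum] at key2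
    simp only [Polynomial.eval_mul, Polynomial.eval_C, Polynomial.eval_pow,
      Polynomial.eval_X] at key2
    rw [← Finset.add_sum_erase _ _ (Finset.mem_univ x)]
    have h3 : ∑ y ∈ Finset.univ.erase x, (if y = x then (1 : ℝ) else if y ∈ V then
        - (Lagrange.basis V (fun y : Fin n => ((y : ℕ) : ℝ)) y).eval ((x : ℕ) : ℝ) else 0) *
        ((y : ℕ) : ℝ) ^ i
        = ∑ y ∈ V, - (((y : ℕ) : ℝ) ^ i *
          (Lagrange.basis V (fun y : Fin n => ((y : ℕ) : ℝ)) y).eval ((x : ℕ) : ℝ)) := by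
      symm
      refine Finset.sum_subset_zero_on_sdiff ?_ ?_ ?_
      · intro y hy
        refine Finset.mem_erase.2 ⟨?_, Finset.mem_univ _⟩
        rintro rfl; exact hx hy
      · intro y hy
        simp only [Finset.mem_sdiff, Finset.mem_erase, Finset.mem_univ, and_true] at hy
        simp [hy.1, hy.2]
      · intro y hy
        have : y ≠ x := by rintro rfl; exact hx hy
        simp only [this, if_false, hy, if_true]
        ring
    rw [h3, Finset.sum_neg_distrib, key2]
    simp

end LinearAlgebra

/-! ### Moment tensors of words, and a lower bound for non-heavy basis words. -/

section Moments

variable {κ J : Type*} [DecidableEq κ] [LinearOrder J] {n r ζ : ℕ}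

/-- Adding the factor `z` at the position `p`. -/
def extendTensor {P : Finset κ} (p : κ) (hp : p ∈ P) (z : Fin r → ℝ) :
    ((P.erase p → Fin r) → ℝ) →ₗ[ℝ] ((P → Fin r) → ℝ) where
  toFun f ρ := f (fun k => ρ ⟨k, Finset.mem_of_mem_erase k.2⟩) * z (ρ ⟨p, hp⟩)
  map_add' f g := by funext ρ; simp [add_mul]
  map_smul' c f := by funext ρ; simp [mul_assoc]

theorem extendTensor_eq_sum {P : Finset κ} (p : κ) (hp : p ∈ P) (z : Fin r → ℝ)
    (f : (P.erase p → Fin r) → ℝ) :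
    extendTensor p hp z f = ∑ i, z i • extendTensor p hp (Pi.single i 1) f := by
  funext ρ
  simp only [extendTensor, LinearMap.coe_mk, AddHom.coe_mk, Finset.sum_apply, Pi.smul_apply,
    smul_eq_mul, Pi.single_apply]
  rw [Finset.sum_eq_single (ρ ⟨p, hp⟩)]
  · simp [mul_comm]
  · intro b _ hb; simp [hb.symm]
  · simp

variable [Fintype κ]

/-- The tensor product over `Q` of the vectors `(1, x, …, x ^ (r - 1))`, where `x = s k`. -/
def momentVec (r : ℕ) (Q : Finset κ) (s : κ → Fin n) (ρ : Q → Fin r) : ℝ :=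
  ∏ k : κ, if h : k ∈ Q then ((s k : ℕ) : ℝ) ^ (ρ ⟨k, h⟩ : ℕ) else 1

theorem momentVec_congr {Q : Finset κ} {s t : κ → Fin n} (h : ∀ k ∈ Q, s k = t k) :
    momentVec r Q s = momentVec r Q t := by
  funext ρ
  refine Finset.prod_congr rfl fun k _ => ?_
  by_cases hk : k ∈ Q
  · simp only [hk, dif_pos, h k hk]
  · simp only [hk, dif_neg, not_false_iff]

theorem momentVec_eq_extendTensor {P : Finset κ} (p : κ) (hp : p ∈ P) (s : κ → Fin n) :
    momentVec r P s = extendTensor p hp (fun i => ((s p : ℕ) : ℝ) ^ (i : ℕ))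
      (momentVec r (P.erase p) s) := by
  funext ρ
  simp only [extendTensor, LinearMap.coe_mk, AddHom.coe_mk, momentVec]
  rw [← Finset.mul_prod_erase _ _ (Finset.mem_univ p),
    ← Finset.mul_prod_erase _ (fun k => if h : k ∈ P.erase p then _ else _) (Finset.mem_univ p)]
  simp only [hp, dif_pos, Finset.mem_erase, ne_eq, not_true_eq_false, false_and, dif_neg,
    not_false_iff, one_mul]
  rw [mul_comm]
  congr 1
  refine Finset.prod_congr rfl fun k hk => ?_
  have hkp : k ≠ p := (Finset.mem_erase.1 hk).1
  by_cases hkP : k ∈ P <;> simp [hkp, hkP]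

theorem momentVec_update {P : Finset κ} (p : κ) (hp : p ∈ P) (s : κ → Fin n) (y : Fin n) :
    momentVec r P (Function.update s p y) = extendTensor p hp (fun i => ((y : ℕ) : ℝ) ^ (i : ℕ))
      (momentVec r (P.erase p) s) := by
  rw [momentVec_eq_extendTensor p hp, Function.update_self]
  congr 1
  exact momentVec_congr fun k hk => Function.update_of_ne (Finset.mem_erase.1 hk).1 _ _

theorem sum_prod_apply_eq (f : κ → Fin n → ℝ) :
    ∑ s : κ → Fin n, ∏ k, f k (s k) = ∏ k, ∑ x, f k x := by
  rw [Finset.prod_univ_sum, Fintype.piFinset_univ]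

/-- Products of columns of the inverse Vandermonde matrix produce the unit tensors. Off Q the column
dual to the constant monomial is used, whose entries sum to 1. -/
theorem span_momentVec (hr : r ≤ n) (hn : 0 < n) (Q : Finset κ) :
    Submodule.span ℝ (Set.range (momentVec (n := n) r Q)) = ⊤ := by
  classical
  obtain ⟨D, hD, -⟩ := exists_vandermonde_inverse n
  rw [eq_top_iff, ← (Pi.basisFun ℝ (Q → Fin r)).span_eq, Submodule.span_le]
  rintro _ ⟨ρ, rfl⟩
  have key : Pi.basisFun ℝ (Q → Fin r) ρ = ∑ s : κ → Fin n,
      (∏ k, if h : k ∈ Q then D (s k) (Fin.castLE hr (ρ ⟨k, h⟩)) else D (s k) ⟨0, hn⟩) •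
        momentVec r Q s := by
    funext τ
    simp only [Finset.sum_apply, Pi.smul_apply, smul_eq_mul, momentVec, ← Finset.prod_mul_distrib]
    rw [sum_prod_apply_eq (fun k x => (if h : k ∈ Q then D x (Fin.castLE hr (ρ ⟨k, h⟩))
      else D x ⟨0, hn⟩) * (if h : k ∈ Q then ((x : ℕ) : ℝ) ^ (τ ⟨k, h⟩ : ℕ) else 1))]
    have : ∀ k, (∑ x, (if h : k ∈ Q then D x (Fin.castLE hr (ρ ⟨k, h⟩))
      else D x ⟨0, hn⟩) * (if h : k ∈ Q then ((x : ℕ) : ℝ) ^ (τ ⟨k, h⟩ : ℕ) else 1))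
        = if h : k ∈ Q then (if τ ⟨k, h⟩ = ρ ⟨k, h⟩ then 1 else 0) else 1 := by
      intro k
      by_cases hk : k ∈ Q
      · simp only [hk, dif_pos]
        have := hD (Fin.castLE hr (τ ⟨k, hk⟩)) (Fin.castLE hr (ρ ⟨k, hk⟩))
        simpa [Fin.ext_iff] using this
      · simp only [hk, dif_neg, not_false_iff]
        have := hD ⟨0, hn⟩ ⟨0, hn⟩
        simpa using this
    rw [Finset.prod_congr rfl fun k _ => this k]
    by_cases hτ : τ = ρ
    · subst hτ
      simp
    · have hne : ∃ k, τ k ≠ ρ k := by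
        by_contra! h; exact hτ (funext h)
      obtain ⟨k, hk⟩ := hne
      rw [Pi.basisFun_apply, Pi.single_apply, if_neg hτ, eq_comm]
      refine Finset.prod_eq_zero (Finset.mem_univ (k : κ)) ?_
      simp [hk]
  rw [key]
  exact Submodule.sum_mem _ fun s _ => Submodule.smul_mem _ _ (Submodule.subset_span ⟨s, rfl⟩)

variable {idx : Finset (κ × Fin n) → J}

open Classical in
/-- The number of basis words with few violated constraints is bounded from below. -/
theorem pow_le_sum_card_not_heavy (hidx : IsLPType idx ζ) (hr : r ≤ n) (hn : 0 < n)
    (S : Finset κ → Finset (κ → Fin n))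
    (hS : ∀ Q s, momentVec r Q s ∈ Submodule.span ℝ (momentVec r Q ''
      {u | u ∈ S Q ∧ idx (wordSet Q s) ≤ idx (wordSet Q u)}))
    (P : Finset κ) (hP : P.card = ζ + 1) :
    r ^ (ζ + 1) ≤ ∑ p ∈ P, ((S (P.erase p)).filter
      fun u => ¬ Heavy idx r (wordSet (P.erase p) u)).card * r := by
  set G : Finset ((P → Fin r) → ℝ) := P.attach.biUnion fun p =>
    ((((S (P.erase p)).filter fun u => ¬ Heavy idx r (wordSet (P.erase p) u)) ×ˢ
      (Finset.univ : Finset (Fin r))).image fun ui =>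
        extendTensor p.1 p.2 (Pi.single ui.2 1) (momentVec r (P.erase p) ui.1)) with hG
  set W := Submodule.span ℝ (G : Set ((P → Fin r) → ℝ)) with hW
  have hmem : ∀ s : κ → Fin n, momentVec r P s ∈ W := by
    -- Every moment tensor on P is shown to lie in W by induction on words in decreasing order of
    -- their value on P.
    have hwf : WellFounded fun s' s : κ → Fin n => idx (wordSet P s) < idx (wordSet P s') :=
      @Finite.wellFounded_of_trans_of_irrefl _ _ _ ⟨fun a b c h1 h2 => lt_trans h2 h1⟩
        ⟨fun a => lt_irrefl _⟩
    intro s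
    induction s using hwf.induction with
    | _ s ih =>
      obtain ⟨Q, hQP, hQc, hQ⟩ := hidx.exists_positions (P := P) s (by omega)
      -- P has one position more than the basis Q, so some p is superfluous: s has the same value on
      -- P and on P without p.
      obtain ⟨p, hpP, hpQ⟩ := Finset.exists_mem_notMem_of_card_lt_card (s := Q) (t := P) (by omega)
      have hQE : Q ⊆ P.erase p := fun k hk =>
        Finset.mem_erase.2 ⟨fun h => hpQ (h ▸ hk), hQP hk⟩
      have hE : idx (wordSet (P.erase p) s) = idx (wordSet P s) :=
        le_antisymm (hidx.mono (wordSet_mono (Finset.erase_subset _ _)))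
          (hQ ▸ hidx.mono (wordSet_mono hQE))
      by_cases hheavy : Heavy idx r (wordSet P s)
      -- The letter at p is traded for violators; the resulting words have larger value and are
      -- covered by induction.
      · obtain ⟨l, hl1, hl2, hl3⟩ := exists_annihilator _ (hheavy p) (s p) (by
          have : insert (p, s p) (wordSet P s) = wordSet P s :=
            Finset.insert_eq_of_mem (mem_wordSet.2 ⟨hpP, rfl⟩)
          simp [this])
        have hsum : ∑ y, l y • momentVec r P (Function.update s p y) = 0 := by
          funext ρ
          simp only [momentVec_update p hpP, Finset.sum_apply, Pi.smul_apply, smul_eq_mul,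
            extendTensor, LinearMap.coe_mk, AddHom.coe_mk, Pi.zero_apply]
          have := hl3 (ρ ⟨p, hpP⟩) (ρ ⟨p, hpP⟩).2
          calc _ = momentVec r (P.erase p) s (fun k => ρ ⟨k, Finset.mem_of_mem_erase k.2⟩) *
                ∑ y, l y * ((y : ℕ) : ℝ) ^ (ρ ⟨p, hpP⟩ : ℕ) := by
                rw [Finset.mul_sum]
                exact Finset.sum_congr rfl fun y _ => by ring
            _ = 0 := by rw [this, mul_zero]
        rw [← Finset.add_sum_erase _ _ (Finset.mem_univ (s p)), hl1, one_smul,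
          Function.update_eq_self] at hsum
        rw [eq_neg_of_add_eq_zero_left hsum]
        refine Submodule.neg_mem _ (Submodule.sum_mem _ fun y hy => ?_)
        by_cases hly : l y = 0
        · rw [hly, zero_smul]; exact Submodule.zero_mem _
        · refine Submodule.smul_mem _ _ (ih _ ?_)
          have hyV := (hl2 y hly).resolve_left (Finset.mem_erase.1 hy).1
          refine hidx.lt_of_violated hE (Finset.mem_filter.1 hyV).2 ?_
            (mem_wordSet.2 ⟨hpP, Function.update_self _ _ _⟩)
          rw [wordSet_congr (t := Function.update s p y)]
          · exact wordSet_mono (Finset.erase_subset _ _)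
          · intro k hk
            exact (Function.update_of_ne (Finset.mem_erase.1 hk).1 _ _).symm
      -- The factor on P without p is expanded in the adapted basis. Non-heavy basis words give
      -- generators of W. A heavy one cannot have the value of the non-heavy s, so its value is
      -- strictly larger and induction applies after writing the letter of s at p.
      · rw [momentVec_eq_extendTensor p hpP]
        have hle : Submodule.span ℝ (momentVec r (P.erase p) ''
            {u | u ∈ S (P.erase p) ∧ idx (wordSet (P.erase p) s) ≤ idx (wordSet (P.erase p) u)})
            ≤ W.comap (extendTensor p hpP fun i => ((s p : ℕ) : ℝ) ^ (i : ℕ)) := by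
          rw [Submodule.span_le]
          rintro _ ⟨u, ⟨hu1, hu2⟩, rfl⟩
          show extendTensor p hpP _ _ ∈ W
          by_cases huh : Heavy idx r (wordSet (P.erase p) u)
          · rw [← momentVec_update]
            refine ih _ ?_
            rw [hE] at hu2
            refine lt_of_lt_of_le (lt_of_le_of_ne hu2 fun h => hheavy (huh.congr hidx h.symm)) ?_
            rw [wordSet_congr (t := Function.update u p (s p))]
            · exact hidx.mono (wordSet_mono (Finset.erase_subset _ _))
            · intro k hk
              exact (Function.update_of_ne (Finset.mem_erase.1 hk).1 _ _).symm
          · rw [extendTensor_eq_sum]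
            refine Submodule.sum_mem _ fun i _ => Submodule.smul_mem _ _ (Submodule.subset_span ?_)
            rw [hG, Finset.mem_coe, Finset.mem_biUnion]
            refine ⟨⟨p, hpP⟩, Finset.mem_attach _ _, Finset.mem_image.2 ⟨(u, i), ?_, rfl⟩⟩
            exact Finset.mem_product.2 ⟨Finset.mem_filter.2 ⟨hu1, huh⟩, Finset.mem_univ _⟩
        exact hle (hS _ _)
  have htop : W = ⊤ := by
    rw [eq_top_iff, ← span_momentVec hr hn P, Submodule.span_le]
    rintro _ ⟨s, rfl⟩
    exact hmem s
  have hcard : r ^ (ζ + 1) ≤ G.card := by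
    have h1 := finrank_span_finset_le_card (R := ℝ) G
    rw [Set.finrank, ← hW, htop, finrank_top, Module.finrank_fintype_fun_eq_card, Fintype.card_fun,
      Fintype.card_fin, Fintype.card_coe, hP] at h1
    exact h1
  refine hcard.trans (Finset.card_biUnion_le.trans ?_)
  rw [← Finset.sum_attach P]
  refine Finset.sum_le_sum fun p _ => ?_
  refine Finset.card_image_le.trans ?_
  rw [Finset.card_product, Finset.card_univ, Fintype.card_fin]

end Moments

/-! ### Counting heavy words. -/

section Counting

variable {κ J : Type*} [Fintype κ] [DecidableEq κ] [LinearOrder J] {n r ζ : ℕ}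

/-- Double counting of pairs (P, p) with p in P: each ζ-set arises from P by erasing one of its card
κ - ζ outside points. -/
theorem sum_powersetCard_succ_erase (f : Finset κ → ℕ) :
    ∑ P ∈ Finset.powersetCard (ζ + 1) (Finset.univ : Finset κ), ∑ p ∈ P, f (P.erase p)
      = ∑ Q ∈ Finset.powersetCard ζ (Finset.univ : Finset κ), (Fintype.card κ - ζ) * f Q := by
  have h1 : ∀ Q ∈ Finset.powersetCard ζ (Finset.univ : Finset κ),
      (Fintype.card κ - ζ) * f Q = ∑ _p ∈ Qᶜ, f Q := by
    intro Q hQ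
    rw [Finset.sum_const, Finset.card_compl, (Finset.mem_powersetCard.1 hQ).2, smul_eq_mul]
  rw [Finset.sum_congr rfl h1, Finset.sum_sigma', Finset.sum_sigma']
  refine Finset.sum_bij' (fun x _ => ⟨x.1.erase x.2, x.2⟩) (fun x _ => ⟨insert x.2 x.1, x.2⟩)
    ?_ ?_ ?_ ?_ ?_
  · rintro ⟨P, p⟩ h
    simp only [Finset.mem_sigma, Finset.mem_powersetCard, Finset.subset_univ, true_and] at h
    simp only [Finset.mem_sigma, Finset.mem_powersetCard, Finset.subset_univ, true_and,
      Finset.mem_compl, Finset.mem_erase, ne_eq, not_true_eq_false, false_and, not_false_iff,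
      and_true]
    rw [Finset.card_erase_of_mem h.2, h.1, Nat.add_sub_cancel]
  · rintro ⟨Q, p⟩ h
    simp only [Finset.mem_sigma, Finset.mem_powersetCard, Finset.subset_univ, true_and,
      Finset.mem_compl] at h
    simp only [Finset.mem_sigma, Finset.mem_powersetCard, Finset.subset_univ, true_and,
      Finset.mem_insert_self, and_true]
    rw [Finset.card_insert_of_notMem h.2, h.1]
  · rintro ⟨P, p⟩ h
    simp only [Finset.mem_sigma] at h
    simp [Finset.insert_erase h.2]
  · rintro ⟨Q, p⟩ h
    simp only [Finset.mem_sigma, Finset.mem_compl] at h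
    simp [Finset.erase_insert h.2]
  · intro _ _; rfl

/-- The positions of a word whose letters are among the first `r` ones. -/
def lowPositions (r : ℕ) (ρ : κ → Fin n) : Finset κ :=
  Finset.univ.filter fun k => (ρ k : ℕ) < r

theorem card_lowPositions_eq (hr : r ≤ n) (Q : Finset κ) :
    (Finset.univ.filter fun ρ : κ → Fin n => lowPositions r ρ = Q).card
      = r ^ Q.card * (n - r) ^ (Fintype.card κ - Q.card) := by
  have h1 : (Finset.univ.filter fun ρ : κ → Fin n => lowPositions r ρ = Q) =
      Fintype.piFinset fun k => if k ∈ Q then Finset.univ.filter fun i : Fin n => (i : ℕ) < r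
        else Finset.univ.filter fun i : Fin n => ¬ (i : ℕ) < r := by
    ext ρ
    simp only [Finset.mem_filter, Finset.mem_univ, true_and, Fintype.mem_piFinset,
      Finset.ext_iff, lowPositions]
    refine forall_congr' fun k => ?_
    by_cases hk : k ∈ Q <;> simp [hk]
  have h2 : (Finset.univ.filter fun i : Fin n => (i : ℕ) < r).card = r := by
    rw [Fin.card_filter_val_lt, min_eq_right hr]
  have h3 : (Finset.univ.filter fun i : Fin n => ¬ (i : ℕ) < r).card = n - r := by
    have := Finset.card_filter_add_card_filter_not (s := (Finset.univ : Finset (Fin n)))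
      (fun i : Fin n => (i : ℕ) < r)
    rw [h2, Finset.card_univ, Fintype.card_fin] at this
    omega
  rw [h1, Fintype.card_piFinset]
  have h4 : ∀ k : κ, (if k ∈ Q then Finset.univ.filter fun i : Fin n => (i : ℕ) < r
        else Finset.univ.filter fun i : Fin n => ¬ (i : ℕ) < r).card
        = if k ∈ Q then r else n - r := by
    intro k; by_cases hk : k ∈ Q
    · simp only [hk, if_true, h2]
    · simp only [hk, if_false, h3]
  rw [Finset.prod_congr rfl fun k _ => h4 k, Finset.prod_ite, Finset.prod_const, Finset.prod_const]
  congr 2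
  · simp
  · rw [← Finset.card_compl]; congr 1; ext; simp

theorem card_lowPositions_lt (hr : r ≤ n) :
    (Finset.univ.filter fun ρ : κ → Fin n => (lowPositions r ρ).card < ζ).card
      = ∑ d ∈ Finset.range ζ, (Fintype.card κ).choose d * (r ^ d *
          (n - r) ^ (Fintype.card κ - d)) := by
  classical
  rw [Finset.card_eq_sum_card_fiberwise (f := lowPositions r)
    (t := (Finset.range ζ).biUnion fun d => Finset.powersetCard d Finset.univ)]
  · rw [Finset.sum_biUnion]
    · refine Finset.sum_congr rfl fun d hd => ?_
      have : ∀ Q ∈ Finset.powersetCard d (Finset.univ : Finset κ),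
          ((Finset.univ.filter fun ρ : κ → Fin n => (lowPositions r ρ).card < ζ).filter
            fun ρ => lowPositions r ρ = Q).card = r ^ d * (n - r) ^ (Fintype.card κ - d) := by
        intro Q hQ
        have hQd := (Finset.mem_powersetCard.1 hQ).2
        rw [← hQd, ← card_lowPositions_eq hr Q, Finset.filter_filter]
        congr 1
        ext ρ
        simp only [Finset.mem_filter, Finset.mem_univ, true_and, and_iff_right_iff_imp]
        rintro rfl
        rw [hQd]; exact Finset.mem_range.1 hd
      rw [Finset.sum_congr rfl this, Finset.sum_const, Finset.card_powersetCard, smul_eq_mul,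
        Finset.card_univ]
    · intro a _ b _ hab
      exact Finset.pairwise_disjoint_powersetCard _ hab
  · intro ρ hρ
    simp only [Finset.coe_filter, Finset.mem_univ, true_and, Set.mem_ofPred_eq] at hρ
    simp only [Finset.coe_biUnion, Set.mem_iUnion, Finset.mem_coe, Finset.mem_range,
      Finset.mem_powersetCard, Finset.subset_univ, true_and, exists_prop]
    exact ⟨_, hρ, rfl⟩

/-- The multivariate moment transform. -/
def momentTransform : ((κ → Fin n) → ℝ) →ₗ[ℝ] ((κ → Fin n) → ℝ) where
  toFun v ρ := ∑ τ, v τ * ∏ k, ((τ k : ℕ) : ℝ) ^ (ρ k : ℕ)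
  map_add' f g := by funext ρ; simp [add_mul, Finset.sum_add_distrib]
  map_smul' c f := by funext ρ; simp [mul_assoc, Finset.mul_sum]

/-- The transform is a tensor power of the Vandermonde matrix, so the tensor power of the inverse
undoes it. -/
theorem momentTransform_injective :
    Function.Injective (momentTransform (κ := κ) (n := n)) := by
  obtain ⟨D, -, hD⟩ := exists_vandermonde_inverse n
  rw [injective_iff_map_eq_zero]
  intro v hv
  funext σ
  have h : ∑ ρ : κ → Fin n, (∏ k, D (σ k) (ρ k)) * momentTransform v ρ = v σ := by
    simp only [momentTransform, LinearMap.coe_mk, AddHom.coe_mk, Finset.mul_sum]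
    rw [Finset.sum_comm]
    have : ∀ τ : κ → Fin n, ∑ ρ : κ → Fin n, (∏ k, D (σ k) (ρ k)) *
        (v τ * ∏ k, ((τ k : ℕ) : ℝ) ^ (ρ k : ℕ)) = v τ * if τ = σ then 1 else 0 := by
      intro τ
      have h1 : ∀ ρ : κ → Fin n, (∏ k, D (σ k) (ρ k)) *
        (v τ * ∏ k, ((τ k : ℕ) : ℝ) ^ (ρ k : ℕ)) =
          v τ * ∏ k, (D (σ k) (ρ k) * ((τ k : ℕ) : ℝ) ^ (ρ k : ℕ)) := by
        intro ρ; rw [Finset.prod_mul_distrib]; ring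
      rw [Finset.sum_congr rfl fun ρ _ => h1 ρ, ← Finset.mul_sum,
        sum_prod_apply_eq fun k i => D (σ k) i * ((τ k : ℕ) : ℝ) ^ (i : ℕ),
        Finset.prod_congr rfl fun k _ => hD (σ k) (τ k)]
      congr 1
      by_cases hτ : τ = σ
      · subst hτ; simp
      · rw [if_neg hτ]
        have hne : ∃ k, τ k ≠ σ k := by
          by_contra! h; exact hτ (funext h)
        obtain ⟨k, hk⟩ := hne
        exact Finset.prod_eq_zero (Finset.mem_univ k) (by simp [hk])
    rw [Finset.sum_congr rfl fun τ _ => this τ]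
    simp
  rw [← h, hv]
  simp

theorem momentTransform_prod (f : κ → Fin n → ℝ) (ρ : κ → Fin n) :
    momentTransform (fun τ => ∏ k, f k (τ k)) ρ = ∏ k, ∑ x, f k x * ((x : ℕ) : ℝ) ^ (ρ k : ℕ) := by
  simp only [momentTransform, LinearMap.coe_mk, AddHom.coe_mk, ← Finset.prod_mul_distrib]
  exact sum_prod_apply_eq fun k x => f k x * ((x : ℕ) : ℝ) ^ (ρ k : ℕ)

/-- Extension by zero of a tensor on the positions in `Q`, the letters off `Q` being fixed. -/
def slice (Q : Finset κ) (η : (Qᶜ : Finset κ) → {i : Fin n // r ≤ (i : ℕ)}) :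
    ((Q → Fin r) → ℝ) →ₗ[ℝ] ((κ → Fin n) → ℝ) where
  toFun f ρ := if h : ∀ k : Q, (ρ k : ℕ) < r then
    (if ∀ k : (Qᶜ : Finset κ), ρ k = η k then f (fun k => ⟨ρ k, h k⟩) else 0) else 0
  map_add' f g := by
    funext ρ
    simp only [Pi.add_apply]
    split_ifs <;> simp
  map_smul' c f := by
    funext ρ
    simp only [Pi.smul_apply, RingHom.id_apply]
    split_ifs <;> simp

end Counting

section Counting

variable {κ J : Type*} [Fintype κ] [DecidableEq κ] [LinearOrder J] {n r ζ : ℕ}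
  {idx : Finset (κ × Fin n) → J}

/-- The value at `ρ` of the transform of a product of point masses (on `Q`) and of vectors `l`. -/
theorem momentTransform_single_mul (Q : Finset κ) (l : κ → Fin n → ℝ) (u ρ : κ → Fin n) :
    momentTransform (fun τ => ∏ k, if k ∈ Q then Pi.single (M := fun _ => ℝ) (u k) 1 (τ k)
        else l k (τ k)) ρ
      = (∏ k, if k ∈ Q then ((u k : ℕ) : ℝ) ^ (ρ k : ℕ) else 1) *
        ∏ k, if k ∈ Q then 1 else ∑ x, l k x * ((x : ℕ) : ℝ) ^ (ρ k : ℕ) := by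
  rw [momentTransform_prod fun k x => if k ∈ Q then Pi.single (M := fun _ => ℝ) (u k) 1 x
        else l k x, ← Finset.prod_mul_distrib]
  refine Finset.prod_congr rfl fun k _ => ?_
  by_cases hk : k ∈ Q
  · simp [hk, Pi.single_apply]
  · simp [hk]

open Classical in
/-- For a heavy word there is a vector that is triangular with respect to `idx`, and whose transform
lies in a small space. -/
theorem exists_vector_of_heavy (hidx : IsLPType idx ζ) (hζ : ζ ≤ Fintype.card κ)
    (S : Finset κ → Finset (κ → Fin n))
    (hS : ∀ Q s, momentVec r Q s ∈ Submodule.span ℝ (momentVec r Q ''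
      {u | u ∈ S Q ∧ idx (wordSet Q s) ≤ idx (wordSet Q u)}))
    (W : Submodule ℝ ((κ → Fin n) → ℝ))
    (hW1 : ∀ ρ : κ → Fin n, (lowPositions r ρ).card < ζ → Pi.single ρ 1 ∈ W)
    (hW2 : ∀ Q : Finset κ, Q.card = ζ → ∀ u ∈ S Q, Heavy idx r (wordSet Q u) →
      ∀ η, slice Q η (momentVec r Q u) ∈ W)
    (s : κ → Fin n) (hs : Heavy idx r (wordSet Finset.univ s)) :
    ∃ v : (κ → Fin n) → ℝ, v s = 1 ∧ (∀ τ, v τ ≠ 0 → τ = s ∨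
      idx (wordSet Finset.univ s) < idx (wordSet Finset.univ τ)) ∧ momentTransform v ∈ W := by
  obtain ⟨Q, -, hQc, hQ⟩ := hidx.exists_positions (P := Finset.univ) s
    (by rwa [Finset.card_univ])
  have hsQ : Heavy idx r (wordSet Q s) := hs.congr hidx hQ.symm
  have hl : ∀ k, ∃ l : Fin n → ℝ, l (s k) = 1 ∧ (∀ y, l y ≠ 0 → y = s k ∨
      idx (wordSet Finset.univ s) < idx (insert (k, y) (wordSet Finset.univ s))) ∧
      ∀ i < r, ∑ y, l y * ((y : ℕ) : ℝ) ^ i = 0 := by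
    intro k
    obtain ⟨l, h1, h2, h3⟩ := exists_annihilator _ (hs k) (s k) (by
      have : insert (k, s k) (wordSet Finset.univ s) = wordSet Finset.univ s :=
        Finset.insert_eq_of_mem (mem_wordSet.2 ⟨Finset.mem_univ _, rfl⟩)
      simp [this])
    exact ⟨l, h1, fun y hy => by simpa using h2 y hy, h3⟩
  choose l hl1 hl2 hl3 using hl
  have hspan := hS Q s
  rw [show {u | u ∈ S Q ∧ idx (wordSet Q s) ≤ idx (wordSet Q u)} = (((S Q).filter fun u =>
    idx (wordSet Q s) ≤ idx (wordSet Q u) : Finset (κ → Fin n)) : Set (κ → Fin n)) by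
      ext u; simp] at hspan
  obtain ⟨c, hc⟩ := (Submodule.mem_span_image_finset_iff_exists_fun' ℝ).1 hspan
  set T := (S Q).filter fun u => idx (wordSet Q s) ≤ idx (wordSet Q u) with hT
  set T1 := T.filter fun u => Heavy idx r (wordSet Q u) with hT1
  set T2 := T.filter fun u => ¬ Heavy idx r (wordSet Q u) with hT2
  -- On Q the vector `e u` is the point mass at u; off Q it is the product of the annihilators `l
  -- k`. Its transform vanishes at every ρ that has a low position outside Q.
  set e : (κ → Fin n) → (κ → Fin n) → ℝ := fun u τ =>
    ∏ k, if k ∈ Q then Pi.single (M := fun _ => ℝ) (u k) 1 (τ k) else l k (τ k) with he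
  have he0 : ∀ u τ, e u τ ≠ 0 → (∀ k ∈ Q, τ k = u k) ∧ ∀ k ∉ Q, l k (τ k) ≠ 0 := by
    intro u τ h
    simp only [he, Finset.prod_ne_zero_iff, Finset.mem_univ, forall_true_left] at h
    refine ⟨fun k hk => ?_, fun k hk => ?_⟩
    · by_contra hne
      have := h k
      simp [hk, hne] at this
    · have := h k
      simpa [hk] using this
  have hT2lt : ∀ u ∈ T2, idx (wordSet Q s) < idx (wordSet Q u) := by
    intro u hu
    have hu' := Finset.mem_filter.1 hu
    refine lt_of_le_of_ne (Finset.mem_filter.1 hu'.1).2 fun h => hu'.2 (hsQ.congr hidx h)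
  -- Expanding the moment tensor of s on Q in the adapted basis, the non-heavy basis words are
  -- subtracted. They have strictly larger value than s, so triangularity survives, and only slices
  -- of heavy basis words remain in the transform.
  refine ⟨e s - ∑ u ∈ T2, c u • e u, ?_, ?_, ?_⟩
  · have h1 : e s s = 1 := by
      refine Finset.prod_eq_one fun k _ => ?_
      by_cases hk : k ∈ Q <;> simp [hk, hl1]
    rw [Pi.sub_apply, h1, Finset.sum_apply, Finset.sum_eq_zero, sub_zero]
    intro u hu
    rw [Pi.smul_apply, smul_eq_mul]
    by_contra hne
    have h2 := (he0 u s (right_ne_zero_of_mul hne)).1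
    exact (Finset.mem_filter.1 hu).2 (wordSet_congr h2 ▸ hsQ)
  · intro τ hτ
    by_cases h1 : e s τ = 0
    · rw [Pi.sub_apply, h1, Finset.sum_apply, zero_sub, neg_ne_zero] at hτ
      obtain ⟨u, hu, hne⟩ := Finset.exists_ne_zero_of_sum_ne_zero hτ
      rw [Pi.smul_apply, smul_eq_mul] at hne
      have h2 := (he0 u τ (right_ne_zero_of_mul hne)).1
      right
      rw [← hQ]
      refine lt_of_lt_of_le (hT2lt u hu) ?_
      rw [← wordSet_congr h2]
      exact hidx.mono (wordSet_mono (Finset.subset_univ _))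
    · obtain ⟨h2, h3⟩ := he0 s τ h1
      by_cases h4 : ∀ k, k ∉ Q → τ k = s k
      · left
        funext k
        by_cases hk : k ∈ Q
        · exact h2 k hk
        · exact h4 k hk
      · push Not at h4
        obtain ⟨k, hk, hne⟩ := h4
        right
        refine hidx.lt_of_violated hQ ((hl2 k _ (h3 k hk)).resolve_left hne) ?_
          (mem_wordSet.2 ⟨Finset.mem_univ _, rfl⟩)
        rw [← wordSet_congr h2]
        exact wordSet_mono (Finset.subset_univ _)
  · set φ := momentTransform (e s - ∑ u ∈ T2, c u • e u) with hφ
    set ψ : (κ → Fin n) → ℝ := ∑ η : (Qᶜ : Finset κ) → {i : Fin n // r ≤ (i : ℕ)},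
      (∏ k : (Qᶜ : Finset κ), ∑ x, l k x * ((x : ℕ) : ℝ) ^ ((η k).1 : ℕ)) •
        slice Q η (∑ u ∈ T1, c u • momentVec r Q u) with hψ
    have hψW : ψ ∈ W := by
      refine Submodule.sum_mem _ fun η _ => Submodule.smul_mem _ _ ?_
      rw [map_sum]
      refine Submodule.sum_mem _ fun u hu => ?_
      rw [map_smul]
      have hu' := Finset.mem_filter.1 hu
      exact Submodule.smul_mem _ _ (hW2 Q hQc u (Finset.mem_filter.1 hu'.1).1 hu'.2 η)
    -- If at least ζ positions of ρ are low, then either they are exactly Q, where the transform is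
    -- a slice by the expansion of the moment tensor, or one lies off Q and both sides vanish. Hence
    -- φ - ψ is a combination of the point masses allowed by `hW1`.
    have hdiff : ∀ ρ : κ → Fin n, ¬ (lowPositions r ρ).card < ζ → (φ - ψ) ρ = 0 := by
      intro ρ hρ
      have hφρ : φ ρ = ((∏ k, if k ∈ Q then ((s k : ℕ) : ℝ) ^ (ρ k : ℕ) else 1) -
          ∑ u ∈ T2, c u * ∏ k, if k ∈ Q then ((u k : ℕ) : ℝ) ^ (ρ k : ℕ) else 1) *
          ∏ k, if k ∈ Q then 1 else ∑ x, l k x * ((x : ℕ) : ℝ) ^ (ρ k : ℕ) := by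
        rw [hφ, map_sub, map_sum, Pi.sub_apply, Finset.sum_apply, sub_mul, Finset.sum_mul]
        congr 1
        · exact momentTransform_single_mul Q l s ρ
        · refine Finset.sum_congr rfl fun u _ => ?_
          rw [map_smul, Pi.smul_apply, smul_eq_mul, mul_assoc]
          congr 1
          exact momentTransform_single_mul Q l u ρ
      rw [Pi.sub_apply, sub_eq_zero, hφρ, hψ, Finset.sum_apply]
      by_cases hsub : lowPositions r ρ ⊆ Q
      · have hZ : lowPositions r ρ = Q :=
          Finset.eq_of_subset_of_card_le hsub (by omega)
        have hlow : ∀ k : Q, (ρ k : ℕ) < r := by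
          intro k
          have h : (k : κ) ∈ lowPositions r ρ := by rw [hZ]; exact k.2
          exact (Finset.mem_filter.1 h).2
        have hhigh : ∀ k : (Qᶜ : Finset κ), r ≤ (ρ k : ℕ) := by
          intro k
          by_contra h
          refine Finset.mem_compl.1 k.2 ?_
          have h' : (k : κ) ∈ lowPositions r ρ :=
            Finset.mem_filter.2 ⟨Finset.mem_univ _, not_le.1 h⟩
          exact hsub h'
        set η₀ : (Qᶜ : Finset κ) → {i : Fin n // r ≤ (i : ℕ)} := fun k => ⟨ρ k, hhigh k⟩ with hη₀
        set ρ' : Q → Fin r := fun k => ⟨ρ k, hlow k⟩ with hρ'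
        have hmv : ∀ u : κ → Fin n, (∏ k, if k ∈ Q then ((u k : ℕ) : ℝ) ^ (ρ k : ℕ) else 1)
            = momentVec r Q u ρ' := by
          intro u
          refine Finset.prod_congr rfl fun k _ => ?_
          by_cases hk : k ∈ Q <;> simp [hk, hρ']
        rw [Finset.sum_eq_single η₀]
        · have h5 : (∏ k : (Qᶜ : Finset κ), ∑ x, l k x * ((x : ℕ) : ℝ) ^ ((η₀ k).1 : ℕ))
              = ∏ k, if k ∈ Q then 1 else ∑ x, l k x * ((x : ℕ) : ℝ) ^ (ρ k : ℕ) := by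
            rw [Finset.prod_coe_sort Qᶜ fun k => ∑ x, l k x * ((x : ℕ) : ℝ) ^ (ρ k : ℕ)]
            rw [← Finset.prod_subset (Finset.subset_univ Qᶜ)]
            · exact Finset.prod_congr rfl fun k hk => by rw [if_neg (Finset.mem_compl.1 hk)]
            · intro k _ hk
              rw [if_pos (by simpa using hk)]
          have h6 : slice Q η₀ (∑ u ∈ T1, c u • momentVec r Q u) ρ
              = ∑ u ∈ T1, c u * momentVec r Q u ρ' := by
            simp only [slice, LinearMap.coe_mk, AddHom.coe_mk, dif_pos hlow, Finset.sum_apply,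
              Pi.smul_apply, smul_eq_mul, hρ']
            exact if_pos fun _ => rfl
          rw [Pi.smul_apply, smul_eq_mul, h6, h5, mul_comm]
          congr 1
          rw [hmv s, Finset.sum_congr rfl fun u _ => by rw [hmv u], ← congrFun hc ρ',
            Finset.sum_apply, ← Finset.sum_filter_add_sum_filter_not T
              (fun u => Heavy idx r (wordSet Q u))]
          simp [hT1, hT2]
        · intro η _ hη
          rw [Pi.smul_apply, smul_eq_mul]
          refine mul_eq_zero_of_right _ ?_
          simp only [slice, LinearMap.coe_mk, AddHom.coe_mk, dif_pos hlow]
          rw [if_neg]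
          intro h
          exact hη (funext fun k => Subtype.ext (h k).symm)
        · intro h; exact absurd (Finset.mem_univ _) h
      · obtain ⟨k, hk, hkQ⟩ := Finset.not_subset.1 hsub
        have hkr := (Finset.mem_filter.1 hk).2
        rw [mul_eq_zero_of_right, Finset.sum_eq_zero]
        · intro η _
          rw [Pi.smul_apply, smul_eq_mul]
          refine mul_eq_zero_of_right _ ?_
          simp only [slice, LinearMap.coe_mk, AddHom.coe_mk]
          split_ifs with h1 h2
          · have h3 := h2 ⟨k, Finset.mem_compl.2 hkQ⟩
            have h4 := (η ⟨k, Finset.mem_compl.2 hkQ⟩).2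
            rw [← h3] at h4
            exact absurd hkr (not_lt.2 h4)
          · rfl
          · rfl
        · refine Finset.prod_eq_zero (Finset.mem_univ k) ?_
          rw [if_neg hkQ, hl3 k _ hkr]
    have hφeq : φ = ψ + ∑ ρ, (φ - ψ) ρ • (Pi.single ρ (1 : ℝ) : (κ → Fin n) → ℝ) := by
      funext τ
      simp [Finset.sum_apply, Pi.single_apply]
    rw [hφeq]
    refine Submodule.add_mem _ hψW (Submodule.sum_mem _ fun ρ _ => ?_)
    by_cases h : (lowPositions r ρ).card < ζ
    · exact Submodule.smul_mem _ _ (hW1 ρ h)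
    · rw [hdiff ρ h, zero_smul]; exact Submodule.zero_mem _

end Counting

section Counting

variable {κ J : Type*} [Fintype κ] [DecidableEq κ] [LinearOrder J] {n r ζ : ℕ}
  {idx : Finset (κ × Fin n) → J}

open Classical in
/-- The number of heavy words for problems of dimension one. -/
theorem card_heavy_le_of_dim_one (hidx : IsLPType idx 1) :
    (Finset.univ.filter fun s : κ → Fin n => Heavy idx r (wordSet Finset.univ s)).card
      ≤ (n - r) ^ Fintype.card κ := by
  set G : κ → Finset (Fin n) := fun k => Finset.univ.filter fun i =>
    r ≤ (Finset.univ.filter fun i' : Fin n => idx {(k, i)} < idx {(k, i')}).card with hG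
  have hGc : ∀ k, (G k).card ≤ n - r := by
    intro k
    rcases (G k).eq_empty_or_nonempty with h0 | hne
    · simp [h0]
    -- The r letters ranked above a best element of `G k` all lie outside `G k`.
    · obtain ⟨i, hi, hmax⟩ := Finset.exists_max_image (G k) (fun i => idx {(k, i)}) hne
      have hdisj : Disjoint (G k)
          (Finset.univ.filter fun i' : Fin n => idx {(k, i)} < idx {(k, i')}) := by
        rw [Finset.disjoint_left]
        intro j hj hj'
        exact absurd (Finset.mem_filter.1 hj').2 (not_lt.2 (hmax j hj))
      have h1 := Finset.card_le_univ (G k ∪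
        (Finset.univ.filter fun i' : Fin n => idx {(k, i)} < idx {(k, i')}))
      rw [Finset.card_union_of_disjoint hdisj, Fintype.card_fin] at h1
      have h2 := (Finset.mem_filter.1 hi).2
      omega
  have hsub : (Finset.univ.filter fun s : κ → Fin n => Heavy idx r (wordSet Finset.univ s))
      ⊆ Fintype.piFinset G := by
    intro s hs
    have hs' := (Finset.mem_filter.1 hs).2
    rw [Fintype.mem_piFinset]
    intro k
    refine Finset.mem_filter.2 ⟨Finset.mem_univ _, (hs' k).trans (Finset.card_le_card ?_)⟩
    intro i hi
    have hi' := (Finset.mem_filter.1 hi).2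
    refine Finset.mem_filter.2 ⟨Finset.mem_univ _, ?_⟩
    -- A basis of a violated word plus its violator must contain the violator; in dimension one it
    -- is nothing else. Thus violators of the word have a larger singleton value than the letter of
    -- the word in their block.
    obtain ⟨B, hBs, hBc, hB⟩ := hidx.dim (insert (k, i) (wordSet Finset.univ s))
    have hmem : (k, i) ∈ B := by
      by_contra hn
      have : B ⊆ wordSet Finset.univ s := fun y hy =>
        (Finset.mem_insert.1 (hBs hy)).resolve_left fun h => hn (h ▸ hy)
      exact absurd hi' (not_lt.2 (hB ▸ hidx.mono this))
    have hBe : B = {(k, i)} := by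
      rw [Finset.card_le_one] at hBc
      ext y
      rw [Finset.mem_singleton]
      exact ⟨fun hy => hBc y hy _ hmem, fun h => h ▸ hmem⟩
    rw [← hBe, hB]
    refine lt_of_le_of_lt (hidx.mono ?_) hi'
    rw [Finset.singleton_subset_iff]
    exact mem_wordSet.2 ⟨Finset.mem_univ _, rfl⟩
  refine (Finset.card_le_card hsub).trans ?_
  rw [Fintype.card_piFinset]
  exact (Finset.prod_le_pow_card _ _ _ fun k _ => hGc k).trans_eq (by rw [Finset.card_univ])

open Classical in
/-- The number of heavy words is bounded by means of the number of heavy basis words. -/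
theorem card_heavy_le_add (hidx : IsLPType idx ζ) (hr : r ≤ n) (hζ : ζ ≤ Fintype.card κ)
    (S : Finset κ → Finset (κ → Fin n))
    (hS : ∀ Q s, momentVec r Q s ∈ Submodule.span ℝ (momentVec r Q ''
      {u | u ∈ S Q ∧ idx (wordSet Q s) ≤ idx (wordSet Q u)})) :
    (Finset.univ.filter fun s : κ → Fin n => Heavy idx r (wordSet Finset.univ s)).card
      ≤ (∑ d ∈ Finset.range ζ, (Fintype.card κ).choose d * (r ^ d *
          (n - r) ^ (Fintype.card κ - d))) +
        (∑ Q ∈ Finset.powersetCard ζ (Finset.univ : Finset κ),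
          ((S Q).filter fun u => Heavy idx r (wordSet Q u)).card) *
            (n - r) ^ (Fintype.card κ - ζ) := by
  set G1 : Finset ((κ → Fin n) → ℝ) := (Finset.univ.filter fun ρ : κ → Fin n =>
    (lowPositions r ρ).card < ζ).image fun ρ => Pi.single ρ 1 with hG1
  set G2 : Finset ((κ → Fin n) → ℝ) := (Finset.powersetCard ζ (Finset.univ : Finset κ)).biUnion
    fun Q => (((S Q).filter fun u => Heavy idx r (wordSet Q u)) ×ˢ
      (Finset.univ : Finset ((Qᶜ : Finset κ) → {i : Fin n // r ≤ (i : ℕ)}))).image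
        fun uη => slice Q uη.2 (momentVec r Q uη.1) with hG2
  set W := Submodule.span ℝ ((G1 ∪ G2 : Finset ((κ → Fin n) → ℝ)) : Set ((κ → Fin n) → ℝ)) with hW
  have hex := exists_vector_of_heavy hidx hζ S hS W
    (fun ρ hρ => Submodule.subset_span (Finset.mem_coe.2 (Finset.mem_union_left _
      (Finset.mem_image.2 ⟨ρ, Finset.mem_filter.2 ⟨Finset.mem_univ _, hρ⟩, rfl⟩))))
    (fun Q hQ u hu huh η => Submodule.subset_span (Finset.mem_coe.2 (Finset.mem_union_right _
      (Finset.mem_biUnion.2 ⟨Q, Finset.mem_powersetCard.2 ⟨Finset.subset_univ _, hQ⟩,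
        Finset.mem_image.2 ⟨(u, η), Finset.mem_product.2 ⟨Finset.mem_filter.2 ⟨hu, huh⟩,
          Finset.mem_univ _⟩, rfl⟩⟩))))
  choose! v hv1 hv2 hv3 using hex
  set F := Finset.univ.filter fun s : κ → Fin n => Heavy idx r (wordSet Finset.univ s) with hF
  have hFh : ∀ s : F, Heavy idx r (wordSet Finset.univ s.1) := fun s =>
    (Finset.mem_filter.1 s.2).2
  -- Triangularity gives independence and the transform is injective, so the number of heavy words
  -- is at most the dimension of W.
  have hli : LinearIndependent ℝ fun s : F => v s.1 :=
    linearIndependent_of_triangular (fun τ => idx (wordSet Finset.univ τ)) (fun s : F => s.1)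
      Subtype.val_injective _ (fun s => hv1 _ (hFh s)) (fun s => hv2 _ (hFh s))
  have hli2 := hli.map' momentTransform (LinearMap.ker_eq_bot.2 momentTransform_injective)
  have h1 := finrank_span_eq_card hli2
  have h2 : Submodule.span ℝ (Set.range (momentTransform ∘ fun s : F => v s.1)) ≤ W := by
    rw [Submodule.span_le]
    rintro _ ⟨s, rfl⟩
    exact hv3 _ (hFh s)
  have h3 := Submodule.finrank_mono h2
  rw [h1, Fintype.card_coe] at h3
  have h4 : Module.finrank ℝ W ≤ (G1 ∪ G2).card := finrank_span_finset_le_card (R := ℝ) (G1 ∪ G2)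
  refine h3.trans (h4.trans ((Finset.card_union_le _ _).trans (Nat.add_le_add ?_ ?_)))
  · rw [← card_lowPositions_lt hr]
    exact Finset.card_image_le
  · refine Finset.card_biUnion_le.trans ?_
    rw [Finset.sum_mul]
    refine Finset.sum_le_sum fun Q hQ => Finset.card_image_le.trans ?_
    have h5 : Fintype.card {i : Fin n // r ≤ (i : ℕ)} = n - r := by
      rw [Fintype.card_subtype]
      have := Finset.card_filter_add_card_filter_not (s := (Finset.univ : Finset (Fin n)))
        (fun i : Fin n => (i : ℕ) < r)
      rw [Fin.card_filter_val_lt, min_eq_right hr, Finset.card_univ, Fintype.card_fin] at this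
      simp only [not_lt] at this
      omega
    rw [Finset.card_product, Finset.card_univ, Fintype.card_fun, h5, Fintype.card_coe,
      Finset.card_compl, (Finset.mem_powersetCard.1 hQ).2]

open Classical in
/-- The number of heavy words, for words that are longer than the dimension. -/
theorem card_heavy_le (hidx : IsLPType idx ζ) (hr : r ≤ n) (hr0 : 0 < r)
    (hζ : ζ < Fintype.card κ) : ∃ q : ℕ,
    (ζ + 1) * q ≤ ζ * ((Fintype.card κ).choose ζ * r ^ ζ) ∧
    (Finset.univ.filter fun s : κ → Fin n => Heavy idx r (wordSet Finset.univ s)).card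
      ≤ (∑ d ∈ Finset.range ζ, (Fintype.card κ).choose d * (r ^ d *
          (n - r) ^ (Fintype.card κ - d))) + q * (n - r) ^ (Fintype.card κ - ζ) := by
  have hn : 0 < n := hr0.trans_le hr
  choose S hS1 hS2 using fun Q : Finset κ =>
    exists_adapted_basis (fun s : κ → Fin n => idx (wordSet Q s)) (momentVec r Q)
  refine ⟨_, ?_, card_heavy_le_add hidx hr hζ.le S hS2⟩
  set N := Fintype.card κ with hN
  set A := ∑ Q ∈ Finset.powersetCard ζ (Finset.univ : Finset κ),
          ((S Q).filter fun u => Heavy idx r (wordSet Q u)).card with hA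
  set B := ∑ Q ∈ Finset.powersetCard ζ (Finset.univ : Finset κ),
          ((S Q).filter fun u => ¬ Heavy idx r (wordSet Q u)).card with hB
  have h1 : A + B ≤ N.choose ζ * r ^ ζ := by
    rw [hA, hB, ← Finset.sum_add_distrib]
    have : ∀ Q ∈ Finset.powersetCard ζ (Finset.univ : Finset κ),
        ((S Q).filter fun u => Heavy idx r (wordSet Q u)).card +
        ((S Q).filter fun u => ¬ Heavy idx r (wordSet Q u)).card ≤ r ^ ζ := by
      intro Q hQ
      rw [Finset.card_filter_add_card_filter_not]
      have := (hS1 Q).linearIndependent.fintype_card_le_finrank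
      simpa [(Finset.mem_powersetCard.1 hQ).2] using this
    refine (Finset.sum_le_card_nsmul _ _ _ this).trans_eq ?_
    rw [Finset.card_powersetCard, smul_eq_mul, Finset.card_univ]
  -- The lower bound for non-heavy basis words is summed over all (ζ+1)-sets P and regrouped by
  -- ζ-sets.
  have h2 : N.choose (ζ + 1) * r ^ (ζ + 1) ≤ (N - ζ) * B * r := by
    have h3 := sum_powersetCard_succ_erase (κ := κ) (ζ := ζ)
      fun Q => ((S Q).filter fun u => ¬ Heavy idx r (wordSet Q u)).card
    rw [hB, Finset.mul_sum, ← h3, Finset.sum_mul]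
    have h4 := Finset.card_nsmul_le_sum (Finset.powersetCard (ζ + 1) (Finset.univ : Finset κ))
      _ _ fun P hP => (pow_le_sum_card_not_heavy hidx hr hn S hS2 P
        (Finset.mem_powersetCard.1 hP).2).trans_eq (Finset.sum_mul _ _ _).symm
    rwa [Finset.card_powersetCard, smul_eq_mul, Finset.card_univ] at h4
  have h5 : N.choose (ζ + 1) * r ^ ζ ≤ (N - ζ) * B := by
    refine Nat.le_of_mul_le_mul_right ?_ hr0
    rwa [mul_assoc, ← pow_succ]
  have h6 := Nat.choose_succ_right_eq N ζ
  -- With (ζ+1)·C(N,ζ+1) = (N-ζ)·C(N,ζ), this makes B at least the fraction 1/(ζ+1) of C(N,ζ)r^ζ,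
  -- leaving at most ζ/(ζ+1) of it to A.
  have h7 : N.choose ζ * r ^ ζ ≤ (ζ + 1) * B := by
    refine Nat.le_of_mul_le_mul_left ?_ (Nat.sub_pos_of_lt hζ)
    calc (N - ζ) * (N.choose ζ * r ^ ζ) = (N.choose (ζ + 1) * r ^ ζ) * (ζ + 1) := by
          rw [mul_right_comm, h6]; ring
      _ ≤ (N - ζ) * B * (ζ + 1) := Nat.mul_le_mul_right _ h5
      _ = _ := by ring
  nlinarith

end Counting

/-! ### Product measures and concentration of sample counts. -/

section Sampling

variable {Δ : Type*} [MeasurableSpace Δ] (P : Measure Δ) [IsProbabilityMeasure P]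

theorem measurePreserving_comp_injective {ι ι' : Type*} [Fintype ι] [Fintype ι'] {e : ι' → ι}
    (he : Function.Injective e) :
    MeasurePreserving (fun (x : ι → Δ) (i : ι') => x (e i)) (Measure.pi fun _ => P)
      (Measure.pi fun _ => P) := by
  classical
  refine ⟨by fun_prop, ?_⟩
  refine (Measure.pi_eq fun s hs => ?_).symm
  rw [Measure.map_apply (by fun_prop) (MeasurableSet.univ_pi hs)]
  have h1 : (fun (x : ι → Δ) (i : ι') => x (e i)) ⁻¹' (Set.univ.pi s) =
      Set.univ.pi (Function.extend e s fun _ => Set.univ) := by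
    ext x
    simp only [Set.mem_preimage, Set.mem_pi, Set.mem_univ, forall_true_left]
    constructor
    · intro h j
      by_cases hj : ∃ i, e i = j
      · obtain ⟨i, rfl⟩ := hj
        rw [he.extend_apply]; exact h i
      · rw [Function.extend_apply' _ _ _ hj]; trivial
    · intro h i
      have := h (e i)
      rwa [he.extend_apply] at this
  rw [h1, Measure.pi_pi, ← Finset.prod_subset (Finset.subset_univ (Finset.univ.image e)),
    Finset.prod_image fun a _ b _ h => he h]
  · exact Finset.prod_congr rfl fun i _ => by rw [he.extend_apply]
  · intro j _ hj
    rw [Function.extend_apply' _ _ _ (by simpa using hj), measure_univ]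

theorem measurePreserving_curry {ι ι' : Type*} [Fintype ι] [Fintype ι'] :
    MeasurePreserving (fun (x : ι × ι' → Δ) (i : ι) (j : ι') => x (i, j))
      (Measure.pi fun _ => P) (Measure.pi fun _ => Measure.pi fun _ => P) := by
  refine ⟨by fun_prop, ?_⟩
  have h := Measure.infinitePi_map_curry (fun (_ : ι) (_ : ι') => P)
  simp only [Measure.infinitePi_eq_pi] at h
  exact h

theorem measurePreserving_uncurry_comp_injective {ι ι' κ : Type*} [Fintype ι] [Fintype ι']
    [Fintype κ] {e : κ → ι × ι'} (he : Function.Injective e) :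
    MeasurePreserving (fun (x : ι → ι' → Δ) (k : κ) => x (e k).1 (e k).2)
      (Measure.pi fun _ => Measure.pi fun _ => P) (Measure.pi fun _ => P) := by
  refine ⟨by fun_prop, ?_⟩
  rw [← (measurePreserving_curry P (ι := ι) (ι' := ι')).map_eq, Measure.map_map (by fun_prop)
    (by fun_prop)]
  exact (measurePreserving_comp_injective P he).map_eq

/-- The sum of the probabilities is the expected number of events that occur. -/
theorem sum_measure_le_of_card_le {Ω σ : Type*} [MeasurableSpace Ω] (μ : Measure Ω)
    [IsProbabilityMeasure μ] [Fintype σ] (E : σ → Set Ω) (hE : ∀ s, MeasurableSet (E s))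
    (c : ENNReal) (F : Ω → Finset σ) (h1 : ∀ᵐ x ∂μ, ((F x).card : ENNReal) ≤ c)
    (h2 : ∀ x s, x ∈ E s → s ∈ F x) : ∑ s, μ (E s) ≤ c := by
  classical
  calc ∑ s, μ (E s) = ∑ s, ∫⁻ x, (E s).indicator 1 x ∂μ :=
        Finset.sum_congr rfl fun s _ => (lintegral_indicator_one (hE s)).symm
    _ = ∫⁻ x, ∑ s, (E s).indicator 1 x ∂μ :=
        (lintegral_finsetSum _ fun s _ => measurable_one.indicator (hE s)).symm
    _ ≤ ∫⁻ _, c ∂μ := by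
        refine lintegral_mono_ae ?_
        filter_upwards [h1] with x hx
        refine le_trans ?_ hx
        have : ∀ s, (E s).indicator (1 : Ω → ENNReal) x ≤ if s ∈ F x then 1 else 0 := by
          intro s
          by_cases hs : x ∈ E s
          · simp [hs, h2 x s hs]
          · simp [hs]
        refine (Finset.sum_le_sum fun s _ => this s).trans_eq ?_
        simp
    _ = c := by simp

/-- A weak law of large numbers for the number of samples in a set. -/
theorem one_sub_le_measure_card_ge {A : Set Δ} [DecidablePred (· ∈ A)] (hA : MeasurableSet A) {K r : ℕ} {p : ℝ}
    (hp : ENNReal.ofReal p ≤ P A) (hr : (r : ℝ) < p * K) :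
    ENNReal.ofReal (1 - K / (p * K - r) ^ 2) ≤ (Measure.pi fun _ : Fin K => P)
      {R | r ≤ (Finset.univ.filter fun i => R i ∈ A).card} := by
  set μ := Measure.pi fun _ : Fin K => P with hμ
  set f : Δ → ℝ := A.indicator 1 with hf
  have hfm : MemLp f 2 P := by
    refine memLp_indicator_const 2 hA (1 : ℝ) (Or.inr (measure_ne_top _ _))
  set Z : (Fin K → Δ) → ℝ := ∑ i, fun ω => f (ω i) with hZ
  have hcoord : ∀ i : Fin K, MemLp (fun ω : Fin K → Δ => f (ω i)) 2 μ := fun i =>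
    hfm.comp_measurePreserving (measurePreserving_eval (fun _ : Fin K => P) i)
  have hZm : MemLp Z 2 μ := memLp_finsetSum' _ fun i _ => hcoord i
  have hintf : ∫ x, f x ∂P = P.real A := integral_indicator_one hA
  have hEZ : ∫ ω, Z ω ∂μ = K * P.real A := by
    have : ∀ ω, Z ω = ∑ i, f (ω i) := fun ω => by simp [hZ]
    simp only [this]
    rw [integral_finsetSum _ fun i _ => (hcoord i).integrable (by norm_num)]
    have h3 : ∀ i : Fin K, ∫ ω : Fin K → Δ, f (ω i) ∂μ = P.real A := by
      intro i
      rw [← hintf, ← (measurePreserving_eval (fun _ : Fin K => P) i).map_eq,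
        integral_map (measurable_pi_apply i).aemeasurable
          (by rw [(measurePreserving_eval (fun _ : Fin K => P) i).map_eq]; exact hfm.1)]
    simp [h3]
  have hvar : ProbabilityTheory.variance Z μ ≤ K := by
    rw [hZ, hμ, ProbabilityTheory.variance_sum_pi (X := fun _ => f) fun _ => hfm]
    have : ProbabilityTheory.variance f P ≤ 1 := by
      refine (ProbabilityTheory.variance_le_expectation_sq hfm.1).trans ?_
      have : f ^ 2 = f := by
        funext x
        by_cases hx : x ∈ A <;> simp [hf, hx]
      rw [this, hintf]
      exact measureReal_le_one
    calc _ ≤ ∑ _i : Fin K, (1 : ℝ) := Finset.sum_le_sum fun i _ => this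
      _ = K := by simp
  have hpr : p ≤ P.real A := by
    rcases le_or_gt p 0 with h | h
    · exact h.trans measureReal_nonneg
    · exact (ENNReal.ofReal_le_iff_le_toReal (measure_ne_top _ _)).1 hp
  have hc : 0 < p * K - r := by linarith
  have hcheb := ProbabilityTheory.meas_ge_le_variance_div_sq hZm hc
  have hcard : ∀ R : Fin K → Δ, ((Finset.univ.filter fun i => R i ∈ A).card : ℝ) = Z R := by
    intro R
    rw [Finset.card_filter]
    push_cast
    simp [hZ, hf, Set.indicator_apply]
  have hsub : {R | r ≤ (Finset.univ.filter fun i => R i ∈ A).card}ᶜ ⊆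
      {ω | p * K - r ≤ |Z ω - ∫ ω, Z ω ∂μ|} := by
    intro R hR
    simp only [Set.mem_compl_iff, Set.mem_ofPred_eq, not_le] at hR ⊢
    have h4 : Z R < r := by rw [← hcard]; exact_mod_cast hR
    rw [hEZ, abs_sub_comm]
    refine le_trans ?_ (le_abs_self _)
    have : p * K ≤ K * P.real A := by
      rw [mul_comm]; exact mul_le_mul_of_nonneg_left hpr (Nat.cast_nonneg K)
    linarith
  have h5 : μ ({R | r ≤ (Finset.univ.filter fun i => R i ∈ A).card}ᶜ) ≤
      ENNReal.ofReal (K / (p * K - r) ^ 2) :=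
    (measure_mono hsub).trans (hcheb.trans (ENNReal.ofReal_le_ofReal
      (div_le_div_of_nonneg_right hvar (sq_nonneg _))))
  have h6 := measure_univ_le_add_compl (μ := μ)
    {R : Fin K → Δ | r ≤ (Finset.univ.filter fun i => R i ∈ A).card}
  rw [measure_univ] at h6
  rw [ENNReal.ofReal_sub _ (by positivity), ENNReal.ofReal_one]
  exact tsub_le_iff_right.2 (h6.trans (by gcongr))

end Sampling

/-! ### Scenario values: from counts of heavy words to the law of the risk. -/

/-- The value `val D` of an optimization problem with constraints `D`, under random sampling of the
constraints from `P`: it is monotone, whether a constraint is violated depends on the value only,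
and almost surely at most `ζ` of finitely many sampled constraints are of support. -/
structure IsScenarioValue {Δ J : Type*} [MeasurableSpace Δ] [LinearOrder J] (P : Measure Δ)
    (val : Set Δ → J) (ζ : ℕ) : Prop where
  mono : ∀ ⦃D D' : Set Δ⦄, D ⊆ D' → val D ≤ val D'
  loc : ∀ ⦃D D' : Set Δ⦄ (δ : Δ), val D = val D' → val D < val (insert δ D) →
    val D' < val (insert δ D')
  measurable : ∀ L : ℕ, MeasurableSet
    {p : (Fin L → Δ) × Δ | val (Set.range p.1) < val (insert p.2 (Set.range p.1))}
  support : ∀ L : ℕ, 1 ≤ L → ∀ᵐ ω ∂(Measure.pi fun _ : Fin L => P),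
    {i | val (ω '' {i}ᶜ) ≠ val (Set.range ω)}.encard ≤ ζ

namespace IsScenarioValue

variable {Δ J : Type*} [MeasurableSpace Δ] [LinearOrder J] {P : Measure Δ} [IsProbabilityMeasure P]
  {val : Set Δ → J} {ζ : ℕ}

/-- The probability that a further sample violates the solution. -/
noncomputable def risk (_h : IsScenarioValue P val ζ) {L : ℕ} (ω : Fin L → Δ) : ENNReal :=
  P {δ | val (Set.range ω) < val (insert δ (Set.range ω))}

theorem measurable_risk (h : IsScenarioValue P val ζ) (L : ℕ) :
    Measurable fun ω : Fin L → Δ => h.risk ω :=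
  measurable_measure_prodMk_left (h.measurable L)

/-- The support bound holds almost surely for all of the finitely many nonempty subarrays at once. A
subset of T of least cardinality with the value of T loses that value when any element is removed,
so all its elements are of support and there are at most ζ of them. -/
theorem ae_isLPType (h : IsScenarioValue P val ζ) (N n : ℕ) :
    ∀ᵐ X ∂(Measure.pi fun _ : Fin N => Measure.pi fun _ : Fin n => P),
      IsLPType (fun T : Finset (Fin N × Fin n) => val ((fun y : Fin N × Fin n => X y.1 y.2) '' (T : Set (Fin N × Fin n)))) ζ := by
  classical
  have h1 : ∀ B : Finset (Fin N × Fin n), B.Nonempty →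
      ∀ᵐ X ∂(Measure.pi fun _ : Fin N => Measure.pi fun _ : Fin n => P),
        {i : Fin B.card | val ((fun i => X (B.equivFin.symm i).1.1 (B.equivFin.symm i).1.2) ''
          {i}ᶜ) ≠ val (Set.range fun i => X (B.equivFin.symm i).1.1
            (B.equivFin.symm i).1.2)}.encard ≤ ζ := by
    intro B hB
    have hmp := measurePreserving_uncurry_comp_injective P
      (e := fun i : Fin B.card => (B.equivFin.symm i).1)
      (Subtype.val_injective.comp B.equivFin.symm.injective)
    exact hmp.quasiMeasurePreserving.ae (h.support B.card hB.card_pos)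
  have h2 : ∀ᵐ X ∂(Measure.pi fun _ : Fin N => Measure.pi fun _ : Fin n => P),
      ∀ B : Finset (Fin N × Fin n), B.Nonempty →
        {i : Fin B.card | val ((fun i => X (B.equivFin.symm i).1.1 (B.equivFin.symm i).1.2) ''
          {i}ᶜ) ≠ val (Set.range fun i => X (B.equivFin.symm i).1.1
            (B.equivFin.symm i).1.2)}.encard ≤ ζ :=
    ae_all_iff.2 fun B => by
      by_cases hB : B.Nonempty
      · filter_upwards [h1 B hB] with X hX _ using hX
      · exact Filter.Eventually.of_forall fun X hX => absurd hX hB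
  filter_upwards [h2] with X hX
  refine ⟨fun T T' hTT' => h.mono (Set.image_mono (Finset.coe_subset.2 hTT')), ?_, ?_⟩
  · intro T T' y hTT' hy
    simp only [Finset.coe_insert, Set.image_insert_eq] at hy ⊢
    exact h.loc _ hTT' hy
  · intro T
    obtain ⟨B, hBmem, hBmin⟩ := Finset.exists_min_image (T.powerset.filter fun B : Finset (Fin N × Fin n) =>
      val ((fun y : Fin N × Fin n => X y.1 y.2) '' (B : Set (Fin N × Fin n))) =
        val ((fun y : Fin N × Fin n => X y.1 y.2) '' (T : Set (Fin N × Fin n)))) Finset.card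
      ⟨T, Finset.mem_filter.2 ⟨Finset.mem_powerset_self T, rfl⟩⟩
    obtain ⟨hBT, hBv⟩ := Finset.mem_filter.1 hBmem
    rw [Finset.mem_powerset] at hBT
    refine ⟨B, hBT, ?_, hBv⟩
    rcases B.eq_empty_or_nonempty with rfl | hne
    · simp
    have h3 := hX B hne
    have hrange : (Set.range fun i => X (B.equivFin.symm i).1.1 (B.equivFin.symm i).1.2) =
        (fun y : Fin N × Fin n => X y.1 y.2) '' (B : Set (Fin N × Fin n)) := by
      ext δ
      constructor
      · rintro ⟨i, rfl⟩
        exact ⟨_, (B.equivFin.symm i).2, rfl⟩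
      · rintro ⟨y, hy, rfl⟩
        exact ⟨B.equivFin ⟨y, hy⟩, by simp⟩
    have himage : ∀ i, (fun i => X (B.equivFin.symm i).1.1 (B.equivFin.symm i).1.2) '' {i}ᶜ =
        (fun y : Fin N × Fin n => X y.1 y.2) '' ((B.erase (B.equivFin.symm i).1 : Finset (Fin N × Fin n)) :
          Set (Fin N × Fin n)) := by
      intro i
      ext δ
      constructor
      · rintro ⟨j, hj, rfl⟩
        refine ⟨_, Finset.mem_coe.2 (Finset.mem_erase.2 ⟨fun he => hj ?_,
          (B.equivFin.symm j).2⟩), rfl⟩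
        exact B.equivFin.symm.injective (Subtype.ext he)
      · rintro ⟨y, hy, rfl⟩
        obtain ⟨hy1, hy2⟩ := Finset.mem_erase.1 (Finset.mem_coe.1 hy)
        refine ⟨B.equivFin ⟨y, hy2⟩, ?_, by simp⟩
        rintro rfl
        simp at hy1
    have huniv : {i : Fin B.card | val ((fun i => X (B.equivFin.symm i).1.1
        (B.equivFin.symm i).1.2) '' {i}ᶜ) ≠ val (Set.range fun i => X (B.equivFin.symm i).1.1
            (B.equivFin.symm i).1.2)} = Set.univ := by
      rw [Set.eq_univ_iff_forall]
      intro i hi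
      rw [himage, hrange, hBv] at hi
      have h4 := hBmin (B.erase (B.equivFin.symm i).1) (Finset.mem_filter.2
        ⟨Finset.mem_powerset.2 ((Finset.erase_subset _ _).trans hBT), hi⟩)
      exact absurd h4 (not_le.2 (Finset.card_erase_lt_of_mem (B.equivFin.symm i).2))
    rw [huniv, Set.encard_univ] at h3
    simpa using h3

/-- The expected risk is at most `ζ / (N + 1)`. -/
theorem lintegral_risk_le (h : IsScenarioValue P val ζ) (N : ℕ) :
    (N + 1 : ENNReal) * ∫⁻ ω, h.risk ω ∂(Measure.pi fun _ : Fin N => P) ≤ ζ := by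
  classical
  set A := {p : (Fin N → Δ) × Δ | val (Set.range p.1) < val (insert p.2 (Set.range p.1))} with hA
  have hAm : MeasurableSet A := h.measurable N
  have hmp : ∀ i : Fin (N + 1), MeasurePreserving
      (fun ω : Fin (N + 1) → Δ => (ω i, fun j => ω (i.succAbove j)))
      (Measure.pi fun _ => P) (P.prod (Measure.pi fun _ => P)) := fun i =>
    measurePreserving_piFinSuccAbove (fun _ : Fin (N + 1) => P) i
  -- `E i` says that sample i violates the solution of the other N samples. It then is a support
  -- constraint of all N + 1, and by exchangeability each `E i` has the expected risk as its
  -- probability.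
  set E : Fin (N + 1) → Set (Fin (N + 1) → Δ) := fun i =>
    {ω | ((fun j => ω (i.succAbove j)), ω i) ∈ A} with hE
  have hEm : ∀ i, MeasurableSet (E i) := fun i => hAm.preimage (by fun_prop)
  have hEμ : ∀ i, (Measure.pi fun _ => P) (E i) =
      ∫⁻ ω, h.risk ω ∂(Measure.pi fun _ : Fin N => P) := by
    intro i
    have h1 := (hmp i).measure_preimage (hAm.preimage measurable_swap).nullMeasurableSet
    rw [Measure.prod_apply_symm (hAm.preimage measurable_swap)] at h1
    exact h1
  have hle : ∑ i, (Measure.pi fun _ => P) (E i) ≤ (ζ : ENNReal) := by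
    refine sum_measure_le_of_card_le _ E hEm _ (fun ω => Finset.univ.filter fun i =>
      val (ω '' {i}ᶜ) ≠ val (Set.range ω)) ?_ ?_
    · filter_upwards [h.support (N + 1) (by omega)] with ω hω
      rw [show {i | val (ω '' {i}ᶜ) ≠ val (Set.range ω)} = ((Finset.univ.filter fun i =>
        val (ω '' {i}ᶜ) ≠ val (Set.range ω) : Finset (Fin (N + 1))) : Set (Fin (N + 1))) by
          ext; simp, Set.encard_coe_eq_coe_finsetCard] at hω
      exact_mod_cast hω
    · intro ω i hi
      refine Finset.mem_filter.2 ⟨Finset.mem_univ _, ne_of_lt ?_⟩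
      have h1 : Set.range (fun j => ω (i.succAbove j)) = ω '' {i}ᶜ := by
        rw [← Fin.range_succAbove i, ← Set.range_comp]; rfl
      have h2 : insert (ω i) (ω '' {i}ᶜ) = Set.range ω := by
        rw [← Set.image_insert_eq, ← Set.image_univ]
        congr 1
        ext j
        simp [em]
      have h3 : val (Set.range fun j => ω (i.succAbove j)) <
        val (insert (ω i) (Set.range fun j => ω (i.succAbove j))) := hi
      rwa [h1, h2] at h3
  simp only [hEμ] at hle
  simpa using hle

end IsScenarioValue

open Classical in
/-- The words whose set of letters is heavy. -/
noncomputable def heavyWords {κ Λ J : Type*} [Fintype κ] [DecidableEq κ] [DecidableEq Λ]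
    [Fintype Λ] [LinearOrder J] (idx : Finset (κ × Λ) → J) (r : ℕ) : Finset (κ → Λ) :=
  Finset.univ.filter fun s => Heavy idx r (wordSet Finset.univ s)

theorem mem_heavyWords {κ Λ J : Type*} [Fintype κ] [DecidableEq κ] [DecidableEq Λ]
    [Fintype Λ] [LinearOrder J] {idx : Finset (κ × Λ) → J} {r : ℕ} {s : κ → Λ} :
    s ∈ heavyWords idx r ↔ Heavy idx r (wordSet Finset.univ s) := by
  simp [heavyWords]

/-- Exchangeability: whichever word is read off, its letters are N fresh samples, independent of the
K companions left in each block. -/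
theorem measurePreserving_word {Δ : Type*} [MeasurableSpace Δ] (P : Measure Δ)
    [IsProbabilityMeasure P] {N K : ℕ} (s : Fin N → Fin (K + 1)) :
    MeasurePreserving (fun X : Fin N → Fin (K + 1) → Δ =>
      ((fun k => X k (s k)), fun k (i : Fin K) => X k ((s k).succAbove i)))
      (Measure.pi fun _ => Measure.pi fun _ => P)
      ((Measure.pi fun _ => P).prod (Measure.pi fun _ => Measure.pi fun _ => P)) := by
  have hmp0 : ∀ k, MeasurePreserving (fun x : Fin (K + 1) → Δ =>
      (x (s k), fun j => x ((s k).succAbove j))) (Measure.pi fun _ => P)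
      (P.prod (Measure.pi fun _ => P)) := fun k =>
    measurePreserving_piFinSuccAbove (fun _ : Fin (K + 1) => P) (s k)
  have hmp1 := measurePreserving_pi (fun _ : Fin N => Measure.pi fun _ : Fin (K + 1) => P)
    (fun _ : Fin N => P.prod (Measure.pi fun _ : Fin K => P)) hmp0
  have hmp2 : MeasurePreserving (fun Y : Fin N → Δ × (Fin K → Δ) =>
      ((fun k => (Y k).1), fun k => (Y k).2)) (Measure.pi fun _ => P.prod (Measure.pi fun _ => P))
      ((Measure.pi fun _ => P).prod (Measure.pi fun _ => Measure.pi fun _ => P)) :=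
    measurePreserving_arrowProdEquivProdArrow Δ (Fin K → Δ) (Fin N)
      (fun _ => P) (fun _ => Measure.pi fun _ : Fin K => P)
  exact hmp2.comp hmp1

theorem measure_word_mem {Δ : Type*} [MeasurableSpace Δ] (P : Measure Δ)
    [IsProbabilityMeasure P] {N K : ℕ} (s : Fin N → Fin (K + 1))
    {F : Set ((Fin N → Δ) × (Fin N → Fin K → Δ))} (hF : MeasurableSet F) :
    (Measure.pi fun _ : Fin N => Measure.pi fun _ : Fin (K + 1) => P)
      {X | ((fun k => X k (s k)), fun k (i : Fin K) => X k ((s k).succAbove i)) ∈ F} =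
    ((Measure.pi fun _ => P).prod (Measure.pi fun _ => Measure.pi fun _ => P)) F := by
  have h := (measurePreserving_word P s).measure_preimage hF.nullMeasurableSet
  exact h

theorem tendsto_div_mul_sub_one_sq {a : ℝ} (ha : 0 < a) :
    Filter.Tendsto (fun K : ℕ => (K : ℝ) / (a * K - 1) ^ 2) Filter.atTop (nhds 0) := by
  have h1 : Filter.Tendsto (fun K : ℕ => (4 / a ^ 2) / (K : ℝ)) Filter.atTop (nhds 0) :=
    tendsto_const_div_atTop_nhds_zero_nat _
  have h2 : Filter.Tendsto (fun K : ℕ => a * (K : ℝ)) Filter.atTop Filter.atTop :=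
    tendsto_natCast_atTop_atTop.const_mul_atTop ha
  refine squeeze_zero' (Filter.Eventually.of_forall fun K => by positivity) ?_ h1
  filter_upwards [h2.eventually_ge_atTop 2, Filter.eventually_ge_atTop 1] with K hK hK1
  have hK0 : (0 : ℝ) < K := by exact_mod_cast hK1
  have h3 : (a * K / 2) ^ 2 ≤ (a * K - 1) ^ 2 := pow_le_pow_left₀ (by positivity) (by linarith) 2
  calc (K : ℝ) / (a * K - 1) ^ 2 ≤ K / (a * K / 2) ^ 2 := by gcongr
    _ = (4 / a ^ 2) / K := by field_simp; norm_num

namespace IsScenarioValue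

variable {Δ J : Type*} [MeasurableSpace Δ] [LinearOrder J] {P : Measure Δ}
  {val : Set Δ → J} {ζ : ℕ}

open Classical in
/-- The event that, for each of the sampled constraints `Y k`, at least `r` of its companions
violate the solution. -/
theorem measurableSet_companions (h : IsScenarioValue P val ζ) (N K r : ℕ) :
    MeasurableSet {p : (Fin N → Δ) × (Fin N → Fin K → Δ) | ∀ k, r ≤ (Finset.univ.filter fun i =>
      val (Set.range p.1) < val (insert (p.2 k i) (Set.range p.1))).card} := by
  rw [Set.ofPred_forall]
  refine MeasurableSet.iInter fun k => ?_
  have hA := h.measurable N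
  simp only [Finset.card_filter]
  refine measurableSet_le measurable_const (Finset.measurable_sum _ fun i _ => ?_)
  refine Measurable.ite ?_ measurable_const measurable_const
  exact hA.preimage (f := fun p : (Fin N → Δ) × (Fin N → Fin K → Δ) => (p.1, p.2 k i))
    (by fun_prop)

variable [IsProbabilityMeasure P]

open Classical in
-- Given ω with risk at least p, each block independently contains at least r violating companions
-- with the probability from Chebyshev's inequality, which gives the N-th power. The word is then
-- heavy; summing over the (K+1)^N equally likely words bounds the expected number of heavy words
-- from below.
theorem pow_mul_measure_le (h : IsScenarioValue P val ζ) {N K r : ℕ} {p : ℝ}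
    (hr : (r : ℝ) < p * K) {c : ENNReal}
    (hc : ∀ᵐ X ∂(Measure.pi fun _ : Fin N => Measure.pi fun _ : Fin (K + 1) => P),
      ((heavyWords (fun T : Finset (Fin N × Fin (K + 1)) => val ((fun y : Fin N × Fin (K + 1) => X y.1 y.2) ''
        (T : Set (Fin N × Fin (K + 1))))) r).card : ENNReal) ≤ c) :
    ((K + 1 : ENNReal) ^ N) * (ENNReal.ofReal (1 - K / (p * K - r) ^ 2) ^ N *
      (Measure.pi fun _ : Fin N => P) {ω | ENNReal.ofReal p ≤ h.risk ω}) ≤ c := by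
  set F := {p : (Fin N → Δ) × (Fin N → Fin K → Δ) | ∀ k, r ≤ (Finset.univ.filter fun i =>
      val (Set.range p.1) < val (insert (p.2 k i) (Set.range p.1))).card} with hF
  have hFm : MeasurableSet F := h.measurableSet_companions N K r
  have h1 : ENNReal.ofReal (1 - K / (p * K - r) ^ 2) ^ N *
      (Measure.pi fun _ : Fin N => P) {ω | ENNReal.ofReal p ≤ h.risk ω} ≤
      ((Measure.pi fun _ : Fin N => P).prod
        (Measure.pi fun _ : Fin N => Measure.pi fun _ : Fin K => P)) F := by
    rw [Measure.prod_apply hFm]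
    have hm : MeasurableSet {ω : Fin N → Δ | ENNReal.ofReal p ≤ h.risk ω} :=
      measurableSet_le measurable_const (h.measurable_risk N)
    rw [← setLIntegral_const]
    refine le_trans ?_ (setLIntegral_le_lintegral {ω | ENNReal.ofReal p ≤ h.risk ω} _)
    refine setLIntegral_mono_ae' hm (Filter.Eventually.of_forall fun ω hω => ?_)
    have h2 : Prod.mk ω ⁻¹' F = Set.univ.pi fun _ => {R : Fin K → Δ | r ≤ (Finset.univ.filter
        fun i => R i ∈ {δ | val (Set.range ω) < val (insert δ (Set.range ω))}).card} := by
      ext R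
      simp [hF]
    rw [h2, Measure.pi_pi, Finset.prod_const, Finset.card_univ, Fintype.card_fin]
    gcongr
    have h3 : MeasurableSet {δ | val (Set.range ω) < val (insert δ (Set.range ω))} :=
      measurable_prodMk_left (h.measurable N)
    exact one_sub_le_measure_card_ge P h3 hω hr
  set E : (Fin N → Fin (K + 1)) → Set (Fin N → Fin (K + 1) → Δ) := fun s =>
    {X | ((fun k => X k (s k)), fun k i => X k ((s k).succAbove i)) ∈ F} with hE
  have hEm : ∀ s, MeasurableSet (E s) := fun s => hFm.preimage (by fun_prop)
  have hEμ : ∀ s, (Measure.pi fun _ : Fin N => Measure.pi fun _ : Fin (K + 1) => P) (E s) =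
      ((Measure.pi fun _ : Fin N => P).prod
        (Measure.pi fun _ : Fin N => Measure.pi fun _ : Fin K => P)) F := by
    intro s
    exact measure_word_mem P s hFm
  have h3 : ∑ s, (Measure.pi fun _ : Fin N => Measure.pi fun _ : Fin (K + 1) => P) (E s) ≤ c := by
    refine sum_measure_le_of_card_le _ E hEm c (fun X => heavyWords (fun T : Finset (Fin N × Fin (K + 1)) =>
      val ((fun y : Fin N × Fin (K + 1) => X y.1 y.2) '' (T : Set (Fin N × Fin (K + 1))))) r) hc ?_
    intro X s hs
    refine mem_heavyWords.2 fun k => (hs k).trans ?_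
    refine Finset.card_le_card_of_injOn (s k).succAbove ?_
      ((Fin.succAbove_right_injective).injOn)
    intro i hi
    simp only [Finset.coe_filter, Finset.mem_univ, true_and, Set.mem_ofPred_eq] at hi ⊢
    have h4 : (fun y : Fin N × Fin (K + 1) => X y.1 y.2) ''
        (wordSet Finset.univ s : Set (Fin N × Fin (K + 1))) = Set.range fun k => X k (s k) := by
      ext δ
      constructor
      · rintro ⟨⟨k, i⟩, hki, rfl⟩
        exact ⟨k, congrArg (X k) (mem_wordSet.1 (Finset.mem_coe.1 hki)).2⟩
      · rintro ⟨k, rfl⟩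
        exact ⟨(k, s k), Finset.mem_coe.2 (mem_wordSet.2 ⟨Finset.mem_univ _, rfl⟩), rfl⟩
    rw [Finset.coe_insert, Set.image_insert_eq, h4]
    exact hi
  simp only [hEμ] at h3
  refine le_trans ?_ h3
  rw [Finset.sum_const, Finset.card_univ, Fintype.card_fun, Fintype.card_fin, Fintype.card_fin,
    nsmul_eq_mul]
  push_cast
  gcongr

/-- Bounds on the number of heavy words are bounds on the distribution of the risk. -/
theorem measure_risk_gt_le (h : IsScenarioValue P val ζ) {N : ℕ} {b : ℝ → ℝ} (hb : Continuous b)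
    (hcount : ∀ (n r : ℕ) (idx : Finset (Fin N × Fin n) → J), IsLPType idx ζ → 0 < r → r ≤ n →
      ((heavyWords idx r).card : ℝ) ≤ b (r / n) * n ^ N) {ε : ℝ} (hε0 : 0 < ε) (hε1 : ε < 1) :
    (Measure.pi fun _ : Fin N => P) {ω | ENNReal.ofReal ε < h.risk ω} ≤ ENNReal.ofReal (b ε) := by
  have key : ∀ p : ℝ, ε < p → (Measure.pi fun _ : Fin N => P) {ω | ENNReal.ofReal p ≤ h.risk ω}
      ≤ ENNReal.ofReal (b ε) := by
    intro p hp
    set m := ((Measure.pi fun _ : Fin N => P) {ω | ENNReal.ofReal p ≤ h.risk ω}) with hm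
    -- The threshold ⌈εK⌉ satisfies r/(K+1) → ε, while the gap pK - r is at least (p-ε)K - 1. The
    -- latter grows linearly in K, so the Chebyshev error K/(pK - r)² tends to zero.
    set r : ℕ → ℕ := fun K => ⌈ε * K⌉₊ with hr
    have hr1 : ∀ K : ℕ, (r K : ℝ) < ε * K + 1 := fun K => Nat.ceil_lt_add_one (by positivity)
    have hgap : Filter.Tendsto (fun K : ℕ => (p - ε) * K - 1) Filter.atTop Filter.atTop :=
      Filter.tendsto_atTop_add_const_right _ _
        (tendsto_natCast_atTop_atTop.const_mul_atTop (sub_pos.2 hp))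
    have hev : ∀ᶠ K : ℕ in Filter.atTop,
        (1 - K / ((p - ε) * K - 1) ^ 2) ^ N * m.toReal ≤ b (r K / (K + 1 : ℕ)) := by
      have hη := tendsto_div_mul_sub_one_sq (sub_pos.2 hp)
      filter_upwards [hgap.eventually_gt_atTop 0, Filter.eventually_ge_atTop 1,
        hη.eventually_le_const (u := 1) one_pos] with K hK hK1 hη1
      have hK0 : (0 : ℝ) < K := by exact_mod_cast hK1
      have hrK : (r K : ℝ) < p * K := by nlinarith [hr1 K]
      have hr0 : 0 < r K := Nat.ceil_pos.2 (by positivity)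
      have hrle : r K ≤ K + 1 := by
        refine (Nat.ceil_le.2 ?_).trans (Nat.le_succ K)
        nlinarith
      have h1 := h.pow_mul_measure_le hrK (c := ENNReal.ofReal (b (r K / (K + 1 : ℕ)) *
          ((K + 1 : ℕ) : ℝ) ^ N)) (by
        filter_upwards [h.ae_isLPType N (K + 1)] with X hX
        have := hcount (K + 1) (r K) _ hX hr0 hrle
        rw [← ENNReal.ofReal_natCast]
        refine ENNReal.ofReal_le_ofReal ?_
        exact this)
      have hK1' : ((K + 1 : ℕ) : ℝ) ^ N > 0 := by positivity
      -- Nonnegativity of the bound is read off from the counting hypothesis for a constant `idx`.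
      have hbnn : 0 ≤ b (r K / (K + 1 : ℕ)) * ((K + 1 : ℕ) : ℝ) ^ N := by
        have := hcount (K + 1) (r K) (fun _ => val ∅) ⟨fun _ _ _ => le_rfl,
          fun _ _ _ _ h => absurd h (lt_irrefl _), fun _ => ⟨∅, by simp, by simp, rfl⟩⟩ hr0 hrle
        exact le_trans (Nat.cast_nonneg _) this
      have h2 := ENNReal.toReal_mono ENNReal.ofReal_ne_top h1
      rw [ENNReal.toReal_ofReal hbnn, ENNReal.toReal_mul, ENNReal.toReal_mul, ENNReal.toReal_pow,
        ENNReal.toReal_pow] at h2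
      have h3 : (K + 1 : ENNReal).toReal = ((K + 1 : ℕ) : ℝ) := by
        rw [← ENNReal.toReal_natCast]; push_cast; rfl
      rw [h3, mul_comm (b _)] at h2
      have h4 := le_of_mul_le_mul_left h2 hK1'
      refine le_trans ?_ h4
      have h5 : 1 - (K : ℝ) / ((p - ε) * K - 1) ^ 2 ≤
          (ENNReal.ofReal (1 - K / (p * K - r K) ^ 2)).toReal := by
        rw [ENNReal.toReal_ofReal']
        refine le_trans ?_ (le_max_left _ _)
        have : ((p - ε) * K - 1) ^ 2 ≤ (p * K - r K) ^ 2 := by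
          refine pow_le_pow_left₀ hK.le ?_ 2
          linarith [hr1 K]
        have := div_le_div_of_nonneg_left hK0.le (pow_pos hK 2) this
        linarith
      exact mul_le_mul_of_nonneg_right (pow_le_pow_left₀ (by linarith) h5 N) ENNReal.toReal_nonneg
    have hlim1 : Filter.Tendsto (fun K : ℕ => (1 - K / ((p - ε) * K - 1) ^ 2) ^ N * m.toReal)
        Filter.atTop (nhds ((1 - 0) ^ N * m.toReal)) :=
      (((tendsto_const_nhds.sub (tendsto_div_mul_sub_one_sq (sub_pos.2 hp))).pow N).mul_const _)
    have hlim2 : Filter.Tendsto (fun K : ℕ => b (r K / (K + 1 : ℕ))) Filter.atTop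
        (nhds (b ε)) := by
      refine (hb.tendsto ε).comp ?_
      have h6 : Filter.Tendsto (fun K : ℕ => (r K : ℝ) / K) Filter.atTop (nhds ε) :=
        (tendsto_nat_ceil_mul_div_atTop hε0.le).comp tendsto_natCast_atTop_atTop
      have h7 := h6.mul (tendsto_natCast_div_add_atTop (1 : ℝ))
      rw [mul_one] at h7
      refine h7.congr' ?_
      filter_upwards [Filter.eventually_ge_atTop 1] with K hK
      have hK0 : (0 : ℝ) < K := by exact_mod_cast hK
      push_cast
      field_simp
    have h8 := le_of_tendsto_of_tendsto hlim1 hlim2 hev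
    rw [sub_zero, one_pow, one_mul] at h8
    have hmt : m ≠ ⊤ := measure_ne_top _ _
    rw [← ENNReal.ofReal_toReal hmt]
    exact ENNReal.ofReal_le_ofReal h8
  -- The strict event is an increasing union of events with thresholds p > ε, all of which satisfy
  -- the same bound.
  have hU : {ω : Fin N → Δ | ENNReal.ofReal ε < h.risk ω} =
      ⋃ j : ℕ, {ω : Fin N → Δ | ENNReal.ofReal (ε + 1 / (j + 1)) ≤ h.risk ω} := by
    ext ω
    simp only [Set.mem_ofPred_eq, Set.mem_iUnion]
    constructor
    · intro hω
      have h9 : ε < (h.risk ω).toReal :=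
        (ENNReal.ofReal_lt_iff_lt_toReal hε0.le (measure_ne_top _ _)).1 hω
      obtain ⟨j, hj⟩ := exists_nat_one_div_lt (sub_pos.2 h9)
      refine ⟨j, (ENNReal.ofReal_le_iff_le_toReal (measure_ne_top _ _)).2 ?_⟩
      change _ ≤ (h.risk ω).toReal
      linarith
    · rintro ⟨j, hj⟩
      refine lt_of_lt_of_le ((ENNReal.ofReal_lt_ofReal_iff (by positivity)).2 ?_) hj
      have : (0 : ℝ) < 1 / (j + 1) := by positivity
      linarith
  rw [hU, Monotone.measure_iUnion]
  · exact iSup_le fun j => key _ (by simp; positivity)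
  · intro i j hij ω hω
    refine le_trans (ENNReal.ofReal_le_ofReal ?_) hω
    gcongr

end IsScenarioValue

/-! ### Elementary bounds for exponential and logarithm. -/

section ExpBounds

theorem exp_neg_le_quadratic {s : ℝ} (hs : 0 ≤ s) : Real.exp (-s) ≤ 1 - s + s ^ 2 / 2 := by
  have hmono : Monotone fun s : ℝ => 1 - s + s ^ 2 / 2 - Real.exp (-s) := by
    refine monotone_of_hasDerivAt_nonneg (f' := fun s => -1 + s + Real.exp (-s)) ?_ ?_
    · intro x
      have h1 := ((hasDerivAt_id x).neg).exp
      have h2 := ((((hasDerivAt_const x (1 : ℝ)).sub (hasDerivAt_id x)).add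
        (((hasDerivAt_id x).pow 2).div_const 2))).sub h1
      refine h2.congr_deriv ?_
      simp
    · intro x
      have := Real.add_one_le_exp (-x)
      simp only [Pi.zero_apply]
      linarith
  have := hmono hs
  simp at this
  linarith

theorem cubic_le_exp_neg {s : ℝ} (hs : 0 ≤ s) :
    1 - s + s ^ 2 / 2 - s ^ 3 / 6 ≤ Real.exp (-s) := by
  have hd : ∀ x : ℝ, HasDerivAt (fun s : ℝ => Real.exp (-s) - (1 - s + s ^ 2 / 2 - s ^ 3 / 6))
      (1 - x + x ^ 2 / 2 - Real.exp (-x)) x := by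
    intro x
    have h1 := ((hasDerivAt_id x).neg).exp
    have h2 := h1.sub ((((hasDerivAt_const x (1 : ℝ)).sub (hasDerivAt_id x)).add
      (((hasDerivAt_id x).pow 2).div_const 2)).sub (((hasDerivAt_id x).pow 3).div_const 6))
    refine h2.congr_deriv ?_
    simp
    ring
  have hmono : MonotoneOn (fun s : ℝ => Real.exp (-s) - (1 - s + s ^ 2 / 2 - s ^ 3 / 6))
      (Set.Ici 0) := by
    refine monotoneOn_of_deriv_nonneg (convex_Ici 0)
      (fun x _ => (hd x).continuousAt.continuousWithinAt)
      (fun x _ => (hd x).differentiableAt.differentiableWithinAt) ?_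
    intro x hx
    rw [interior_Ici] at hx
    rw [(hd x).deriv]
    have := exp_neg_le_quadratic (le_of_lt hx)
    linarith
  have := hmono (Set.mem_Ici.2 le_rfl) (Set.mem_Ici.2 hs) hs
  simp at this
  linarith

theorem quadratic_le_exp_neg {s : ℝ} (hs : 0 ≤ s) (hs1 : s ≤ 3 / 10) :
    1 - s + 9 / 20 * s ^ 2 ≤ Real.exp (-s) := by
  refine le_trans ?_ (cubic_le_exp_neg hs)
  nlinarith [mul_nonneg (sq_nonneg s) (sub_nonneg.2 hs1)]

/-- Equivalent to x/2 ≤ sinh(x/2). -/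
theorem mul_exp_le_one_sub_exp_neg {x : ℝ} (hx : 0 ≤ x) :
    x * Real.exp (-(x / 2)) ≤ 1 - Real.exp (-x) := by
  have h1 : x / 2 ≤ Real.sinh (x / 2) := Real.self_le_sinh_iff.2 (by linarith)
  rw [Real.sinh_eq] at h1
  have h2 : Real.exp (x / 2) * Real.exp (-(x / 2)) = 1 := by rw [← Real.exp_add]; simp
  have h3 : Real.exp (-(x / 2)) * Real.exp (-(x / 2)) = Real.exp (-x) := by
    rw [← Real.exp_add]; ring_nf
  nlinarith [Real.exp_pos (-(x / 2))]

/-- Lower bound for the logarithm, with `x = 2 z / (1 + z)`. -/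
theorem le_neg_log_one_sub {x : ℝ} (hx0 : 0 < x) (hx1 : x < 1) :
    x * (1 + (x / (2 - x) + (x / (2 - x)) ^ 2 / 3 + (x / (2 - x)) ^ 3 / 3 +
      (x / (2 - x)) ^ 4 / 5)) ≤ - Real.log (1 - x) := by
  set z := x / (2 - x) with hz
  have h2x : 0 < 2 - x := by linarith
  have hz0 : 0 < z := div_pos hx0 h2x
  have hz1 : z < 1 := by rw [hz, div_lt_one h2x]; linarith
  have hxz : x = 2 * z / (1 + z) := by rw [hz]; field_simp; ring
  -- Since -log(1-x) = log((1+z)/(1-z)), three terms of the odd series in z suffice. Dividing by x =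
  -- 2z/(1+z) and dropping the z^5 term yields the stated quartic.
  have h := sum_le_hasSum (Finset.range 3) (fun k _ => by positivity)
    (Real.hasSum_log_sub_log_of_abs_lt_one (abs_lt.2 ⟨by linarith, hz1⟩))
  have hlog : Real.log (1 + z) - Real.log (1 - z) = - Real.log (1 - x) := by
    rw [← Real.log_div (by linarith) (by linarith), ← Real.log_inv]
    congr 1
    have h1z : 1 + z ≠ 0 := by linarith
    have h1x : 1 - x = (1 - z) / (1 + z) := by rw [hxz]; field_simp; ring
    rw [h1x, inv_div]
  rw [hlog] at h
  refine le_trans ?_ h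
  simp only [Finset.sum_range_succ, Finset.sum_range_zero]
  rw [hxz]
  have h1z : 1 + z ≠ 0 := by linarith
  have : 2 * z / (1 + z) * (1 + (z + z ^ 2 / 3 + z ^ 3 / 3 + z ^ 4 / 5)) =
    2 * (z + z ^ 3 / 3 + z ^ 5 / 5) - 2 * z ^ 6 / (5 * (1 + z)) := by
    field_simp
    ring
  rw [this]
  have : 0 ≤ 2 * z ^ 6 / (5 * (1 + z)) := by positivity
  push_cast
  linarith

end ExpBounds

/-! ### Polynomial inequalities by Horner evaluation. -/

section PolynomialBounds

/-- One Horner step with lower bounds: a nonpositive lower bound t for the tail allows z to be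
replaced by the endpoint h, and t' is a rounding of a + ht. -/
theorem horner_step {z h T t a t' : ℝ} (hz0 : 0 ≤ z) (hz1 : z ≤ h) (hT : t ≤ T) (ht : t ≤ 0)
    (h' : t' ≤ a + h * t) : t' ≤ a + z * T := by
  nlinarith [mul_le_mul_of_nonneg_left hT hz0, mul_le_mul_of_nonpos_right hz1 ht]

/-- The difference of the sides has degree 17 in z. It is bounded from the leading coefficient
downwards, each partial value being rounded down to a nonpositive number; the last one is 0. -/
theorem polynomial_bound_three {z : ℝ} (hz0 : 0 ≤ z) (hz1 : z ≤ 3 / 5) :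
    9 / 2 * (1 + z) ^ 5 ≤ 93 / 20 * ((1 + 27 / 10 * (z + z ^ 2 / 3 + z ^ 3 / 3 + z ^ 4 / 5)) ^ 3 *
      (1 - z) ^ 2 * ((1 + z) ^ 3 - 19 / 10 * z * (1 + z) ^ 2 +
        (19 / 10 * z) ^ 2 / 2 * (1 + z) - (19 / 10 * z) ^ 3 / 6)) := by
  have h17 : (-7/40 : ℝ) ≤ -871937217/5000000000 := by norm_num
  have h16 := horner_step hz0 hz1 h17 (by norm_num) (a := 1063531539/5000000000) (t' := 0) (by norm_num)
  have h15 := horner_step hz0 hz1 h16 (by norm_num) (a := 11286776763/5000000000) (t' := 0) (by norm_num)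
  have h14 := horner_step hz0 hz1 h15 (by norm_num) (a := 3786033069/1000000000) (t' := 0) (by norm_num)
  have h13 := horner_step hz0 hz1 h14 (by norm_num) (a := 1322290089/100000000) (t' := 0) (by norm_num)
  have h12 := horner_step hz0 hz1 h13 (by norm_num) (a := 13871785977/500000000) (t' := 0) (by norm_num)
  have h11 := horner_step hz0 hz1 h12 (by norm_num) (a := 2454153471/100000000) (t' := 0) (by norm_num)
  have h10 := horner_step hz0 hz1 h11 (by norm_num) (a := 3987616149/100000000) (t' := 0) (by norm_num)
  have h9 := horner_step hz0 hz1 h10 (by norm_num) (a := 4827972519/200000000) (t' := 0) (by norm_num)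
  have h8 := horner_step hz0 hz1 h9 (by norm_num) (a := -1709037657/40000000) (t' := -21363/500) (by norm_num)
  have h7 := horner_step hz0 hz1 h8 (by norm_num) (a := -2088222093/40000000) (t' := -38921/500) (by norm_num)
  have h6 := horner_step hz0 hz1 h7 (by norm_num) (a := -3776452767/40000000) (t' := -141117/1000) (by norm_num)
  have h5 := horner_step hz0 hz1 h6 (by norm_num) (a := -11191997/125000) (t' := -174207/1000) (by norm_num)
  have h4 := horner_step hz0 hz1 h5 (by norm_num) (a := -1153421/20000) (t' := -40549/250) (by norm_num)
  have h3 := horner_step hz0 hz1 h4 (by norm_num) (a := 227377/20000) (t' := -85949/1000) (by norm_num)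
  have h2 := horner_step hz0 hz1 h3 (by norm_num) (a := 137781/4000) (t' := -137/8) (by norm_num)
  have h1 := horner_step hz0 hz1 h2 (by norm_num) (a := 549/50) (t' := 0) (by norm_num)
  have h0 := horner_step hz0 hz1 h1 (by norm_num) (a := 3/20) (t' := 0) (by norm_num)
  rw [← sub_nonneg]
  refine h0.trans_eq ?_
  ring

theorem polynomial_bound_two {z : ℝ} (hz0 : 0 ≤ z) (hz1 : z ≤ 13 / 27) :
    4 * (1 + z) ^ 4 ≤ 17 / 4 * ((1 + 27 / 10 * (z + z ^ 2 / 3 + z ^ 3 / 3)) ^ 2 *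
      (1 - z) * (1 - (z + z ^ 2 / 3 + z ^ 3 / 3) / 2 +
        9 / 20 * ((z + z ^ 2 / 3 + z ^ 3 / 3) / 2) ^ 2) *
      ((1 + z) ^ 3 - 19 / 10 * z * (1 + z) ^ 2 +
        (19 / 10 * z) ^ 2 / 2 * (1 + z) - (19 / 10 * z) ^ 3 / 6)) := by
  have h16 : (0 : ℝ) ≤ 655911/64000000 := by norm_num
  have h15 := horner_step hz0 hz1 h16 (by norm_num) (a := -800037/64000000) (t' := -13/1000) (by norm_num)
  have h14 := horner_step hz0 hz1 h15 (by norm_num) (a := -537489/16000000) (t' := -1/25) (by norm_num)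
  have h13 := horner_step hz0 hz1 h14 (by norm_num) (a := -21724419/32000000) (t' := -699/1000) (by norm_num)
  have h12 := horner_step hz0 hz1 h13 (by norm_num) (a := -61935879/64000000) (t' := -261/200) (by norm_num)
  have h11 := horner_step hz0 hz1 h12 (by norm_num) (a := -197762751/64000000) (t' := -3719/1000) (by norm_num)
  have h10 := horner_step hz0 hz1 h11 (by norm_num) (a := 67294109/48000000) (t' := -389/1000) (by norm_num)
  have h9 := horner_step hz0 hz1 h10 (by norm_num) (a := -50156681/96000000) (t' := -71/100) (by norm_num)
  have h8 := horner_step hz0 hz1 h9 (by norm_num) (a := 2682419749/192000000) (t' := 0) (by norm_num)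
  have h7 := horner_step hz0 hz1 h8 (by norm_num) (a := -3253321229/576000000) (t' := -5649/1000) (by norm_num)
  have h6 := horner_step hz0 hz1 h7 (by norm_num) (a := -25716019/6400000) (t' := -6739/1000) (by norm_num)
  have h5 := horner_step hz0 hz1 h6 (by norm_num) (a := -1057706969/28800000) (t' := -39971/1000) (by norm_num)
  have h4 := horner_step hz0 hz1 h5 (by norm_num) (a := -23595547/960000) (t' := -5478/125) (by norm_num)
  have h3 := horner_step hz0 hz1 h4 (by norm_num) (a := -211409/16000) (t' := -17157/500) (by norm_num)
  have h2 := horner_step hz0 hz1 h3 (by norm_num) (a := 22109/4800) (t' := -2979/250) (by norm_num)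
  have h1 := horner_step hz0 hz1 h2 (by norm_num) (a := 21/4) (t' := -61/125) (by norm_num)
  have h0 := horner_step hz0 hz1 h1 (by norm_num) (a := 1/4) (t' := 0) (by norm_num)
  rw [← sub_nonneg]
  refine h0.trans_eq ?_
  ring

end PolynomialBounds

/-! ### One-variable inequalities left after optimizing over the number of samples. -/

section KeyInequalities

theorem cubic_aux_nonneg {z : ℝ} (hz0 : 0 ≤ z) (hz1 : z ≤ 1) :
    0 ≤ (1 + z) ^ 3 - 19 / 10 * z * (1 + z) ^ 2 +
        (19 / 10 * z) ^ 2 / 2 * (1 + z) - (19 / 10 * z) ^ 3 / 6 := by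
  have h : (1 + z) ^ 3 - 19 / 10 * z * (1 + z) ^ 2 +
        (19 / 10 * z) ^ 2 / 2 * (1 + z) - (19 / 10 * z) ^ 3 / 6 =
      1 + 11 / 10 * z + z ^ 2 * (201 / 200 - 1429 / 6000 * z) := by ring
  have h1 : 0 ≤ 201 / 200 - 1429 / 6000 * z := by linarith
  rw [h]
  positivity

/-- The common estimates behind `key_inequality_three` and `key_inequality_two`. -/
theorem key_estimates {x : ℝ} (hx0 : 0 < x) (hx1 : x ≤ 3 / 4) :
    ∃ z : ℝ, 0 < z ∧ x = 2 * z / (1 + z) ∧ 1 - x = (1 - z) / (1 + z) ∧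
      1 + 27 / 10 * (z + z ^ 2 / 3 + z ^ 3 / 3 + z ^ 4 / 5) ≤
        Real.exp 1 * (-Real.log (1 - x) / x - (1 - Real.exp (-1))) ∧
      ((1 + z) ^ 3 - 19 / 10 * z * (1 + z) ^ 2 +
        (19 / 10 * z) ^ 2 / 2 * (1 + z) - (19 / 10 * z) ^ 3 / 6) / (1 + z) ^ 3 ≤
        Real.exp (-(3 / 2 * (1 - Real.exp (-1)) * x)) := by
  have he1 := Real.exp_one_gt_d9
  have he2 := Real.exp_neg_one_gt_d9
  have h2x : 0 < 2 - x := by linarith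
  have hz0 : 0 < x / (2 - x) := div_pos hx0 h2x
  have hlog := le_neg_log_one_sub hx0 (by linarith)
  have hxz : x = 2 * (x / (2 - x)) / (1 + x / (2 - x)) := by field_simp; ring
  generalize x / (2 - x) = z at *
  have h1z : 0 < 1 + z := by linarith
  refine ⟨z, hz0, hxz, by rw [hxz]; field_simp; ring, ?_, ?_⟩
  -- Since e(1 - 1/e) = e - 1, the right side is 1 + e(-log(1-x)/x - 1), and 27/10 is a lower bound
  -- for e.
  · have h1 : 1 + (z + z ^ 2 / 3 + z ^ 3 / 3 + z ^ 4 / 5) ≤ -Real.log (1 - x) / x := by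
      rw [le_div_iff₀ hx0, mul_comm]; exact hlog
    have h2 : Real.exp 1 * Real.exp (-1) = 1 := by rw [← Real.exp_add]; simp
    have h3 : 0 ≤ z + z ^ 2 / 3 + z ^ 3 / 3 + z ^ 4 / 5 := by positivity
    nlinarith [mul_le_mul_of_nonneg_left h1 (Real.exp_pos 1).le]
  -- Here 19/10 bounds 3(1 - 1/e) from above, and the cubic Taylor polynomial bounds the exponential
  -- from below.
  · have h4 : 3 / 2 * (1 - Real.exp (-1)) * x ≤ 19 / 10 * z / (1 + z) := by
      have : 3 / 2 * (1 - Real.exp (-1)) * x = (3 * (1 - Real.exp (-1))) * z / (1 + z) := by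
        rw [hxz]; ring
      rw [this]
      gcongr
      linarith
    refine le_trans ?_ (Real.exp_le_exp.2 (neg_le_neg h4))
    refine le_trans (le_of_eq ?_) (cubic_le_exp_neg (by positivity))
    field_simp

/-- The substitution x = 2z/(1+z) and the estimates of `key_estimates` turn this into
`polynomial_bound_three`; 93/20 is a lower bound for e² - e. -/
theorem key_inequality_three {x : ℝ} (hx0 : 0 < x) (hx1 : x ≤ 3 / 4) :
    9 / 2 * Real.exp (3 / 2 * (1 - Real.exp (-1)) * x) ≤
      (Real.exp 1 * (-Real.log (1 - x) / x - (1 - Real.exp (-1)))) ^ 3 * (1 - x) ^ 2 *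
        (Real.exp 2 * (1 - Real.exp (-1))) := by
  have he1 := Real.exp_one_gt_d9
  obtain ⟨z, hz0, hxz, h1x, hκ, hE⟩ := key_estimates hx0 hx1
  set κ := Real.exp 1 * (-Real.log (1 - x) / x - (1 - Real.exp (-1)))
  set s := 3 / 2 * (1 - Real.exp (-1)) * x
  have h1z : 0 < 1 + z := by linarith
  have hz1 : z ≤ 3 / 5 := by
    have : 2 * z / (1 + z) ≤ 3 / 4 := hxz ▸ hx1
    rw [div_le_iff₀ h1z] at this
    linarith
  have hc : 93 / 20 ≤ Real.exp 2 * (1 - Real.exp (-1)) := by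
    have h2 : Real.exp 2 * Real.exp (-1) = Real.exp 1 := by rw [← Real.exp_add]; norm_num
    have h3 : Real.exp 2 = Real.exp 1 * Real.exp 1 := by rw [← Real.exp_add]; norm_num
    rw [mul_sub, h2, h3]
    nlinarith
  have hp := polynomial_bound_three hz0.le hz1
  set κ₀ := 1 + 27 / 10 * (z + z ^ 2 / 3 + z ^ 3 / 3 + z ^ 4 / 5)
  set E := (1 + z) ^ 3 - 19 / 10 * z * (1 + z) ^ 2 +
        (19 / 10 * z) ^ 2 / 2 * (1 + z) - (19 / 10 * z) ^ 3 / 6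
  have hκ0 : 0 ≤ κ₀ := by positivity
  have hE0 : 0 ≤ E := cubic_aux_nonneg hz0.le (by linarith)
  have h1 : 9 / 2 ≤ κ ^ 3 * (1 - x) ^ 2 * (Real.exp 2 * (1 - Real.exp (-1))) * Real.exp (-s) := by
    have h2 : 9 / 2 ≤ κ₀ ^ 3 * (1 - x) ^ 2 * (93 / 20) * (E / (1 + z) ^ 3) := by
      rw [h1x]
      rw [show κ₀ ^ 3 * ((1 - z) / (1 + z)) ^ 2 * (93 / 20) * (E / (1 + z) ^ 3) =
        93 / 20 * (κ₀ ^ 3 * (1 - z) ^ 2 * E) / (1 + z) ^ 5 by field_simp]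
      rw [le_div_iff₀ (by positivity)]
      exact hp
    have h1x0 : 0 ≤ 1 - x := by linarith
    have hκκ : 0 ≤ κ := hκ0.trans hκ
    have hc0 : 0 ≤ Real.exp 2 * (1 - Real.exp (-1)) := by linarith
    refine h2.trans ?_
    gcongr
  calc 9 / 2 * Real.exp s ≤ κ ^ 3 * (1 - x) ^ 2 * (Real.exp 2 * (1 - Real.exp (-1))) *
        Real.exp (-s) * Real.exp s := by gcongr
    _ = _ := by rw [mul_assoc, ← Real.exp_add]; simp

/-- The function y² exp(-y/(2e)) increases up to y = 4e, and it is compared here at κ₀ and at eμ ≤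
4e. -/
theorem sq_mul_exp_neg_mono {κ₀ μ : ℝ} (h0 : 0 ≤ κ₀) (h1 : κ₀ ≤ Real.exp 1 * μ) (h4 : μ ≤ 4) :
    κ₀ ^ 2 * Real.exp (-(κ₀ / (2 * Real.exp 1))) ≤
      (Real.exp 1 * μ) ^ 2 * Real.exp (-(μ / 2)) := by
  have h2 : κ₀ ≤ (Real.exp 1 * μ) * Real.exp (-((Real.exp 1 * μ - κ₀) / (4 * Real.exp 1))) := by
    have h3 := Real.one_sub_le_exp_neg ((Real.exp 1 * μ - κ₀) / (4 * Real.exp 1))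
    refine le_trans ?_ (mul_le_mul_of_nonneg_left h3 (h0.trans h1))
    have h5 : (Real.exp 1 * μ) * ((Real.exp 1 * μ - κ₀) / (4 * Real.exp 1)) =
        μ / 4 * (Real.exp 1 * μ - κ₀) := by field_simp
    rw [mul_sub, mul_one, h5]
    have : μ / 4 * (Real.exp 1 * μ - κ₀) ≤ 1 * (Real.exp 1 * μ - κ₀) :=
      mul_le_mul_of_nonneg_right (by linarith) (by linarith)
    linarith
  have h6 := pow_le_pow_left₀ h0 h2 2
  rw [mul_pow, ← Real.exp_nat_mul] at h6
  calc _ ≤ (Real.exp 1 * μ) ^ 2 * Real.exp ((2 : ℕ) * -((Real.exp 1 * μ - κ₀) /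
        (4 * Real.exp 1))) * Real.exp (-(κ₀ / (2 * Real.exp 1))) := by gcongr
    _ = _ := by
      rw [mul_assoc, ← Real.exp_add]
      congr 2
      push_cast
      field_simp
      ring

/-- The constant 8312/10000 bounds exp(-1/(2e)) from below; the rest of the exponent is at most q/2
because e > 27/10. -/
theorem exp_neg_lower {q : ℝ} (hq0 : 0 ≤ q) (hq1 : q ≤ 6 / 10) :
    8312 / 10000 * (1 - q / 2 + 9 / 20 * (q / 2) ^ 2) ≤
      Real.exp (-((1 + 27 / 10 * q) / (2 * Real.exp 1))) := by
  have he1 := Real.exp_one_gt_d9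
  have he3 := Real.exp_neg_one_gt_d9
  have he4 := Real.exp_neg_one_lt_d9
  have h3 : Real.exp 1 * Real.exp (-1) = 1 := by rw [← Real.exp_add]; simp
  have h2 : (1 + 27 / 10 * q) / (2 * Real.exp 1) ≤ Real.exp (-1) / 2 + q / 2 := by
    rw [div_le_iff₀ (by positivity)]
    have h5 : (Real.exp (-1) / 2 + q / 2) * (2 * Real.exp 1) =
      Real.exp 1 * Real.exp (-1) + Real.exp 1 * q := by ring
    have h6 : 27 / 10 * q ≤ Real.exp 1 * q := mul_le_mul_of_nonneg_right (by linarith) hq0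
    rw [h5, h3]
    linarith
  refine le_trans ?_ (Real.exp_le_exp.2 (neg_le_neg h2))
  rw [neg_add, Real.exp_add]
  have h4 : (8312 : ℝ) / 10000 ≤ Real.exp (-(Real.exp (-1) / 2)) := by
    refine le_trans ?_ (quadratic_le_exp_neg (by positivity) (by linarith))
    have : (0.1839 : ℝ) ^ 2 ≤ (Real.exp (-1) / 2) ^ 2 :=
      pow_le_pow_left₀ (by norm_num) (by linarith) 2
    norm_num at this
    linarith
  have h5 := quadratic_le_exp_neg (s := q / 2) (by positivity) (by linarith)
  have h6 : 0 ≤ 1 - q / 2 + 9 / 20 * (q / 2) ^ 2 := by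
    have := sq_nonneg (q / 2)
    linarith
  gcongr

/-- The factor exp(μ/2) also involves the logarithm, so μ cannot simply be replaced by its lower
bound. It is moved to the other side, where y² exp(-y/(2e)) is monotone in y = eμ in the range
needed. Then 17/4 ≤ 3(e-1)·0.8312 reduces the claim to `polynomial_bound_two`. -/
theorem key_inequality_two {x : ℝ} (hx0 : 0 < x) (hx1 : x ≤ 13 / 20) :
    4 * (Real.exp ((-Real.log (1 - x) / x - (1 - Real.exp (-1))) / 2) *
      Real.exp (3 / 2 * (1 - Real.exp (-1)) * x)) ≤
      3 * (Real.exp 1 - 1) * (Real.exp 1 * (-Real.log (1 - x) / x - (1 - Real.exp (-1)))) ^ 2 *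
        (1 - x) := by
  have he1 := Real.exp_one_gt_d9
  have he2 := Real.exp_one_lt_d9
  have he3 := Real.exp_neg_one_gt_d9
  have he4 := Real.exp_neg_one_lt_d9
  obtain ⟨z, hz0, hxz, h1x, hκ, hE⟩ := key_estimates hx0 (by linarith)
  set μ := -Real.log (1 - x) / x - (1 - Real.exp (-1)) with hμ
  set s := 3 / 2 * (1 - Real.exp (-1)) * x
  have h1z : 0 < 1 + z := by linarith
  have hz1 : z ≤ 13 / 27 := by
    have : 2 * z / (1 + z) ≤ 13 / 20 := hxz ▸ hx1
    rw [div_le_iff₀ h1z] at this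
    linarith
  have hp := polynomial_bound_two hz0.le hz1
  set q := z + z ^ 2 / 3 + z ^ 3 / 3 with hq
  set E := (1 + z) ^ 3 - 19 / 10 * z * (1 + z) ^ 2 +
        (19 / 10 * z) ^ 2 / 2 * (1 + z) - (19 / 10 * z) ^ 3 / 6
  have hE0 : 0 ≤ E := cubic_aux_nonneg hz0.le (by linarith)
  have hq0 : 0 ≤ q := by positivity
  have hq1 : q ≤ 6 / 10 := by
    have h2 : z ^ 2 ≤ (13 / 27) ^ 2 := by gcongr
    have h3 : z ^ 3 ≤ (13 / 27) ^ 3 := by gcongr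
    rw [hq]; norm_num at h2 h3; linarith
  set κ₀ := 1 + 27 / 10 * q with hκ₀
  have hκ0 : κ₀ ≤ Real.exp 1 * μ := by
    refine le_trans ?_ hκ
    have : 0 ≤ z ^ 4 / 5 := by positivity
    linarith
  have hκ1 : 1 ≤ κ₀ := by linarith
  have hμ4 : μ ≤ 4 := by
    have h2 : -Real.log (1 - x) ≤ x / (1 - x) := by
      rw [← Real.log_inv]
      refine (Real.log_le_sub_one_of_pos (inv_pos.2 (by linarith))).trans_eq ?_
      have : 1 - x ≠ 0 := by linarith
      field_simp
      ring
    have h3 : -Real.log (1 - x) / x ≤ 1 / (1 - x) := by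
      rw [div_le_iff₀ hx0]
      refine h2.trans_eq ?_
      ring
    have h4 : 1 / (1 - x) ≤ 1 / (7 / 20) := by
      apply one_div_le_one_div_of_le <;> linarith
    have : (1 : ℝ) / (7 / 20) ≤ 3 := by norm_num
    linarith
  have hmono := sq_mul_exp_neg_mono (by linarith) hκ0 hμ4
  have hκexp : 8312 / 10000 * (1 - q / 2 + 9 / 20 * (q / 2) ^ 2) ≤
      Real.exp (-(κ₀ / (2 * Real.exp 1))) := exp_neg_lower hq0 hq1
  have h1 : 4 ≤ 3 * (Real.exp 1 - 1) * ((Real.exp 1 * μ) ^ 2 * Real.exp (-(μ / 2))) *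
      (1 - x) * Real.exp (-s) := by
    have h2 : 4 ≤ 3 * (Real.exp 1 - 1) * (κ₀ ^ 2 * (8312 / 10000 *
        (1 - q / 2 + 9 / 20 * (q / 2) ^ 2))) * (1 - x) * (E / (1 + z) ^ 3) := by
      have h7 : 17 / 4 ≤ 3 * (Real.exp 1 - 1) * (8312 / 10000) := by linarith
      have h8 : 4 ≤ 17 / 4 * (κ₀ ^ 2 * (1 - q / 2 + 9 / 20 * (q / 2) ^ 2) *
          (1 - x) * (E / (1 + z) ^ 3)) := by
        rw [h1x, show 17 / 4 * (κ₀ ^ 2 * (1 - q / 2 + 9 / 20 * (q / 2) ^ 2) *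
          ((1 - z) / (1 + z)) * (E / (1 + z) ^ 3)) = 17 / 4 * (κ₀ ^ 2 * (1 - z) *
            (1 - q / 2 + 9 / 20 * (q / 2) ^ 2) * E) / (1 + z) ^ 4 by field_simp,
          le_div_iff₀ (by positivity)]
        exact hp
      have h9 : 0 ≤ κ₀ ^ 2 * (1 - q / 2 + 9 / 20 * (q / 2) ^ 2) * (1 - x) *
          (E / (1 + z) ^ 3) := by
        have h6 : 0 ≤ 1 - q / 2 + 9 / 20 * (q / 2) ^ 2 := by
          have := sq_nonneg (q / 2)
          linarith
        have : 0 ≤ 1 - x := by linarith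
        positivity
      calc (4 : ℝ) ≤ _ := h8
        _ ≤ _ := mul_le_mul_of_nonneg_right h7 h9
        _ = _ := by ring
    refine h2.trans ?_
    have : 0 ≤ 1 - x := by linarith
    have : 0 ≤ Real.exp 1 - 1 := by linarith
    have h10 : κ₀ ^ 2 * (8312 / 10000 * (1 - q / 2 + 9 / 20 * (q / 2) ^ 2)) ≤
        (Real.exp 1 * μ) ^ 2 * Real.exp (-(μ / 2)) :=
      (mul_le_mul_of_nonneg_left hκexp (sq_nonneg _)).trans hmono
    gcongr
  calc 4 * (Real.exp (μ / 2) * Real.exp s) ≤ 3 * (Real.exp 1 - 1) * ((Real.exp 1 * μ) ^ 2 *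
        Real.exp (-(μ / 2))) * (1 - x) * Real.exp (-s) * (Real.exp (μ / 2) * Real.exp s) := by
        gcongr
    _ = 3 * (Real.exp 1 - 1) * (Real.exp 1 * μ) ^ 2 * (1 - x) *
        ((Real.exp (-(μ / 2)) * Real.exp (μ / 2)) * (Real.exp (-s) * Real.exp s)) := by ring
    _ = _ := by rw [← Real.exp_add, ← Real.exp_add]; simp

end KeyInequalities

/-! ### Binomial distribution functions and Chernoff bounds. -/

section BinomialTail

/-- The mass at `d` of the binomial distribution with `N` trials of success probability `x`. -/
noncomputable def binomialMass (N d : ℕ) (x : ℝ) : ℝ := N.choose d * (x ^ d * (1 - x) ^ (N - d))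

/-- The distribution function at `k` of the binomial distribution. -/
noncomputable def binomialCdf (N k : ℕ) (x : ℝ) : ℝ := ∑ d ∈ Finset.range (k + 1), binomialMass N d x

theorem binomialMass_nonneg {N d : ℕ} {x : ℝ} (hx0 : 0 ≤ x) (hx1 : x ≤ 1) :
    0 ≤ binomialMass N d x := by
  have : 0 ≤ 1 - x := by linarith
  unfold binomialMass
  positivity

theorem binomialMass_succ_zero (N : ℕ) (x : ℝ) :
    binomialMass (N + 1) 0 x = (1 - x) * binomialMass N 0 x := by
  simp [binomialMass, pow_succ, mul_comm]

theorem binomialMass_succ_succ (N d : ℕ) (x : ℝ) :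
    binomialMass (N + 1) (d + 1) x = (1 - x) * binomialMass N (d + 1) x + x * binomialMass N d x := by
  unfold binomialMass
  rw [Nat.choose_succ_succ, Nat.add_sub_add_right]
  push_cast
  rcases Nat.lt_or_ge N (d + 1) with h | h
  · rw [Nat.choose_eq_zero_of_lt h]
    push_cast
    ring
  · obtain ⟨j, rfl⟩ := Nat.exists_eq_add_of_le h
    rw [show d + 1 + j - d = j + 1 by omega, show d + 1 + j - (d + 1) = j by omega]
    ring

theorem binomialCdf_zero_right (N : ℕ) (x : ℝ) : binomialCdf N 0 x = (1 - x) ^ N := by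
  simp [binomialCdf, binomialMass]

theorem binomialCdf_succ_right (N k : ℕ) (x : ℝ) :
    binomialCdf N (k + 1) x = binomialCdf N k x + binomialMass N (k + 1) x :=
  Finset.sum_range_succ _ _

theorem binomialCdf_succ_left (N k : ℕ) (x : ℝ) :
    binomialCdf (N + 1) k x = binomialCdf N k x - x * binomialMass N k x := by
  induction k with
  | zero =>
    simp only [binomialCdf, zero_add, Finset.sum_range_one, binomialMass_succ_zero]
    ring
  | succ k ih =>
    rw [binomialCdf_succ_right, binomialCdf_succ_right, ih, binomialMass_succ_succ]
    ring

theorem binomialCdf_succ_succ (N k : ℕ) (x : ℝ) :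
    binomialCdf (N + 1) (k + 1) x = (1 - x) * binomialCdf N (k + 1) x + x * binomialCdf N k x := by
  rw [binomialCdf_succ_left, binomialCdf_succ_right]
  ring

theorem binomialCdf_zero_left (k : ℕ) (x : ℝ) : binomialCdf 0 k x = 1 := by
  unfold binomialCdf
  rw [Finset.sum_range_succ']
  simp [binomialMass]

theorem binomialCdf_le_one {x : ℝ} (hx0 : 0 ≤ x) (hx1 : x ≤ 1) (N k : ℕ) :
    binomialCdf N k x ≤ 1 := by
  induction N with
  | zero => rw [binomialCdf_zero_left]
  | succ N ih =>
    rw [binomialCdf_succ_left]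
    have := mul_nonneg hx0 (binomialMass_nonneg (N := N) (d := k) hx0 hx1)
    linarith

/-- The Chernoff bound with parameter 1, by induction through Pascal's rule and (1-x) + x/e = 1 -
(1-1/e)x. Its exponent exceeds the one finally needed by one unit. -/
theorem binomialCdf_le_exp {x : ℝ} (hx0 : 0 ≤ x) (hx1 : x ≤ 1) (N k : ℕ) :
    binomialCdf N k x ≤ Real.exp k * (1 - (1 - Real.exp (-1)) * x) ^ N := by
  have he := Real.exp_pos (-1)
  have hq : 1 - x ≤ 1 - (1 - Real.exp (-1)) * x := by nlinarith
  have h1x : 0 ≤ 1 - x := by linarith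
  induction N generalizing k with
  | zero =>
    rw [binomialCdf_zero_left, pow_zero, mul_one]
    exact Real.one_le_exp (Nat.cast_nonneg k)
  | succ N ih =>
    cases k with
    | zero =>
      rw [binomialCdf_zero_right, Nat.cast_zero, Real.exp_zero, one_mul]
      exact pow_le_pow_left₀ h1x hq _
    | succ k =>
      rw [binomialCdf_succ_succ]
      have h1 := mul_le_mul_of_nonneg_left (ih (k + 1)) h1x
      have h2 := mul_le_mul_of_nonneg_left (ih k) hx0
      have h3 : Real.exp (k : ℝ) = Real.exp ((k + 1 : ℕ) : ℝ) * Real.exp (-1) := by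
        rw [← Real.exp_add]; push_cast; ring_nf
      rw [h3] at h2
      refine (add_le_add h1 h2).trans_eq ?_
      ring

/-- One-step bounds are propagated to larger `k`. -/
theorem binomialCdf_le_of_le {x : ℝ} (hx0 : 0 ≤ x) (hx1 : x ≤ 1) {k₀ : ℕ}
    (h : ∀ N : ℕ, binomialCdf N k₀ x ≤ Real.exp (k₀ - 1 - (1 - Real.exp (-1)) * N * x))
    {k : ℕ} (hk : k₀ ≤ k) (N : ℕ) :
    binomialCdf N k x ≤ Real.exp (k - 1 - (1 - Real.exp (-1)) * N * x) := by
  induction k, hk using Nat.le_induction generalizing N with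
  | base => exact h N
  | succ k hk ih =>
    induction N with
    | zero =>
      rw [binomialCdf_zero_left]
      refine Real.one_le_exp ?_
      push_cast
      have : (0 : ℝ) ≤ k := Nat.cast_nonneg k
      linarith
    | succ N ihN =>
      rw [binomialCdf_succ_succ]
      have h1 := mul_le_mul_of_nonneg_left ihN (by linarith : 0 ≤ 1 - x)
      have h2 := mul_le_mul_of_nonneg_left (ih N) hx0
      set A := Real.exp (((k + 1 : ℕ) : ℝ) - 1 - (1 - Real.exp (-1)) * N * x) with hA
      have h3 : Real.exp ((k : ℝ) - 1 - (1 - Real.exp (-1)) * N * x) = A * Real.exp (-1) := by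
        rw [hA, ← Real.exp_add]; push_cast; ring_nf
      rw [h3] at h2
      have h4 : Real.exp (((k + 1 : ℕ) : ℝ) - 1 - (1 - Real.exp (-1)) * ((N + 1 : ℕ) : ℝ) * x) =
          A * Real.exp (-((1 - Real.exp (-1)) * x)) := by
        rw [hA, ← Real.exp_add]; push_cast; ring_nf
      rw [h4]
      -- Pascal's rule produces the factor (1-x) + x/e = 1 - (1-1/e)x, which is at most the decay of
      -- the target in one step.
      have h5 := mul_le_mul_of_nonneg_left
        (Real.one_sub_le_exp_neg ((1 - Real.exp (-1)) * x)) (Real.exp_pos _ : 0 < A).le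
      refine le_trans ?_ h5
      linarith

theorem tendsto_pow_one_sub_zero {x : ℝ} (hx0 : 0 < x) (hx1 : x < 1) :
    Filter.Tendsto (fun N : ℕ => (1 - (1 - Real.exp (-1)) * x) ^ N) Filter.atTop (nhds 0) := by
  have h1 := Real.exp_pos (-1)
  have h2 : Real.exp (-1) < 1 := Real.exp_neg_one_lt_d9.trans (by norm_num)
  refine tendsto_pow_atTop_nhds_zero_of_lt_one ?_ ?_ <;> nlinarith

/-- A sequence with sufficiently large increments that tends to zero is bounded by `exp`. -/
theorem le_exp_of_increments {x s : ℝ} {b : ℕ → ℝ} {N₀ : ℕ}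
    (hb : Filter.Tendsto b Filter.atTop (nhds 0))
    (h : ∀ N, N₀ ≤ N → b N - b (N + 1) ≤ Real.exp (s - (1 - Real.exp (-1)) * N * x) *
      (1 - Real.exp (-((1 - Real.exp (-1)) * x)))) {N : ℕ} (hN : N₀ ≤ N) :
    b N ≤ Real.exp (s - (1 - Real.exp (-1)) * N * x) := by
  set t : ℕ → ℝ := fun N => Real.exp (s - (1 - Real.exp (-1)) * N * x) with ht
  -- In each step t loses at least as much as b, so b - t is nondecreasing; since b tends to 0 and t
  -- is positive, b - t can never exceed 0.
  have hstep : ∀ M, N₀ ≤ M → b M - t M ≤ b (M + 1) - t (M + 1) := by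
    intro M hM
    have h1 := h M hM
    have h2 : t (M + 1) = t M * Real.exp (-((1 - Real.exp (-1)) * x)) := by
      simp only [ht]
      rw [← Real.exp_add]; push_cast; ring_nf
    rw [h2]
    simp only [ht] at *
    linarith
  have hmono : ∀ j, b N - t N ≤ b (N + j) - t (N + j) := by
    intro j
    induction j with
    | zero => exact le_rfl
    | succ j ih => exact ih.trans (hstep (N + j) (by omega))
  have hlim : Filter.Tendsto (fun j => b (N + j)) Filter.atTop (nhds 0) := by
    have := hb.comp (Filter.tendsto_add_atTop_nat N)
    refine this.congr fun j => ?_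
    simp [add_comm]
  have : b N - t N ≤ 0 := by
    refine ge_of_tendsto' hlim fun j => ?_
    have h1 : 0 < t (N + j) := Real.exp_pos _
    linarith [hmono j]
  linarith

end BinomialTail

/-! ### Decrements of the binomial tails compared with those of the exponential. -/

section Increments

theorem le_mul_exp_sub_one {a b : ℝ} (ha : 0 < a) : b ≤ a * Real.exp (b / a - 1) := by
  have h := Real.add_one_le_exp (b / a - 1)
  rw [sub_add_cancel, div_le_iff₀ ha] at h
  linarith

/-- With m = N - 1 this bounds x times the binomial mass at 3. Writing (1-x)^m = exp(-(μ+c)xm), the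
cubic is absorbed by m ≤ a·exp(m/a - 1) with a = 3/(μx). This leaves exp(-cxm), as on the right, and
an inequality in x alone. -/
theorem increment_aux_three {x m : ℝ} (hx0 : 0 < x) (hx1 : x ≤ 3 / 4) (hm : 0 ≤ m) :
    x ^ 4 * (m ^ 3 / 6) * Real.exp (Real.log (1 - x) * (m - 2)) ≤
      Real.exp (2 - (1 - Real.exp (-1)) * (m + 1) * x) *
        (1 - Real.exp (-((1 - Real.exp (-1)) * x))) := by
  obtain ⟨z, hz0, -, -, hκ, -⟩ := key_estimates hx0 hx1
  have key := key_inequality_three hx0 hx1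
  have hc0 : 0 < 1 - Real.exp (-1) := by
    have := Real.exp_neg_one_lt_d9
    linarith
  set c := 1 - Real.exp (-1)
  set μ := -Real.log (1 - x) / x - c with hμ
  have hμ0 : 0 < μ := by
    have h1 : 0 < Real.exp 1 * μ := lt_of_lt_of_le (by positivity) hκ
    exact (mul_pos_iff_of_pos_left (Real.exp_pos 1)).1 h1
  have hlog : Real.log (1 - x) = -(μ * x + c * x) := by
    rw [hμ]; field_simp; ring
  have h1x : 1 - x = Real.exp (-(μ * x + c * x)) := by
    rw [← hlog, Real.exp_log (by linarith)]
  have hm3 : m ^ 3 ≤ (3 / (μ * x)) ^ 3 * Real.exp (μ * x * m - 3) := by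
    have h := pow_le_pow_left₀ hm (le_mul_exp_sub_one (a := 3 / (μ * x)) (b := m)
      (by positivity)) 3
    rw [mul_pow, ← Real.exp_nat_mul] at h
    refine h.trans_eq ?_
    congr 2
    push_cast
    field_simp
  have hkey2 : 9 / 2 / μ ^ 3 * Real.exp (2 * (μ * x + c * x) - 3) ≤
      Real.exp 2 * c * Real.exp (-(3 / 2 * c * x)) := by
    rw [h1x, mul_pow, ← Real.exp_nat_mul, ← Real.exp_nat_mul] at key
    have h := mul_le_mul_of_nonneg_right key
      (Real.exp_pos (2 * (μ * x + c * x) - 3 - 3 / 2 * c * x)).le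
    have e1 : 9 / 2 * Real.exp (3 / 2 * c * x) * Real.exp (2 * (μ * x + c * x) - 3 - 3 / 2 * c * x)
        = 9 / 2 * Real.exp (2 * (μ * x + c * x) - 3) := by
      rw [mul_assoc, ← Real.exp_add]; ring_nf
    have e2 : Real.exp ((3 : ℕ) * 1) * μ ^ 3 * Real.exp ((2 : ℕ) * -(μ * x + c * x)) *
        (Real.exp 2 * c) * Real.exp (2 * (μ * x + c * x) - 3 - 3 / 2 * c * x) =
        (Real.exp 2 * c * (Real.exp ((3 : ℕ) * 1) * Real.exp ((2 : ℕ) * -(μ * x + c * x)) *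
          Real.exp (2 * (μ * x + c * x) - 3 - 3 / 2 * c * x))) * μ ^ 3 := by ring
    rw [e1, e2, ← Real.exp_add, ← Real.exp_add] at h
    rw [div_mul_eq_mul_div, div_le_iff₀ (by positivity)]
    refine h.trans_eq ?_
    congr 3
    push_cast
    ring_nf
  calc x ^ 4 * (m ^ 3 / 6) * Real.exp (Real.log (1 - x) * (m - 2))
      ≤ x ^ 4 * ((3 / (μ * x)) ^ 3 * Real.exp (μ * x * m - 3) / 6) *
        Real.exp (Real.log (1 - x) * (m - 2)) := by gcongr
    _ = x * (9 / 2 / μ ^ 3 * Real.exp (2 * (μ * x + c * x) - 3)) * Real.exp (-(c * x * m)) := by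
        have e3 : Real.exp (μ * x * m - 3) * Real.exp (Real.log (1 - x) * (m - 2)) =
            Real.exp (2 * (μ * x + c * x) - 3) * Real.exp (-(c * x * m)) := by
          rw [← Real.exp_add, ← Real.exp_add, hlog]; ring_nf
        rw [show x ^ 4 * ((3 / (μ * x)) ^ 3 * Real.exp (μ * x * m - 3) / 6) *
          Real.exp (Real.log (1 - x) * (m - 2)) = x ^ 4 * (3 / (μ * x)) ^ 3 / 6 *
            (Real.exp (μ * x * m - 3) * Real.exp (Real.log (1 - x) * (m - 2))) by ring, e3]
        field_simp
        norm_num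
    _ ≤ x * (Real.exp 2 * c * Real.exp (-(3 / 2 * c * x))) * Real.exp (-(c * x * m)) := by gcongr
    _ = Real.exp (2 - c * (m + 1) * x) * (c * x * Real.exp (-(c * x / 2))) := by
        have e4 : Real.exp 2 * Real.exp (-(3 / 2 * c * x)) * Real.exp (-(c * x * m)) =
            Real.exp (2 - c * (m + 1) * x) * Real.exp (-(c * x / 2)) := by
          rw [← Real.exp_add, ← Real.exp_add, ← Real.exp_add]; ring_nf
        linear_combination x * c * e4
    _ ≤ _ := by
        gcongr
        exact mul_exp_le_one_sub_exp_neg (by positivity)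

/-- The same method with w = (N-1)x + 1/2 and a = 2/μ; the shift by 1/2 is the source of exp(μ/2) in
`key_inequality_two`. -/
theorem increment_aux_two {x w : ℝ} (hx0 : 0 < x) (hx1 : x ≤ 13 / 20) (hw : 0 ≤ w) :
    x / 3 * w ^ 2 * Real.exp (Real.log (1 - x) * ((w - 1 / 2) / x - 1)) ≤
      Real.exp (1 - (1 - Real.exp (-1)) * (w - 1 / 2) - (1 - Real.exp (-1)) * x) *
        (1 - Real.exp (-((1 - Real.exp (-1)) * x))) := by
  obtain ⟨z, hz0, -, -, hκ, -⟩ := key_estimates hx0 (by linarith)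
  have key := key_inequality_two hx0 hx1
  have hec : Real.exp 1 - 1 = Real.exp 1 * (1 - Real.exp (-1)) := by
    rw [mul_sub, ← Real.exp_add]; simp
  rw [hec] at key
  have hc0 : 0 < 1 - Real.exp (-1) := by
    have := Real.exp_neg_one_lt_d9
    linarith
  set c := 1 - Real.exp (-1)
  set μ := -Real.log (1 - x) / x - c with hμ
  have hμ0 : 0 < μ := by
    have h1 : 0 < Real.exp 1 * μ := lt_of_lt_of_le (by positivity) hκ
    exact (mul_pos_iff_of_pos_left (Real.exp_pos 1)).1 h1
  have hlog : Real.log (1 - x) = -(μ * x + c * x) := by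
    rw [hμ]; field_simp; ring
  have h1x : 1 - x = Real.exp (-(μ * x + c * x)) := by
    rw [← hlog, Real.exp_log (by linarith)]
  have hw2 : w ^ 2 ≤ (2 / μ) ^ 2 * Real.exp (μ * w - 2) := by
    have h := pow_le_pow_left₀ hw (le_mul_exp_sub_one (a := 2 / μ) (b := w) (by positivity)) 2
    rw [mul_pow, ← Real.exp_nat_mul] at h
    refine h.trans_eq ?_
    congr 2
    push_cast
    field_simp
  have hkey2 : 4 / 3 / μ ^ 2 * Real.exp (μ / 2 + (μ * x + c * x) - 2) ≤
      Real.exp 1 * c * Real.exp (-(3 / 2 * c * x)) := by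
    rw [h1x, mul_pow, ← Real.exp_nat_mul, ← Real.exp_add] at key
    have h := mul_le_mul_of_nonneg_right key
      (Real.exp_pos (μ * x + c * x - 2 - 3 / 2 * c * x)).le
    have e1 : 4 * Real.exp (μ / 2 + 3 / 2 * c * x) * Real.exp (μ * x + c * x - 2 - 3 / 2 * c * x)
        = 4 * Real.exp (μ / 2 + (μ * x + c * x) - 2) := by
      rw [mul_assoc, ← Real.exp_add]; ring_nf
    have e2 : 3 * (Real.exp 1 * c) * (Real.exp ((2 : ℕ) * 1) * μ ^ 2) *
        Real.exp (-(μ * x + c * x)) * Real.exp (μ * x + c * x - 2 - 3 / 2 * c * x) =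
        (3 * (Real.exp 1 * c) * (Real.exp ((2 : ℕ) * 1) * Real.exp (-(μ * x + c * x)) *
          Real.exp (μ * x + c * x - 2 - 3 / 2 * c * x))) * μ ^ 2 := by ring
    have e3 : Real.exp ((2 : ℕ) * 1) * Real.exp (-(μ * x + c * x)) *
          Real.exp (μ * x + c * x - 2 - 3 / 2 * c * x) = Real.exp (-(3 / 2 * c * x)) := by
      rw [← Real.exp_add, ← Real.exp_add]
      congr 1
      push_cast
      ring
    rw [e1, e2, e3] at h
    rw [div_mul_eq_mul_div, div_le_iff₀ (by positivity)]
    linarith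
  calc x / 3 * w ^ 2 * Real.exp (Real.log (1 - x) * ((w - 1 / 2) / x - 1))
      ≤ x / 3 * ((2 / μ) ^ 2 * Real.exp (μ * w - 2)) *
        Real.exp (Real.log (1 - x) * ((w - 1 / 2) / x - 1)) := by gcongr
    _ = x * (4 / 3 / μ ^ 2 * Real.exp (μ / 2 + (μ * x + c * x) - 2)) *
        Real.exp (-(c * (w - 1 / 2))) := by
        have e4 : Real.exp (μ * w - 2) * Real.exp (Real.log (1 - x) * ((w - 1 / 2) / x - 1)) =
            Real.exp (μ / 2 + (μ * x + c * x) - 2) * Real.exp (-(c * (w - 1 / 2))) := by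
          rw [← Real.exp_add, ← Real.exp_add, hlog]
          congr 1
          field_simp
          ring
        rw [show x / 3 * ((2 / μ) ^ 2 * Real.exp (μ * w - 2)) *
          Real.exp (Real.log (1 - x) * ((w - 1 / 2) / x - 1)) = x / 3 * (2 / μ) ^ 2 *
            (Real.exp (μ * w - 2) * Real.exp (Real.log (1 - x) * ((w - 1 / 2) / x - 1))) by ring,
          e4]
        ring_nf
    _ ≤ x * (Real.exp 1 * c * Real.exp (-(3 / 2 * c * x))) * Real.exp (-(c * (w - 1 / 2))) := by
        gcongr
    _ = Real.exp (1 - c * (w - 1 / 2) - c * x) * (c * x * Real.exp (-(c * x / 2))) := by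
        have e5 : Real.exp 1 * Real.exp (-(3 / 2 * c * x)) * Real.exp (-(c * (w - 1 / 2))) =
            Real.exp (1 - c * (w - 1 / 2) - c * x) * Real.exp (-(c * x / 2)) := by
          rw [← Real.exp_add, ← Real.exp_add, ← Real.exp_add]; ring_nf
        linear_combination x * c * e5
    _ ≤ _ := by
        gcongr
        exact mul_exp_le_one_sub_exp_neg (by positivity)

end Increments

/-! ### Exponential bounds for the binomial tails. -/

section BinomialBounds

theorem pow_eq_exp_log {y : ℝ} (hy : 0 < y) (j : ℕ) : y ^ j = Real.exp (Real.log y * j) := by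
  rw [mul_comm, Real.exp_nat_mul, Real.exp_log hy]

theorem tendsto_binomialCdf {x : ℝ} (hx0 : 0 < x) (hx1 : x < 1) (k : ℕ) :
    Filter.Tendsto (fun N => binomialCdf N k x) Filter.atTop (nhds 0) := by
  refine squeeze_zero (fun N => Finset.sum_nonneg fun d _ => binomialMass_nonneg hx0.le hx1.le)
    (fun N => binomialCdf_le_exp hx0.le hx1.le N k) ?_
  simpa using (tendsto_pow_one_sub_zero hx0 hx1).const_mul (Real.exp k)

theorem binomialCdf_three_le_of_le {x : ℝ} (hx0 : 0 < x) (hx1 : x ≤ 3 / 4) {N : ℕ} (hN : 3 ≤ N) :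
    binomialCdf N 3 x ≤ Real.exp (2 - (1 - Real.exp (-1)) * N * x) := by
  refine le_exp_of_increments (tendsto_binomialCdf hx0 (by linarith) 3) (N₀ := 3) ?_ hN
  intro N hN
  obtain ⟨j, rfl⟩ := Nat.exists_eq_add_of_le' hN
  rw [binomialCdf_succ_left (j + 3), sub_sub_cancel, binomialMass, Nat.add_sub_cancel]
  have h1 := increment_aux_three hx0 hx1 (m := j + 2) (by positivity)
  rw [show (j : ℝ) + 2 - 2 = j by ring, ← pow_eq_exp_log (by linarith)] at h1
  -- The product of three consecutive integers is at most the cube of the middle one.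
  have h2 : ((j + 3).choose 3 : ℝ) ≤ (j + 2 : ℝ) ^ 3 / 6 := by
    have h3 := Nat.descFactorial_eq_factorial_mul_choose (j + 3) 3
    simp only [Nat.descFactorial, Nat.factorial] at h3
    have h4 : ((j : ℝ) + 1) * ((j + 2) * (j + 3)) = 6 * ((j + 3).choose 3 : ℝ) := by
      have : (j + 1) * ((j + 2) * (j + 3)) = 6 * (j + 3).choose 3 := by
        simpa [Nat.add_sub_cancel] using h3
      exact_mod_cast this
    have h5 : (0 : ℝ) ≤ j := Nat.cast_nonneg j
    rw [le_div_iff₀ (by norm_num)]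
    nlinarith
  have h1x : 0 ≤ 1 - x := by linarith
  calc x * (((j + 3).choose 3 : ℝ) * (x ^ 3 * (1 - x) ^ j))
      ≤ x * ((j + 2 : ℝ) ^ 3 / 6 * (x ^ 3 * (1 - x) ^ j)) := by gcongr
    _ = x ^ 4 * ((j + 2 : ℝ) ^ 3 / 6) * (1 - x) ^ j := by ring
    _ ≤ _ := h1
    _ = _ := by push_cast; ring_nf

theorem mixed_binomialCdf_le_of_le {x : ℝ} (hx0 : 0 < x) (hx1 : x ≤ 13 / 20) {N : ℕ}
    (hN : 2 ≤ N) : 1 / 3 * binomialCdf N 1 x + 2 / 3 * binomialCdf N 2 x ≤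
      Real.exp (1 - (1 - Real.exp (-1)) * N * x) := by
  have hlim := ((tendsto_binomialCdf hx0 (by linarith) 1).const_mul (1 / 3)).add
    ((tendsto_binomialCdf hx0 (by linarith) 2).const_mul (2 / 3))
  rw [mul_zero, mul_zero, add_zero] at hlim
  refine le_exp_of_increments hlim (N₀ := 2) ?_ hN
  intro N hN
  obtain ⟨j, rfl⟩ := Nat.exists_eq_add_of_le' hN
  rw [binomialCdf_succ_left (j + 2), binomialCdf_succ_left (j + 2)]
  have h1 := increment_aux_two hx0 hx1 (w := (j + 1) * x + 1 / 2) (by positivity)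
  rw [show (((j : ℝ) + 1) * x + 1 / 2 - 1 / 2) / x - 1 = j by field_simp; ring,
    ← pow_eq_exp_log (by linarith)] at h1
  have h2 : ((j + 2).choose 2 : ℝ) = (j + 2) * (j + 1) / 2 := by
    rw [Nat.cast_choose_two]; push_cast; ring
  have h1x : 0 ≤ (1 - x) ^ j := pow_nonneg (by linarith) j
  have h3 : 1 / 3 * (x * binomialMass (j + 2) 1 x) + 2 / 3 * (x * binomialMass (j + 2) 2 x) =
      x / 3 * ((j + 2) * x * (1 + j * x)) * (1 - x) ^ j := by
    rw [binomialMass, binomialMass, h2, Nat.choose_one_right, Nat.add_sub_cancel,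
      show j + 2 - 1 = j + 1 by omega]
    push_cast
    ring
  -- The arithmetic-geometric mean inequality; the defect is exactly (x - 1/2)².
  have h4 : (j + 2) * x * (1 + j * x) ≤ ((j + 1) * x + 1 / 2 : ℝ) ^ 2 := by
    nlinarith [sq_nonneg (x - 1 / 2)]
  have h5 : x / 3 * ((j + 2) * x * (1 + j * x)) * (1 - x) ^ j ≤
      x / 3 * ((j + 1) * x + 1 / 2 : ℝ) ^ 2 * (1 - x) ^ j := by gcongr
  have h6 : Real.exp (1 - (1 - Real.exp (-1)) * ((j + 1) * x + 1 / 2 - 1 / 2) -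
      (1 - Real.exp (-1)) * x) = Real.exp (1 - (1 - Real.exp (-1)) * ((j + 2 : ℕ) : ℝ) * x) := by
    push_cast; ring_nf
  rw [h6] at h1
  linarith

theorem exp_bounds_numeric : 316 / 500 ≤ 1 - Real.exp (-1) ∧ 1 - Real.exp (-1) ≤ 6322 / 10000 := by
  have h1 := Real.exp_neg_one_gt_d9
  have h2 := Real.exp_neg_one_lt_d9
  constructor <;> linarith

/-- Chernoff bounds with the factor `1 - y ≤ exp (-y - a)` for `y` bounded from below. -/
theorem one_sub_mul_pow_le {y y₀ a : ℝ} (hy : y₀ ≤ y) (hy1 : y ≤ 1)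
    (h : 1 - y₀ ≤ Real.exp (-(y₀ + a))) (hya : 0 ≤ y₀ + a) {N : ℕ} :
    (1 - y) ^ N ≤ Real.exp (-(N * (y + a))) := by
  have h1 : 1 - y ≤ Real.exp (-(y + a)) := by
    have h2 := Real.one_sub_le_exp_neg (y - y₀)
    have h3 : Real.exp (-(y + a)) = Real.exp (-(y₀ + a)) * Real.exp (-(y - y₀)) := by
      rw [← Real.exp_add]; ring_nf
    have h4 : Real.exp (-(y₀ + a)) ≤ 1 := Real.exp_le_one_iff.2 (by linarith)
    have h5 := mul_le_mul_of_nonneg_left h2 (Real.exp_pos (-(y₀ + a))).le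
    rw [h3]
    nlinarith
  have h6 := pow_le_pow_left₀ (by linarith) h1 N
  rw [← Real.exp_nat_mul] at h6
  rwa [mul_neg] at h6

/-- For N ≤ 3 the exponent is nonnegative, and for x ≤ 3/4 the decrements are compared. For larger
x, N = 4 and N = 5 are explicit polynomials, and from N = 6 on the Chernoff bound has enough slack.
-/
theorem binomialCdf_three_le {x : ℝ} (hx0 : 0 < x) (hx1 : x < 1) (N : ℕ) :
    binomialCdf N 3 x ≤ Real.exp (2 - (1 - Real.exp (-1)) * N * x) := by
  obtain ⟨hc1, hc2⟩ := exp_bounds_numeric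
  set c := 1 - Real.exp (-1) with hc
  rcases Nat.lt_or_ge N 4 with hN | hN
  · refine (binomialCdf_le_one hx0.le hx1.le N 3).trans (Real.one_le_exp ?_)
    have h1 : (N : ℝ) ≤ 3 := by exact_mod_cast Nat.lt_succ_iff.1 hN
    have h2 : c * N * x ≤ c * 3 * 1 := by gcongr
    linarith
  rcases le_or_gt x (3 / 4) with hx | hx
  · exact binomialCdf_three_le_of_le hx0 hx (by omega)
  have hN' : N = 4 ∨ N = 5 ∨ 6 ≤ N := by omega
  rcases hN' with rfl | rfl | hN
  · have h1 : binomialCdf 4 3 x = 1 - x ^ 4 := by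
      simp [binomialCdf, binomialMass, Finset.sum_range_succ, Nat.choose]
      ring
    have h2 := Real.add_one_le_exp (2 - c * (4 : ℕ) * x)
    rw [h1]
    refine le_trans ?_ h2
    push_cast
    nlinarith [sq_nonneg (x ^ 2 - 3 / 4), sq_nonneg (x - 17 / 20)]
  · have h1 : binomialCdf 5 3 x = 1 - 5 * x ^ 4 + 4 * x ^ 5 := by
      simp [binomialCdf, binomialMass, Finset.sum_range_succ, Nat.choose]
      ring
    have h2 := Real.add_one_le_exp (1 - c * 5 / 2 * x)
    have h3 : 2 - 1581 / 1000 * x ≤ Real.exp (1 - c * 5 / 2 * x) := by nlinarith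
    have h4 := pow_le_pow_left₀ (by linarith) h3 2
    rw [← Real.exp_nat_mul] at h4
    rw [h1]
    have h5 : 2 - c * (5 : ℕ) * x = (2 : ℕ) * (1 - c * 5 / 2 * x) := by push_cast; ring
    rw [h5]
    refine le_trans ?_ h4
    obtain ⟨t, rfl⟩ : ∃ t, x = 1 - t := ⟨1 - x, by ring⟩
    have ht0 : 0 ≤ t := by linarith
    have ht1 : 0 ≤ 1 / 4 - t := by linarith
    have h6 : 1 - 5 * (1 - t) ^ 4 + 4 * (1 - t) ^ 5 =
        10 * t ^ 2 - t ^ 3 * (20 - 15 * t) - 4 * t ^ 5 := by ring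
    have h7 : 0 ≤ t ^ 3 * (20 - 15 * t) := mul_nonneg (by positivity) (by linarith)
    have h8 : 0 ≤ 4 * t ^ 5 := by positivity
    rw [h6]
    nlinarith [mul_nonneg ht0 ht1]
  · have hN6 : (6 : ℝ) ≤ N := by exact_mod_cast hN
    have h1 := binomialCdf_le_exp hx0.le hx1.le N 3
    have h2 : 474 / 1000 ≤ c * x := by nlinarith
    -- For x > 3/4 each factor 1 - cx gains an extra exp(-1/6), and six of them supply the unit
    -- missing from the Chernoff exponent.
    have h3 := one_sub_mul_pow_le (a := 1 / 6) h2 (by nlinarith) (N := N) (by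
      have h4 := pow_le_pow_left₀ (by norm_num)
        (cubic_le_exp_neg (s := (474 / 1000 + 1 / 6) / 3) (by norm_num)) 3
      rw [← Real.exp_nat_mul] at h4
      rw [show -((474 : ℝ) / 1000 + 1 / 6) = (3 : ℕ) * -((474 / 1000 + 1 / 6) / 3) by
        push_cast; ring]
      refine le_trans ?_ h4
      norm_num) (by norm_num)
    refine h1.trans ?_
    calc Real.exp (3 : ℕ) * (1 - c * x) ^ N ≤ Real.exp (3 : ℕ) * Real.exp (-(N * (c * x + 1 / 6))) := by
          gcongr
      _ = Real.exp (3 - N * (c * x) - N / 6) := by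
          rw [← Real.exp_add]; push_cast; ring_nf
      _ ≤ _ := Real.exp_le_exp.2 (by linarith)

/-- Averaging improves the Chernoff constant by the factor 2/3. Pascal's rule for the pair (1, 2)
calls the pair (0, 1), hence the joint induction. -/
theorem mixed_binomialCdf_le_exp {x : ℝ} (hx0 : 0 ≤ x) (hx1 : x ≤ 1) (N : ℕ) :
    1 / 3 * binomialCdf N 0 x + 2 / 3 * binomialCdf N 1 x ≤
      2 / 3 * Real.exp 1 * (1 - (1 - Real.exp (-1)) * x) ^ N ∧
    1 / 3 * binomialCdf N 1 x + 2 / 3 * binomialCdf N 2 x ≤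
      2 / 3 * Real.exp 2 * (1 - (1 - Real.exp (-1)) * x) ^ N := by
  have he := Real.exp_one_gt_d9
  have he2 : Real.exp 2 = Real.exp 1 * Real.exp 1 := by rw [← Real.exp_add]; norm_num
  have he3 : Real.exp 1 * Real.exp (-1) = 1 := by rw [← Real.exp_add]; simp
  have h1x : 0 ≤ 1 - x := by linarith
  have h0 := binomialCdf_le_exp hx0 hx1
  induction N with
  | zero =>
    simp only [binomialCdf_zero_left, pow_zero, he2]
    constructor <;> nlinarith
  | succ N ih =>
    obtain ⟨ih1, ih2⟩ := ih
    have h3 : binomialCdf (N + 1) 0 x = (1 - x) * binomialCdf N 0 x := by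
      simp only [binomialCdf_zero_right]; ring
    have h4 := h0 N 0
    rw [Nat.cast_zero, Real.exp_zero, one_mul] at h4
    have h5 : 0 ≤ binomialCdf N 0 x := by rw [binomialCdf_zero_right]; positivity
    set q := (1 - (1 - Real.exp (-1)) * x) with hq
    have m1 := mul_le_mul_of_nonneg_left ih1 h1x
    have m2 := mul_le_mul_of_nonneg_left ih2 h1x
    have m3 := mul_le_mul_of_nonneg_left ih1 hx0
    have m4 := mul_le_mul_of_nonneg_left h4 hx0
    rw [h3, binomialCdf_succ_succ N 0, binomialCdf_succ_succ N 1, he2, pow_succ]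
    have e1 : 2 / 3 * Real.exp 1 * (q ^ N * q) =
        (1 - x) * (2 / 3 * Real.exp 1 * q ^ N) + 2 / 3 * (x * q ^ N) *
          (Real.exp 1 * Real.exp (-1)) := by rw [hq]; ring
    have e2 : 2 / 3 * (Real.exp 1 * Real.exp 1) * (q ^ N * q) =
        (1 - x) * (2 / 3 * (Real.exp 1 * Real.exp 1) * q ^ N) + x * (2 / 3 * Real.exp 1 * q ^ N) *
          (Real.exp 1 * Real.exp (-1)) := by rw [hq]; ring
    rw [he2] at m2
    rw [e1, e2, he3]
    constructor <;> linarith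

theorem mixed_binomialCdf_le {x : ℝ} (hx0 : 0 < x) (hx1 : x < 1) {N : ℕ} (hN : 3 ≤ N) :
    1 / 3 * binomialCdf N 1 x + 2 / 3 * binomialCdf N 2 x ≤
      Real.exp (1 - (1 - Real.exp (-1)) * N * x) := by
  obtain ⟨hc1, hc2⟩ := exp_bounds_numeric
  rcases le_or_gt x (13 / 20) with hx | hx
  · exact mixed_binomialCdf_le_of_le hx0 hx (by omega)
  have hcher : 1 / 3 * binomialCdf N 1 x + 2 / 3 * binomialCdf N 2 x ≤
      2 / 3 * Real.exp 2 * (1 - (1 - Real.exp (-1)) * x) ^ N :=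
    (mixed_binomialCdf_le_exp hx0.le hx1.le N).2
  set c := 1 - Real.exp (-1) with hc
  have hN' : N = 3 ∨ N = 4 ∨ N = 5 ∨ 6 ≤ N := by omega
  rcases hN' with rfl | rfl | rfl | hN
  · have h1 : 1 / 3 * binomialCdf 3 1 x + 2 / 3 * binomialCdf 3 2 x = 1 - x ^ 2 := by
      simp [binomialCdf, binomialMass, Finset.sum_range_succ, Nat.choose]
      ring
    have h2 := Real.add_one_le_exp (1 - c * (3 : ℕ) * x)
    rw [h1]
    refine le_trans ?_ h2
    push_cast
    nlinarith [sq_nonneg (x - 1)]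
  · have h1 : 1 / 3 * binomialCdf 4 1 x + 2 / 3 * binomialCdf 4 2 x = (1 - x ^ 2) ^ 2 := by
      simp [binomialCdf, binomialMass, Finset.sum_range_succ, Nat.choose]
      ring
    have h2 := Real.add_one_le_exp (1 / 2 - c * 2 * x)
    have h3 : 1 - x ^ 2 ≤ Real.exp (1 / 2 - c * 2 * x) := by
      refine le_trans ?_ h2
      nlinarith [sq_nonneg (x - 632 / 1000)]
    have h4 := pow_le_pow_left₀ (by nlinarith) h3 2
    rw [← Real.exp_nat_mul] at h4
    rw [h1]
    refine h4.trans_eq ?_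
    congr 1
    push_cast
    ring
  · have h1 : 1 / 3 * binomialCdf 5 1 x + 2 / 3 * binomialCdf 5 2 x =
        (1 - x) ^ 3 * (1 + 3 * x + 8 / 3 * x ^ 2) := by
      simp [binomialCdf, binomialMass, Finset.sum_range_succ, Nat.choose]
      ring
    have h2 := Real.add_one_le_exp (1 / 3 - c * 5 / 3 * x)
    have h3 : 4 / 3 - 1054 / 1000 * x ≤ Real.exp (1 / 3 - c * 5 / 3 * x) := by nlinarith
    have h4 := pow_le_pow_left₀ (by linarith) h3 3
    rw [← Real.exp_nat_mul] at h4
    rw [h1]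
    have h5 : 1 - c * (5 : ℕ) * x = (3 : ℕ) * (1 / 3 - c * 5 / 3 * x) := by push_cast; ring
    rw [h5]
    refine le_trans ?_ h4
    obtain ⟨t, rfl⟩ : ∃ t, x = 1 - t := ⟨1 - x, by ring⟩
    have ht0 : 0 ≤ t := by linarith
    have ht1 : t ≤ 35 / 100 := by linarith
    have h6 : (1 - (1 - t)) ^ 3 * (1 + 3 * (1 - t) + 8 / 3 * (1 - t) ^ 2) =
        t ^ 3 * (20 / 3 - t * (25 / 3 - 8 / 3 * t)) := by ring
    rw [h6]
    rcases le_or_gt t (3 / 10) with h | h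
    · have h7 := pow_le_pow_left₀ (by positivity)
        (by linarith : 1883 / 1000 * t ≤ 4 / 3 - 1054 / 1000 * (1 - t)) 3
      refine le_trans ?_ h7
      have h8 : 0 ≤ t * (25 / 3 - 8 / 3 * t) := mul_nonneg ht0 (by linarith)
      rw [mul_pow, mul_comm]
      exact mul_le_mul_of_nonneg_right (by norm_num; linarith) (by positivity)
    · have h7 := pow_le_pow_left₀ (by positivity)
        (by linarith : 164 / 100 * t ≤ 4 / 3 - 1054 / 1000 * (1 - t)) 3
      refine le_trans ?_ h7
      rw [mul_pow, mul_comm]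
      exact mul_le_mul_of_nonneg_right (by norm_num; nlinarith) (by positivity)
  · have hN6 : (6 : ℝ) ≤ N := by exact_mod_cast hN
    have h2 : 41 / 100 ≤ c * x := by nlinarith
    -- Here 41/100 ≤ c·13/20, and for N ≥ 6 the gain exp(-N/10) is enough because (2/3)·exp(4/10) ≤
    -- 1.
    have h3 := one_sub_mul_pow_le (a := 1 / 10) h2 (by nlinarith) (N := N) (by
      refine le_trans ?_ (cubic_le_exp_neg (by norm_num))
      norm_num) (by norm_num)
    refine hcher.trans ?_
    calc 2 / 3 * Real.exp 2 * (1 - c * x) ^ N ≤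
          2 / 3 * Real.exp 2 * Real.exp (-(N * (c * x + 1 / 10))) := by gcongr
      _ = (2 / 3 * Real.exp (1 - N / 10)) * Real.exp (1 - c * N * x) := by
          rw [mul_assoc, mul_assoc, ← Real.exp_add, ← Real.exp_add]
          ring_nf
      _ ≤ 1 * Real.exp (1 - c * N * x) := by
          gcongr
          have h5 : Real.exp (1 - N / 10) ≤ Real.exp (4 / 10) := Real.exp_le_exp.2 (by linarith)
          have h6 : 2 / 3 ≤ Real.exp (-(4 / 10)) := by
            refine le_trans ?_ (cubic_le_exp_neg (by norm_num))
            norm_num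
          have h7 : Real.exp (4 / 10) * Real.exp (-(4 / 10)) = 1 := by
            rw [← Real.exp_add]; simp
          nlinarith [Real.exp_pos (4 / 10)]
      _ = _ := one_mul _

end BinomialBounds

/-! ### The tail of the risk of one scenario program. -/

section Count

variable {N n r ζ : ℕ} {J : Type*} [LinearOrder J] {idx : Finset (Fin N × Fin n) → J}

theorem cast_mul_pow_eq_binomialMass (hr : r ≤ n) (hn : 0 < n) {d : ℕ} (hd : d ≤ N) :
    ((N.choose d * (r ^ d * (n - r) ^ (N - d)) : ℕ) : ℝ) = binomialMass N d (r / n) * n ^ N := by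
  have hn' : (n : ℝ) ≠ 0 := by positivity
  have h1 : (1 - (r : ℝ) / n) = (n - r) / n := by field_simp
  rw [binomialMass, h1, div_pow, div_pow]
  push_cast [Nat.cast_sub hr]
  obtain ⟨j, rfl⟩ := Nat.exists_eq_add_of_le hd
  rw [Nat.add_sub_cancel_left, pow_add]
  field_simp

theorem card_heavyWords_le_of_dim_one (hidx : IsLPType idx 1) (hr0 : 0 < r) (hr : r ≤ n) :
    ((heavyWords idx r).card : ℝ) ≤ (1 - (r / n : ℝ)) ^ N * n ^ N := by
  have hn' : (n : ℝ) ≠ 0 := by have := hr0.trans_le hr; positivity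
  have h := card_heavy_le_of_dim_one (r := r) hidx
  rw [Fintype.card_fin] at h
  have h1 : ((heavyWords idx r).card : ℝ) ≤ ((n - r : ℕ) : ℝ) ^ N := by exact_mod_cast h
  refine h1.trans_eq ?_
  rw [← mul_pow, Nat.cast_sub hr]
  congr 1
  field_simp

/-- In dimension ζ+1 the count is F_ζ plus the fraction (ζ+1)/(ζ+2) of the next binomial mass, that
is, a mixture of F_ζ and F_{ζ+1}. -/
theorem card_heavyWords_le (hidx : IsLPType idx (ζ + 1)) (hN : ζ + 1 < N) (hr0 : 0 < r)
    (hr : r ≤ n) : ((heavyWords idx r).card : ℝ) ≤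
      (1 / (ζ + 2) * binomialCdf N ζ (r / n) + (ζ + 1) / (ζ + 2) * binomialCdf N (ζ + 1) (r / n)) *
        n ^ N := by
  have hn : 0 < n := hr0.trans_le hr
  obtain ⟨q, hq, h⟩ := card_heavy_le hidx hr hr0 (by rwa [Fintype.card_fin])
  rw [Fintype.card_fin] at h hq
  have h1 : ((heavyWords idx r).card : ℝ) ≤ ((∑ d ∈ Finset.range (ζ + 1), N.choose d * (r ^ d *
      (n - r) ^ (N - d)) + q * (n - r) ^ (N - (ζ + 1)) : ℕ) : ℝ) := by exact_mod_cast h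
  refine h1.trans ?_
  have h2 : ((∑ d ∈ Finset.range (ζ + 1), N.choose d * (r ^ d * (n - r) ^ (N - d)) : ℕ) : ℝ) =
      binomialCdf N ζ (r / n) * n ^ N := by
    rw [binomialCdf, Finset.sum_mul, Nat.cast_sum]
    refine Finset.sum_congr rfl fun d hd => cast_mul_pow_eq_binomialMass hr hn ?_
    have := Finset.mem_range.1 hd
    omega
  have h3 : ((q * (n - r) ^ (N - (ζ + 1)) : ℕ) : ℝ) ≤
      (ζ + 1) / (ζ + 2) * (binomialMass N (ζ + 1) (r / n) * n ^ N) := by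
    rw [← cast_mul_pow_eq_binomialMass hr hn hN.le, div_mul_eq_mul_div, le_div_iff₀ (by positivity)]
    have h4 := Nat.mul_le_mul_right ((n - r) ^ (N - (ζ + 1))) hq
    have h5 : q * (n - r) ^ (N - (ζ + 1)) * (ζ + 2) ≤
        (ζ + 1) * (N.choose (ζ + 1) * (r ^ (ζ + 1) * (n - r) ^ (N - (ζ + 1)))) := by
      calc _ = (ζ + 1 + 1) * q * (n - r) ^ (N - (ζ + 1)) := by ring
        _ ≤ _ := h4
        _ = _ := by ring
    exact_mod_cast h5
  rw [Nat.cast_add, h2]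
  rw [binomialCdf_succ_right]
  have h6 : (1 : ℝ) / (ζ + 2) = 1 - (ζ + 1) / (ζ + 2) := by field_simp; ring
  rw [h6]
  linarith

theorem continuous_binomialCdf (N k : ℕ) : Continuous (binomialCdf N k) := by
  unfold binomialCdf binomialMass
  fun_prop

end Count

namespace IsScenarioValue

variable {Δ J : Type*} [MeasurableSpace Δ] [LinearOrder J] {P : Measure Δ} [IsProbabilityMeasure P]
  {val : Set Δ → J} {ζ : ℕ}

theorem measure_risk_pos_eq_zero (h : IsScenarioValue P val 0) (N : ℕ) :
    (Measure.pi fun _ : Fin N => P) {ω | 0 < h.risk ω} = 0 := by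
  have h1 := h.lintegral_risk_le N
  rw [Nat.cast_zero, nonpos_iff_eq_zero, mul_eq_zero] at h1
  have h2 := h1.resolve_left (by positivity)
  rw [lintegral_eq_zero_iff (h.measurable_risk N)] at h2
  have h3 : {ω : Fin N → Δ | 0 < h.risk ω} = {ω | ¬ h.risk ω = 0} := by
    ext ω; simp [pos_iff_ne_zero]
  rw [h3]
  exact h2

theorem measure_risk_gt_le_div (h : IsScenarioValue P val ζ) (N : ℕ) {ε : ℝ} (hε : 0 < ε) :
    (Measure.pi fun _ : Fin N => P) {ω | ENNReal.ofReal ε < h.risk ω} ≤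
      ENNReal.ofReal (ζ / ((N + 1) * ε)) := by
  have h1 := mul_meas_ge_le_lintegral (μ := Measure.pi fun _ : Fin N => P) (h.measurable_risk N)
    (ENNReal.ofReal ε)
  have h2 := h.lintegral_risk_le N
  have h3 : (N + 1 : ENNReal) * (ENNReal.ofReal ε * (Measure.pi fun _ : Fin N => P)
      {ω | ENNReal.ofReal ε ≤ h.risk ω}) ≤ ζ := le_trans (by gcongr) h2
  have h4 : (Measure.pi fun _ : Fin N => P) {ω | ENNReal.ofReal ε < h.risk ω} ≤
      (Measure.pi fun _ : Fin N => P) {ω | ENNReal.ofReal ε ≤ h.risk ω} :=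
    measure_mono fun ω hω => le_of_lt (show ENNReal.ofReal ε < h.risk ω from hω)
  refine h4.trans ?_
  rw [← mul_assoc] at h3
  have h5 : (N + 1 : ENNReal) * ENNReal.ofReal ε = ENNReal.ofReal ((N + 1) * ε) := by
    rw [ENNReal.ofReal_mul (by positivity)]
    congr 1
    rw [ENNReal.ofReal_add (by positivity) zero_le_one]
    simp
  rw [h5, mul_comm] at h3
  rw [ENNReal.ofReal_div_of_pos (by positivity), ENNReal.ofReal_natCast]
  exact (ENNReal.le_div_iff_mul_le (Or.inl (by simpa using by positivity))
    (Or.inl ENNReal.ofReal_ne_top)).2 h3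

/-- The distribution of the risk. -/
theorem measure_risk_gt_le_exp (h : IsScenarioValue P val ζ) (N : ℕ) {ε : ℝ} (hε0 : 0 < ε)
    (hε1 : ε < 1) : (Measure.pi fun _ : Fin N => P) {ω | ENNReal.ofReal ε < h.risk ω} ≤
      ENNReal.ofReal (Real.exp (ζ - 1 - (1 - Real.exp (-1)) * N * ε)) := by
  obtain ⟨hc1, hc2⟩ := exp_bounds_numeric
  rcases le_or_gt ((1 - Real.exp (-1)) * N * ε) (ζ - 1) with htriv | hpos
  · refine prob_le_one.trans ?_
    rw [← ENNReal.ofReal_one]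
    exact ENNReal.ofReal_le_ofReal (Real.one_le_exp (by linarith))
  have hcN : ((ζ : ℝ) - 1) < 6322 / 10000 * N := by
    have hN0 : (0 : ℝ) ≤ N := Nat.cast_nonneg N
    have h1 : (1 - Real.exp (-1)) * N * ε ≤ 6322 / 10000 * N * 1 := by gcongr
    linarith
  rcases Nat.lt_or_ge ζ 1 with h0 | h1
  · obtain rfl : ζ = 0 := by omega
    refine le_trans (measure_mono fun ω hω => ?_) ((h.measure_risk_pos_eq_zero N).trans_le zero_le)
    exact lt_of_le_of_lt (zero_le : 0 ≤ ENNReal.ofReal ε) hω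
  rcases Nat.eq_or_lt_of_le h1 with h1 | h2
  -- For ζ = 1 the mixed bound behaves like 1 - Nx/2 near 0, which is too weak since 1 - 1/e > 1/2;
  -- the dimension-one count is used instead.
  · subst h1
    refine (h.measure_risk_gt_le (b := fun x => (1 - x) ^ N) (by fun_prop)
      (fun n r idx hidx hr0 hr => card_heavyWords_le_of_dim_one hidx hr0 hr) hε0 hε1).trans ?_
    refine ENNReal.ofReal_le_ofReal ?_
    have h2 := pow_le_pow_left₀ (by linarith) (Real.one_sub_le_exp_neg ε) N
    rw [← Real.exp_nat_mul] at h2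
    refine h2.trans (Real.exp_le_exp.2 ?_)
    have h3 : 0 ≤ (N : ℝ) * ε := by positivity
    push_cast
    nlinarith
  obtain ⟨k, rfl⟩ : ∃ k, ζ = k + 1 := ⟨ζ - 1, by omega⟩
  rcases Nat.lt_or_ge (k + 1) N with hN | hN
  · refine (h.measure_risk_gt_le (b := fun x => 1 / (k + 2) * binomialCdf N k x +
      (k + 1) / (k + 2) * binomialCdf N (k + 1) x)
      (((continuous_binomialCdf N k).const_mul _).add ((continuous_binomialCdf N _).const_mul _))
      (fun n r idx hidx hr0 hr => card_heavyWords_le hidx hN hr0 hr) hε0 hε1).trans ?_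
    refine ENNReal.ofReal_le_ofReal ?_
    rcases Nat.eq_or_lt_of_le (show 1 ≤ k by omega) with hk | hk
    · subst hk
      refine le_trans (le_of_eq ?_) ((mixed_binomialCdf_le hε0 hε1 (N := N) (by omega)).trans_eq ?_)
      · norm_num
      · norm_num
    -- For ζ ≥ 3 the mixture may be replaced by its larger part F_ζ.
    · have h3 := binomialCdf_le_of_le hε0.le hε1.le (k₀ := 3) (fun N =>
        (binomialCdf_three_le hε0 hε1 N).trans_eq (by norm_num)) (k := k + 1) (by omega) N
      refine le_trans ?_ h3
      have h4 : binomialCdf N k ε ≤ binomialCdf N (k + 1) ε := by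
        rw [binomialCdf_succ_right]
        linarith [binomialMass_nonneg (N := N) (d := k + 1) hε0.le hε1.le]
      have h5 : (1 : ℝ) / (k + 2) = 1 - (k + 1) / (k + 2) := by field_simp; ring
      have h6 : (0 : ℝ) ≤ 1 / (k + 2) := by positivity
      rw [h5] at h6 ⊢
      nlinarith [mul_le_mul_of_nonneg_left h4 h6]
  · -- the only remaining case is `ζ = N = 2`
    have hNk : (N : ℝ) ≤ k + 1 := by exact_mod_cast hN
    push_cast at hcN hpos
    have hk1 : k = 1 := by
      have : (k : ℝ) < 2 := by linarith
      have : k < 2 := by exact_mod_cast this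
      omega
    subst hk1
    have hN2 : N = 2 := by
      have : (1 : ℝ) < N := by push_cast at hcN; linarith
      have : 1 < N := by exact_mod_cast this
      omega
    subst hN2
    refine (h.measure_risk_gt_le_div 2 hε0).trans (ENNReal.ofReal_le_ofReal ?_)
    push_cast at hpos ⊢
    set c := 1 - Real.exp (-1)
    have hε2 : 79 / 100 ≤ ε := by nlinarith
    have h3 := Real.add_one_le_exp (2 - 1 - c * 2 * ε)
    have h4 : (2 : ℝ) / ((2 + 1) * ε) ≤ 2 - 12644 / 10000 * ε := by
      rw [div_le_iff₀ (by positivity)]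
      nlinarith
    refine h4.trans (le_trans ?_ h3)
    nlinarith

end IsScenarioValue

/-! ### Lexicographic minimization and the value of a scenario program. -/

section LexMin

variable {α : Type*}

/-- Minimizers of several functions, taken one after the other. -/
def lexArgmin (Φ : List (α → ℝ)) (A : Set α) : Set α :=
  Φ.foldl (fun A φ => argminOn φ A) A

/-- The list of the values of several functions. -/
def lexKey (Φ : List (α → ℝ)) (x : α) : List ℝ := Φ.map fun φ => φ x

theorem cons_le_cons_iff_lex {a b : ℝ} {l l' : List ℝ} :
    a :: l ≤ b :: l' ↔ a < b ∨ a = b ∧ l ≤ l' := by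
  rw [le_iff_lt_or_eq, le_iff_lt_or_eq (a := l), List.cons_lt_cons_iff, List.cons.injEq]
  tauto

theorem lexArgmin_append (Φ Ψ : List (α → ℝ)) (A : Set α) :
    lexArgmin (Φ ++ Ψ) A = lexArgmin Ψ (lexArgmin Φ A) :=
  List.foldl_append

/-- Successive minimization amounts to minimizing the list of values lexicographically, which makes
solutions of different programs comparable. -/
theorem mem_lexArgmin {Φ : List (α → ℝ)} {A : Set α} {x : α} :
    x ∈ lexArgmin Φ A ↔ x ∈ A ∧ ∀ y ∈ A, lexKey Φ x ≤ lexKey Φ y := by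
  induction Φ generalizing A with
  | nil => simp [lexArgmin, lexKey]
  | cons φ Φ ih =>
    change x ∈ lexArgmin Φ (argminOn φ A) ↔ _
    rw [ih]
    simp only [argminOn, Set.mem_ofPred_eq, lexKey, List.map_cons, cons_le_cons_iff_lex]
    constructor
    · rintro ⟨⟨hx, hmin⟩, h⟩
      refine ⟨hx, fun y hy => ?_⟩
      rcases (hmin y hy).lt_or_eq with hlt | heq
      · exact Or.inl hlt
      · exact Or.inr ⟨heq, h y ⟨hy, fun z hz => heq ▸ hmin z hz⟩⟩
    · rintro ⟨hx, h⟩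
      have hmin : ∀ y ∈ A, φ x ≤ φ y := fun y hy => (h y hy).elim le_of_lt fun h => h.1.le
      refine ⟨⟨hx, hmin⟩, fun y hy => ?_⟩
      rcases h y hy.1 with hlt | heq
      · exact absurd hlt (not_lt.2 (hy.2 x hx))
      · exact heq.2

theorem lexArgmin_subset (Φ : List (α → ℝ)) (A : Set α) : lexArgmin Φ A ⊆ A :=
  fun _ hx => (mem_lexArgmin.1 hx).1

theorem lexArgmin_nonempty [TopologicalSpace α] {Φ : List (α → ℝ)}
    (hΦ : ∀ φ ∈ Φ, Continuous φ) {A : Set α} (hA : IsCompact A) (hne : A.Nonempty) :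
    (lexArgmin Φ A).Nonempty := by
  induction Φ generalizing A with
  | nil => exact hne
  | cons φ Φ ih =>
    have hφ := hΦ φ (by simp)
    obtain ⟨x, hx, hmin⟩ := hA.exists_isMinOn hne hφ.continuousOn
    have heq : argminOn φ A = A ∩ φ ⁻¹' Set.Iic (φ x) := by
      ext y
      constructor
      · exact fun hy => ⟨hy.1, hy.2 x hx⟩
      · exact fun hy => ⟨hy.1, fun z hz => le_trans hy.2 (hmin hz)⟩
    refine ih (fun φ h => hΦ φ (by simp [h])) (A := argminOn φ A) ?_ ⟨x, hx, fun y hy => hmin hy⟩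
    rw [heq]
    exact hA.inter_right (isClosed_Iic.preimage hφ)

end LexMin

namespace ChanceProgram

variable {n : ℕ} {Δ : Type*} (Q : ChanceProgram n Δ) (S : ConvexScenario n)

/-- The functions that are minimized one after the other to single out one solution. -/
noncomputable def objectives : List (EuclideanSpace ℝ (Fin n) → ℝ) :=
  ((fun x => inner ℝ S.c x) :: S.tie) ++ List.ofFn fun i x => x i

/-- The feasible set for a set of uncertainties. -/
def feasible (D : Set Δ) : Set (EuclideanSpace ℝ (Fin n)) :=
  {x | x ∈ S.C ∩ Q.adm ∧ ∀ δ ∈ D, Q.g x δ ≤ 0}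

/-- The solution for a set of uncertainties: a set with at most one element. -/
def solution (D : Set Δ) : Set (EuclideanSpace ℝ (Fin n)) :=
  lexArgmin (objectives S) (Q.feasible S D)

open Classical in
/-- The value for a set of uncertainties. -/
noncomputable def value (D : Set Δ) : WithTop (List ℝ) :=
  -- Infeasibility gets the top value, so that adding constraints never lowers the value.
  if h : (Q.solution S D).Nonempty then (lexKey (objectives S) h.some : WithTop (List ℝ)) else ⊤

variable {Q S}

/-- The coordinates at the end of `objectives` determine the point, so a solution is unique even for
sets of constraints not covered by the uniqueness assumption, such as the empty one. -/
theorem eq_of_lexKey_eq {x y : EuclideanSpace ℝ (Fin n)}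
    (h : lexKey (objectives S) x = lexKey (objectives S) y) : x = y := by
  rw [lexKey, lexKey, List.map_inj_left] at h
  ext i
  exact h (fun x => x i) (List.mem_append_right _ ((List.mem_ofFn' _ _).2 ⟨i, rfl⟩))

theorem solution_subsingleton (D : Set Δ) : (Q.solution S D).Subsingleton := by
  intro x hx y hy
  have hx' := mem_lexArgmin.1 hx
  have hy' := mem_lexArgmin.1 hy
  exact eq_of_lexKey_eq (le_antisymm (hx'.2 y hy'.1) (hy'.2 x hx'.1))

theorem value_of_mem {D : Set Δ} {x : EuclideanSpace ℝ (Fin n)} (hx : x ∈ Q.solution S D) :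
    Q.value S D = lexKey (objectives S) x := by
  have h : (Q.solution S D).Nonempty := ⟨x, hx⟩
  rw [value, dif_pos h, solution_subsingleton D h.some_mem hx]

theorem value_of_eq_empty {D : Set Δ} (h : Q.solution S D = ∅) : Q.value S D = ⊤ := by
  rw [value, dif_neg (by simp [h])]

theorem value_congr {D D' : Set Δ} (h : Q.solution S D = Q.solution S D') :
    Q.value S D = Q.value S D' := by
  rcases (Q.solution S D).eq_empty_or_nonempty with h0 | ⟨x, hx⟩
  · rw [value_of_eq_empty h0, value_of_eq_empty (h ▸ h0)]
  · rw [value_of_mem hx, value_of_mem (h ▸ hx)]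

theorem solution_eq_of_value_eq {D D' : Set Δ} (h : Q.value S D = Q.value S D') :
    Q.solution S D = Q.solution S D' := by
  rcases (Q.solution S D).eq_empty_or_nonempty with h0 | ⟨x, hx⟩
  · rcases (Q.solution S D').eq_empty_or_nonempty with h0' | ⟨y, hy⟩
    · rw [h0, h0']
    · rw [value_of_eq_empty h0, value_of_mem hy] at h
      exact absurd h (by simp)
  · rcases (Q.solution S D').eq_empty_or_nonempty with h0' | ⟨y, hy⟩
    · rw [value_of_eq_empty h0', value_of_mem hx] at h
      exact absurd h (by simp)
    · rw [value_of_mem hx, value_of_mem hy, WithTop.coe_inj] at h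
      obtain rfl := eq_of_lexKey_eq h
      rw [(solution_subsingleton D).eq_singleton_of_mem hx,
        (solution_subsingleton D').eq_singleton_of_mem hy]

theorem feasible_anti {D D' : Set Δ} (h : D ⊆ D') : Q.feasible S D' ⊆ Q.feasible S D :=
  fun _ hx => ⟨hx.1, fun δ hδ => hx.2 δ (h hδ)⟩

/-- The optimizers of the scenario program in terms of the set of the samples. -/
theorem optimizers_eq {ι : Type*} (ω : ι → Δ) : Q.optimizers S ω =
    lexArgmin ((fun x => inner ℝ S.c x) :: S.tie) (Q.feasible S (Set.range ω)) := by
  have h : Q.scenarioFeasible S ω = Q.feasible S (Set.range ω) := by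
    ext x
    simp [scenarioFeasible, feasible]
  rw [optimizers, h]
  rfl

theorem solution_range_eq {ι : Type*} (ω : ι → Δ) : Q.solution S (Set.range ω) =
    lexArgmin (List.ofFn fun i x => x i) (Q.optimizers S ω) := by
  rw [optimizers_eq, solution, objectives, lexArgmin_append]

theorem continuous_g {Δ : Type*} [MeasurableSpace Δ] {Q : ChanceProgram n Δ} (hQ : Q.IsRegular)
    (δ : Δ) : Continuous fun x => Q.g x δ :=
  continuousOn_univ.1 ((hQ.convex_g δ).continuousOn isOpen_univ)

theorem continuous_objectives (hS : S.IsRegular) : ∀ φ ∈ objectives S, Continuous φ := by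
  intro φ hφ
  rcases List.mem_append.1 hφ with h | h
  · rcases List.mem_cons.1 h with rfl | h
    · fun_prop
    · exact continuousOn_univ.1 ((hS.convex_tie φ h).continuousOn isOpen_univ)
  · obtain ⟨i, rfl⟩ := (List.mem_ofFn' _ _).1 h
    fun_prop

theorem solution_nonempty_of_value_lt {D D' : Set Δ}
    (h : Q.value S D < Q.value S D') : (Q.solution S D).Nonempty := by
  rw [Set.nonempty_iff_ne_empty]
  intro h0
  rw [value_of_eq_empty h0] at h
  exact absurd h not_top_lt

section Regular

variable [MeasurableSpace Δ]

theorem isCompact_constraint (hQ : Q.IsRegular) (hS : S.IsRegular) : IsCompact (S.C ∩ Q.adm) :=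
  hQ.compact_adm.inter_left hS.closed_C

theorem isCompact_feasible (hQ : Q.IsRegular) (hS : S.IsRegular) (D : Set Δ) :
    IsCompact (Q.feasible S D) := by
  have h : Q.feasible S D = (S.C ∩ Q.adm) ∩ ⋂ δ ∈ D, {x | Q.g x δ ≤ 0} := by
    ext x
    simp only [feasible, Set.mem_ofPred_eq, Set.mem_inter_iff, Set.mem_iInter]
  rw [h]
  exact (isCompact_constraint hQ hS).inter_right
    (isClosed_biInter fun δ _ => isClosed_le (continuous_g hQ δ) continuous_const)

theorem solution_nonempty (hQ : Q.IsRegular) (hS : S.IsRegular) {D : Set Δ}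
    (h : (Q.feasible S D).Nonempty) : (Q.solution S D).Nonempty :=
  lexArgmin_nonempty (continuous_objectives hS) (isCompact_feasible hQ hS D) h

theorem value_mono (hQ : Q.IsRegular) (hS : S.IsRegular) {D D' : Set Δ} (h : D ⊆ D') :
    Q.value S D ≤ Q.value S D' := by
  rcases (Q.solution S D').eq_empty_or_nonempty with h0 | ⟨y, hy⟩
  · rw [value_of_eq_empty h0]; exact le_top
  · have hy' := feasible_anti h (mem_lexArgmin.1 hy).1
    obtain ⟨x, hx⟩ := solution_nonempty hQ hS ⟨y, hy'⟩
    rw [value_of_mem hx, value_of_mem hy, WithTop.coe_le_coe]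
    exact (mem_lexArgmin.1 hx).2 y hy'

/-- If x satisfies the new constraint, it stays feasible and hence optimal on the smaller feasible
set; otherwise the solution must change, and values determine solutions. -/
theorem value_lt_iff (hQ : Q.IsRegular) (hS : S.IsRegular) {D : Set Δ}
    {x : EuclideanSpace ℝ (Fin n)} (hx : x ∈ Q.solution S D) (δ : Δ) :
    Q.value S D < Q.value S (insert δ D) ↔ 0 < Q.g x δ := by
  have hx' := mem_lexArgmin.1 hx
  constructor
  · intro h
    by_contra hle
    rw [not_lt] at hle
    have hxf : x ∈ Q.feasible S (insert δ D) := by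
      refine ⟨hx'.1.1, fun δ' hδ' => ?_⟩
      rcases Set.mem_insert_iff.1 hδ' with rfl | h'
      · exact hle
      · exact hx'.1.2 δ' h'
    have hxs : x ∈ Q.solution S (insert δ D) :=
      mem_lexArgmin.2 ⟨hxf, fun y hy => hx'.2 y (feasible_anti (Set.subset_insert _ _) hy)⟩
    rw [value_of_mem hx, value_of_mem hxs] at h
    exact lt_irrefl _ h
  · intro h
    refine lt_of_le_of_ne (value_mono hQ hS (Set.subset_insert _ _)) fun heq => ?_
    have h1 := solution_eq_of_value_eq heq
    rw [h1] at hx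
    exact absurd ((mem_lexArgmin.1 hx).1.2 δ (Set.mem_insert _ _)) (not_le.2 h)

theorem value_loc (hQ : Q.IsRegular) (hS : S.IsRegular) {D D' : Set Δ} (δ : Δ)
    (h : Q.value S D = Q.value S D') (hlt : Q.value S D < Q.value S (insert δ D)) :
    Q.value S D' < Q.value S (insert δ D') := by
  obtain ⟨x, hx⟩ := solution_nonempty_of_value_lt hlt
  rw [value_lt_iff hQ hS hx] at hlt
  rw [solution_eq_of_value_eq h] at hx
  exact (value_lt_iff hQ hS hx δ).2 hlt

/-- The refined solution is a function of the set of optimizers, so a sample whose removal changes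
the value also changes the optimizers. -/
theorem ae_support_value {P : Measure Δ} {ζ : ℕ} (hζ : Q.hellyDim P S ≤ (ζ : ℕ∞)) (L : ℕ)
    (hL : 1 ≤ L) : ∀ᵐ ω ∂(Measure.pi fun _ : Fin L => P),
      {i | Q.value S (ω '' {i}ᶜ) ≠ Q.value S (Set.range ω)}.encard ≤ ζ := by
  have hmem : Q.hellyDim P S ∈ {ζ : ℕ∞ | ∀ N : ℕ, 1 ≤ N →
    ∀ᵐ ω ∂(Measure.pi fun _ : Fin N => P), (Q.supportConstraints S ω).encard ≤ ζ} :=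
    csInf_mem ⟨⊤, fun N _ => Filter.Eventually.of_forall fun ω => le_top⟩
  filter_upwards [hmem L hL] with ω hω
  refine le_trans (Set.encard_le_encard fun i hi => ?_) (hω.trans hζ)
  intro heq
  refine hi (value_congr ?_)
  have h1 : ω '' {i}ᶜ = Set.range fun j : {j : Fin L // j ≠ i} => ω j := by
    ext δ
    constructor
    · rintro ⟨j, hj, rfl⟩; exact ⟨⟨j, hj⟩, rfl⟩
    · rintro ⟨j, rfl⟩; exact ⟨j, j.2, rfl⟩
  rw [h1, solution_range_eq, solution_range_eq, heq]

end Regular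

end ChanceProgram

/-! ### Measurability of constrained argmin sets. -/

section Measurability

variable {E Ω : Type*} [MetricSpace E] [MeasurableSpace Ω]

/-- Functions that are continuous in the first and measurable in the second variable. -/
structure IsCaratheodory (h : E → Ω → ℝ) : Prop where
  continuous : ∀ ω, Continuous fun x => h x ω
  measurable : ∀ x, Measurable (h x)

/-- By compactness the minimum over K is attained, so it is nonpositive iff it is below every
1/(m+1), and this can be tested on a countable dense subset. -/
theorem IsCaratheodory.measurableSet_exists_le {h : E → Ω → ℝ} (hh : IsCaratheodory h) {K : Set E}
    (hK : IsCompact K) : MeasurableSet {ω | ∃ x ∈ K, h x ω ≤ 0} := by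
  obtain ⟨D, hDK, hDc, hKD⟩ := hK.isSeparable.exists_countable_dense_subset
  have heq : {ω | ∃ x ∈ K, h x ω ≤ 0} =
      ⋂ m : ℕ, ⋃ d ∈ D, {ω | h d ω < 1 / ((m : ℝ) + 1)} := by
    ext ω
    simp only [Set.mem_ofPred_eq, Set.mem_iInter, Set.mem_iUnion, exists_prop]
    constructor
    · rintro ⟨x, hx, hle⟩ m
      have hopen : IsOpen {y | h y ω < 1 / ((m : ℝ) + 1)} :=
        isOpen_lt (hh.continuous ω) continuous_const
      obtain ⟨d, hd1, hd2⟩ := mem_closure_iff.1 (hKD hx) _ hopen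
        (lt_of_le_of_lt hle (by positivity : (0 : ℝ) < 1 / ((m : ℝ) + 1)))
      exact ⟨d, hd2, hd1⟩
    · intro H
      obtain ⟨d, hd, -⟩ := H 0
      obtain ⟨x, hx, hmin⟩ := hK.exists_isMinOn ⟨d, hDK hd⟩ (hh.continuous ω).continuousOn
      refine ⟨x, hx, ?_⟩
      by_contra hpos
      obtain ⟨m, hm⟩ := exists_nat_one_div_lt (not_le.1 hpos)
      obtain ⟨d, hd, hlt⟩ := H m
      have h1 : h x ω ≤ h d ω := hmin (hDK hd)
      linarith
  rw [heq]
  exact MeasurableSet.iInter fun m => MeasurableSet.biUnion hDc fun d _ =>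
    measurableSet_lt (hh.measurable d) measurable_const

theorem IsCaratheodory.sup {h h' : E → Ω → ℝ} (hh : IsCaratheodory h) (hh' : IsCaratheodory h') :
    IsCaratheodory fun x ω => max (h x ω) (h' x ω) :=
  ⟨fun ω => (hh.continuous ω).max (hh'.continuous ω),
    fun x => (hh.measurable x).max (hh'.measurable x)⟩

/-- Adding the constraint φ ≤ v(ω), with v the measurable optimal value, describes the argmin by a
sublevel set of the same kind, so the construction can be iterated along a list of objectives. -/
theorem IsCaratheodory.exists_argminOn {h : E → Ω → ℝ} (hh : IsCaratheodory h) {K : Set E}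
    (hK : IsCompact K) {φ : E → ℝ} (hφ : Continuous φ) :
    ∃ h' : E → Ω → ℝ, IsCaratheodory h' ∧
      ∀ ω, argminOn φ {x | x ∈ K ∧ h x ω ≤ 0} = {x | x ∈ K ∧ h' x ω ≤ 0} := by
  set v : Ω → ℝ := fun ω => sInf (φ '' {x | x ∈ K ∧ h x ω ≤ 0}) with hv
  have hmin : ∀ ω, {x | x ∈ K ∧ h x ω ≤ 0}.Nonempty →
      ∃ x, (x ∈ K ∧ h x ω ≤ 0) ∧ φ x = v ω ∧ ∀ y, y ∈ K ∧ h y ω ≤ 0 → v ω ≤ φ y := by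
    intro ω hne
    have hc : IsCompact {x | x ∈ K ∧ h x ω ≤ 0} :=
      hK.inter_right (isClosed_le (hh.continuous ω) continuous_const)
    obtain ⟨x, hx, hxm⟩ := hc.exists_isMinOn hne hφ.continuousOn
    have hleast : IsLeast (φ '' {x | x ∈ K ∧ h x ω ≤ 0}) (φ x) :=
      ⟨⟨x, hx, rfl⟩, by rintro _ ⟨y, hy, rfl⟩; exact hxm hy⟩
    have hvx : v ω = φ x := hleast.csInf_eq
    exact ⟨x, hx, hvx.symm, fun y hy => hvx ▸ hxm hy⟩
  have hvm : Measurable v := by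
    refine measurable_of_Iic fun t => ?_
    -- The infimum of the empty set is 0 by convention, hence the extra term for infeasible ω.
    have heq : v ⁻¹' Set.Iic t = {ω | ∃ x ∈ K, max (h x ω) (φ x - t) ≤ 0} ∪
        ({ω | ∃ x ∈ K, h x ω ≤ 0}ᶜ ∩ {_ω | 0 ≤ t}) := by
      ext ω
      simp only [Set.mem_preimage, Set.mem_Iic, Set.mem_union, Set.mem_ofPred_eq, Set.mem_inter_iff,
        Set.mem_compl_iff, max_le_iff, sub_nonpos]
      by_cases hne : ∃ x ∈ K, h x ω ≤ 0
      · obtain ⟨x, hx, hxv, hxm⟩ := hmin ω hne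
        constructor
        · exact fun hle => Or.inl ⟨x, hx.1, hx.2, hxv ▸ hle⟩
        · rintro (⟨y, hy, hy1, hy2⟩ | ⟨h1, -⟩)
          · exact (hxm y ⟨hy, hy1⟩).trans hy2
          · exact absurd hne h1
      · have hempty : {x | x ∈ K ∧ h x ω ≤ 0} = ∅ := by
          rw [Set.eq_empty_iff_forall_notMem]
          exact fun x hx => hne ⟨x, hx⟩
        have hv0 : v ω = 0 := by simp only [hv, hempty, Set.image_empty, Real.sInf_empty]
        rw [hv0]
        constructor
        · exact fun h0 => Or.inr ⟨hne, h0⟩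
        · rintro (⟨y, hy, hy1, -⟩ | ⟨-, h1⟩)
          · exact absurd ⟨y, hy, hy1⟩ hne
          · exact h1
    rw [heq]
    have hc : IsCaratheodory fun (x : E) (_ : Ω) => φ x - t :=
      ⟨fun _ => hφ.sub continuous_const, fun _ => measurable_const⟩
    exact ((hh.sup hc).measurableSet_exists_le hK).union
      ((hh.measurableSet_exists_le hK).compl.inter (MeasurableSet.const _))
  refine ⟨fun x ω => max (h x ω) (φ x - v ω), hh.sup
    ⟨fun ω => hφ.sub continuous_const, fun x => measurable_const.sub hvm⟩, fun ω => ?_⟩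
  ext x
  simp only [argminOn, Set.mem_ofPred_eq, max_le_iff, sub_nonpos]
  constructor
  · rintro ⟨hx, hxm⟩
    obtain ⟨y, hy, hyv, -⟩ := hmin ω ⟨x, hx⟩
    exact ⟨hx.1, hx.2, hyv ▸ hxm y hy⟩
  · rintro ⟨hx, hx1, hx2⟩
    obtain ⟨y, hy, hyv, hym⟩ := hmin ω ⟨x, hx, hx1⟩
    exact ⟨⟨hx, hx1⟩, fun z hz => hx2.trans (hym z hz)⟩

theorem IsCaratheodory.exists_lexArgmin {h : E → Ω → ℝ} (hh : IsCaratheodory h) {K : Set E}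
    (hK : IsCompact K) {Φ : List (E → ℝ)} (hΦ : ∀ φ ∈ Φ, Continuous φ) :
    ∃ h' : E → Ω → ℝ, IsCaratheodory h' ∧
      ∀ ω, lexArgmin Φ {x | x ∈ K ∧ h x ω ≤ 0} = {x | x ∈ K ∧ h' x ω ≤ 0} := by
  induction Φ generalizing h with
  | nil => exact ⟨h, hh, fun ω => rfl⟩
  | cons φ Φ ih =>
    obtain ⟨h1, hh1, he1⟩ := hh.exists_argminOn hK (hΦ φ (by simp))
    obtain ⟨h2, hh2, he2⟩ := ih hh1 fun φ hφ => hΦ φ (by simp [hφ])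
    refine ⟨h2, hh2, fun ω => ?_⟩
    rw [← he2, ← he1]
    rfl

end Measurability

namespace ChanceProgram

variable {n : ℕ} {Δ : Type*} [MeasurableSpace Δ] {Q : ChanceProgram n Δ} {S : ConvexScenario n}

/-- The new sample violates iff a solution exists but none satisfies the new constraint; both
conditions are of the form treated by `measurableSet_exists_le`. -/
theorem measurableSet_value_lt (hQ : Q.IsRegular) (hS : S.IsRegular) (L : ℕ) :
    MeasurableSet {p : (Fin L → Δ) × Δ |
      Q.value S (Set.range p.1) < Q.value S (insert p.2 (Set.range p.1))} := by
  have hg : ∀ i : Fin L, IsCaratheodory fun (x : EuclideanSpace ℝ (Fin n))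
      (p : (Fin L → Δ) × Δ) => Q.g x (p.1 i) := fun i =>
    ⟨fun p => continuous_g hQ _, fun x => (hQ.measurable_g x).comp (by fun_prop)⟩
  have hg' : IsCaratheodory fun (x : EuclideanSpace ℝ (Fin n)) (p : (Fin L → Δ) × Δ) =>
      Q.g x p.2 :=
    ⟨fun p => continuous_g hQ _, fun x => (hQ.measurable_g x).comp measurable_snd⟩
  have h0 : IsCaratheodory fun (x : EuclideanSpace ℝ (Fin n)) (p : (Fin L → Δ) × Δ) =>
      ∑ i, max (Q.g x (p.1 i)) 0 :=
    ⟨fun p => continuous_finsetSum _ fun i _ => ((hg i).continuous p).max continuous_const,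
      fun x => Finset.measurable_sum _ fun i _ => ((hg i).measurable x).max measurable_const⟩
  have hK := isCompact_constraint hQ hS
  obtain ⟨h1, hh1, he1⟩ := h0.exists_lexArgmin hK (continuous_objectives hS)
  have hfeas : ∀ p : (Fin L → Δ) × Δ, Q.feasible S (Set.range p.1) =
      {x | x ∈ S.C ∩ Q.adm ∧ ∑ i, max (Q.g x (p.1 i)) 0 ≤ 0} := by
    intro p
    ext x
    simp only [feasible, Set.mem_ofPred_eq, Set.forall_mem_range]
    refine and_congr_right fun _ => ?_
    have hnn : 0 ≤ ∑ i, max (Q.g x (p.1 i)) 0 := Finset.sum_nonneg fun i _ => le_max_right _ _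
    have hzero : ∑ i, max (Q.g x (p.1 i)) 0 ≤ 0 ↔ ∑ i, max (Q.g x (p.1 i)) 0 = 0 :=
      ⟨fun h => le_antisymm h hnn, fun h => h.le⟩
    rw [hzero, Finset.sum_eq_zero_iff_of_nonneg fun i _ => le_max_right _ _]
    simp
  have hsol : ∀ p : (Fin L → Δ) × Δ, Q.solution S (Set.range p.1) =
      {x | x ∈ S.C ∩ Q.adm ∧ h1 x p ≤ 0} := by
    intro p
    rw [solution, hfeas p, he1 p]
  have heq : {p : (Fin L → Δ) × Δ |
      Q.value S (Set.range p.1) < Q.value S (insert p.2 (Set.range p.1))} =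
      {p | ∃ x ∈ S.C ∩ Q.adm, h1 x p ≤ 0} \ {p | ∃ x ∈ S.C ∩ Q.adm, max (h1 x p) (Q.g x p.2) ≤ 0} := by
    ext p
    simp only [Set.mem_ofPred_eq, Set.mem_sdiff, max_le_iff]
    constructor
    · intro hlt
      obtain ⟨x, hx⟩ := solution_nonempty_of_value_lt hlt
      rw [value_lt_iff hQ hS hx] at hlt
      have hx' := hx
      rw [hsol] at hx'
      refine ⟨⟨x, hx'⟩, ?_⟩
      rintro ⟨y, hy, hy1, hy2⟩
      have hys : y ∈ Q.solution S (Set.range p.1) := by rw [hsol]; exact ⟨hy, hy1⟩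
      rw [solution_subsingleton _ hys hx] at hy2
      exact absurd hlt (not_lt.2 hy2)
    · rintro ⟨⟨x, hx, hx1⟩, hno⟩
      have hxs : x ∈ Q.solution S (Set.range p.1) := by rw [hsol]; exact ⟨hx, hx1⟩
      rw [value_lt_iff hQ hS hxs]
      by_contra hle
      exact hno ⟨x, hx, hx1, not_lt.1 hle⟩
  rw [heq]
  exact (hh1.measurableSet_exists_le hK).diff ((hh1.sup hg').measurableSet_exists_le hK)

theorem isScenarioValue {P : Measure Δ} (hQ : Q.IsRegular) (hS : S.IsRegular) {ζ : ℕ}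
    (hζ : Q.hellyDim P S ≤ (ζ : ℕ∞)) : IsScenarioValue P (Q.value S) ζ :=
  ⟨fun _ _ h => value_mono hQ hS h, fun _ _ δ h hlt => value_loc hQ hS δ h hlt,
    measurableSet_value_lt hQ hS, ae_support_value hζ⟩

end ChanceProgram

/-! ### From one program to the convex hull of the optimizers. -/

theorem ofReal_one_sub_le_measure {Ω : Type*} [MeasurableSpace Ω]
    {μ : Measure Ω} [IsProbabilityMeasure μ] {A : Set Ω} {β : ℝ} (hβ : 0 ≤ β)
    (h : μ Aᶜ ≤ ENNReal.ofReal β) : ENNReal.ofReal (1 - β) ≤ μ A := by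
  have h6 := measure_univ_le_add_compl (μ := μ) A
  rw [measure_univ] at h6
  rw [ENNReal.ofReal_sub _ hβ, ENNReal.ofReal_one]
  exact tsub_le_iff_right.2 (h6.trans (by gcongr))

namespace ChanceProgram

variable {n : ℕ} {Δ : Type*} [MeasurableSpace Δ] {Q : ChanceProgram n Δ} {P : Measure Δ}

/-- Under uniqueness the refined solution is the optimizer itself, so its violation set consists of
the samples that raise the value. -/
theorem measure_violation_optimizer [IsProbabilityMeasure P] {S : ConvexScenario n}
    (hQ : Q.IsRegular) (hS : S.IsRegular) {ζ : ℕ}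
    (hζ : Q.hellyDim P S ≤ (ζ : ℕ∞)) {N : ℕ} {ω : Fin N → Δ}
    (hu : (Q.optimizers S ω).Subsingleton) {x : EuclideanSpace ℝ (Fin n)}
    (hx : x ∈ Q.optimizers S ω) :
    P {δ | 0 < Q.g x δ} = (isScenarioValue hQ hS hζ).risk ω := by
  have hxf : x ∈ Q.feasible S (Set.range ω) := by
    rw [optimizers_eq] at hx
    exact lexArgmin_subset _ _ hx
  obtain ⟨y, hy⟩ := solution_nonempty hQ hS ⟨x, hxf⟩
  have hyo : y ∈ Q.optimizers S ω := by
    rw [solution_range_eq] at hy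
    exact lexArgmin_subset _ _ hy
  rw [hu hx hyo, IsScenarioValue.risk]
  congr 1
  ext δ
  exact (value_lt_iff hQ hS hy δ).symm

/-- For dimension zero, uniqueness of the optimizer extends to the program without samples. -/
theorem optimizers_subsingleton_of_hellyDim_zero [IsProbabilityMeasure P] {S : ConvexScenario n}
    (hu : ∀ ω : Fin 1 → Δ, (Q.optimizers S ω).Subsingleton) (hζ : Q.hellyDim P S ≤ (0 : ℕ∞))
    (ω : Fin 0 → Δ) : (Q.optimizers S ω).Subsingleton := by
  have hmem : Q.hellyDim P S ∈ {ζ : ℕ∞ | ∀ N : ℕ, 1 ≤ N →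
    ∀ᵐ ω ∂(Measure.pi fun _ : Fin N => P), (Q.supportConstraints S ω).encard ≤ ζ} :=
    csInf_mem ⟨⊤, fun N _ => Filter.Eventually.of_forall fun ω => le_top⟩
  -- Dimension zero yields a one-sample program whose sample is not of support, so it has the same
  -- optimizers as the program without samples.
  obtain ⟨ω', hω'⟩ := (hmem 1 le_rfl).exists
  have h0 : Q.supportConstraints S ω' = ∅ := by
    rw [← Set.encard_eq_zero]
    exact nonpos_iff_eq_zero.1 (hω'.trans hζ)
  have h1 : Q.optimizers S (fun j : {j : Fin 1 // j ≠ 0} => ω' j) = Q.optimizers S ω' := by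
    by_contra hne
    exact Set.eq_empty_iff_forall_notMem.1 h0 0 hne
  have h2 : Q.optimizers S ω = Q.optimizers S ω' := by
    rw [← h1, optimizers_eq, optimizers_eq]
    congr 2
    have : IsEmpty {j : Fin 1 // j ≠ 0} := ⟨fun j => j.2 (Subsingleton.elim _ _)⟩
    rw [Set.range_eq_empty, Set.range_eq_empty]
  rw [h2]
  exact hu ω'

/-- Carathéodory writes the point with affinely independent optimizers, at most n + 1 of them and at
most one per program. A convex function is at most its largest value at these points, so a violated
constraint is violated at one of them. -/
theorem violation_convexHull_le {ι : Type*} [Fintype ι] (hQ : Q.IsRegular)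
    (A : ι → Set (EuclideanSpace ℝ (Fin n))) (hA : ∀ k, (A k).Subsingleton) {c : ENNReal}
    (h : ∀ k, ∀ x ∈ A k, P {δ | 0 < Q.g x δ} ≤ c) :
    Q.violation P (convexHull ℝ (⋃ k, A k)) ≤ (min (n + 1) (Fintype.card ι) : ℕ) * c := by
  classical
  refine iSup₂_le fun x hx => ?_
  rw [convexHull_eq_union] at hx
  simp only [Set.mem_iUnion, exists_prop] at hx
  obtain ⟨t, htA, hti, hxt⟩ := hx
  have hsub : {δ | 0 < Q.g x δ} ⊆ ⋃ y ∈ t, {δ | 0 < Q.g y δ} := by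
    intro δ hδ
    obtain ⟨y, hy, hle⟩ := (hQ.convex_g δ).exists_ge_of_mem_convexHull (Set.subset_univ _) hxt
    exact Set.mem_biUnion (Finset.mem_coe.1 hy) (lt_of_lt_of_le (show 0 < Q.g x δ from hδ) hle)
  have hk : ∀ y : t, ∃ k, y.1 ∈ A k := fun y => Set.mem_iUnion.1 (htA y.2)
  choose f hf using hk
  have hcard1 : t.card ≤ Fintype.card ι := by
    rw [← Fintype.card_coe]
    refine Fintype.card_le_of_injective f fun a b hab => Subtype.ext (hA (f a) (hf a) ?_)
    rw [hab]
    exact hf b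
  have hcard2 : t.card ≤ n + 1 := by
    have h1 := hti.card_le_finrank_succ
    have h2 := Submodule.finrank_le (vectorSpan ℝ (Set.range ((↑) : t → EuclideanSpace ℝ (Fin n))))
    rw [finrank_euclideanSpace_fin] at h2
    have h3 : t.card = Fintype.card t := (Fintype.card_coe t).symm
    have h4 : Fintype.card t ≤ n + 1 := h1.trans (by omega)
    omega
  calc P {δ | 0 < Q.g x δ} ≤ ∑ y ∈ t, P {δ | 0 < Q.g y δ} :=
        (measure_mono hsub).trans (measure_biUnion_finset_le _ _)
    _ ≤ ∑ _y ∈ t, c := Finset.sum_le_sum fun y hy => h (f ⟨y, hy⟩) y (hf ⟨y, hy⟩)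
    _ = (t.card : ENNReal) * c := by rw [Finset.sum_const, nsmul_eq_mul]
    _ ≤ _ := by
        gcongr
        exact le_min hcard2 hcard1

theorem violation_empty : Q.violation P ∅ = 0 := by
  simp [violation]

theorem approxFeasible_subset_chanceFeasible [IsProbabilityMeasure P] {M : ℕ}
    {S : Fin M → ConvexScenario n} {ι : Type*} {ω : ι → Δ} {ε : ℝ} (hε : 0 ≤ ε)
    (h : Q.violation P (Q.optimizerHull S ω) ≤ ENNReal.ofReal ε) :
    Q.approxFeasible S ω ⊆ Q.chanceFeasible P ε := by
  rintro x ⟨hx1, hx2⟩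
  refine ⟨hx1, ofReal_one_sub_le_measure hε ?_⟩
  have h1 : {δ | Q.g x δ ≤ 0}ᶜ = {δ | 0 < Q.g x δ} := by
    ext δ; simp
  rw [h1]
  exact le_trans (le_iSup₂ (f := fun x _ => P {δ | 0 < Q.g x δ}) x hx2) h

end ChanceProgram

/-- Bound for the violation probability of the convex hull of the optimizers. -/
theorem measure_violation_optimizerHull_le {n M N : ℕ} {Δ : Type*} [MeasurableSpace Δ]
    (P : Measure Δ) [IsProbabilityMeasure P]
    (Q : ChanceProgram n Δ) (hQ : Q.IsRegular)
    (S : Fin M → ConvexScenario n) (hS : ∀ k, (S k).IsRegular)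
    (huniq : ∀ k (L : ℕ), 1 ≤ L → ∀ ω : Fin L → Δ, (Q.optimizers (S k) ω).Subsingleton)
    (ζ : ℕ) (hζ : ∀ k, Q.hellyDim P (S k) ≤ (ζ : ℕ∞))
    (ε β : ℝ) (hε : ε ∈ Set.Ioo (0 : ℝ) 1) (hβ : β ∈ Set.Ioo (0 : ℝ) 1)
    (hN : (Real.exp 1 / (Real.exp 1 - 1)) * (min (n + 1) M : ℕ) / ε
        * ((ζ : ℝ) - 1 + Real.log ((M : ℝ) / β)) ≤ (N : ℝ)) :
    (Measure.pi fun _ : Fin N => P)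
        {ω | ENNReal.ofReal ε < Q.violation P (Q.optimizerHull S ω)} ≤ ENNReal.ofReal β := by
  -- Without programs the hull is empty and its violation is zero.
  rcases Nat.eq_zero_or_pos M with hM | hM
  · subst hM
    have h0 : {ω : Fin N → Δ | ENNReal.ofReal ε < Q.violation P (Q.optimizerHull S ω)} = ∅ := by
      rw [Set.eq_empty_iff_forall_notMem]
      intro ω hω
      have h1 : Q.optimizerHull S ω = ∅ := by simp [ChanceProgram.optimizerHull]
      rw [Set.mem_ofPred_eq, h1, ChanceProgram.violation_empty] at hω
      exact absurd hω not_lt_zero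
    rw [h0, measure_empty]
    exact zero_le
  obtain ⟨hε0, hε1⟩ := hε
  obtain ⟨hβ0, hβ1⟩ := hβ
  have hM' : (1 : ℝ) ≤ M := by exact_mod_cast hM
  set m := min (n + 1) M with hm
  have hm1 : 1 ≤ m := le_min (by omega) hM
  have hm' : (1 : ℝ) ≤ m := by exact_mod_cast hm1
  have hlog : 0 < Real.log (M / β) := Real.log_pos (by rw [lt_div_iff₀ hβ0]; linarith)
  have he := Real.exp_one_gt_d9
  have hc : Real.exp 1 / (Real.exp 1 - 1) * (1 - Real.exp (-1)) = 1 := by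
    have h1 : Real.exp 1 * Real.exp (-1) = 1 := by rw [← Real.exp_add]; simp
    rw [div_mul_eq_mul_div, div_eq_one_iff_eq (by linarith), mul_sub, h1, mul_one]
  have hc0 : 0 < 1 - Real.exp (-1) := by
    have := Real.exp_neg_one_lt_d9
    linarith
  have hu : ∀ k (ω : Fin N → Δ), (Q.optimizers (S k) ω).Subsingleton := by
    intro k ω
    -- Uniqueness is assumed only for at least one sample. The sample bound permits N = 0 only when
    -- ζ = 0, because log(M/β) > 0.
    rcases Nat.eq_zero_or_pos N with hN0 | hN0
    · subst hN0
      have hζ0 : ζ = 0 := by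
        by_contra hne
        have h1 : (1 : ℝ) ≤ ζ := by exact_mod_cast Nat.one_le_iff_ne_zero.2 hne
        have h2 : 0 < Real.exp 1 - 1 := by linarith
        have h3 : 0 < (ζ : ℝ) - 1 + Real.log (M / β) := by linarith
        have h4 : 0 < (Real.exp 1 / (Real.exp 1 - 1)) * (m : ℝ) / ε
          * ((ζ : ℝ) - 1 + Real.log (M / β)) := by positivity
        simp only [Nat.cast_zero] at hN
        linarith
      subst hζ0
      exact ChanceProgram.optimizers_subsingleton_of_hellyDim_zero (huniq k 1 le_rfl) (hζ k) ω
    · exact huniq k N hN0 ω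
  have hεm0 : 0 < ε / m := by positivity
  have hεm1 : ε / m < 1 := by
    rw [div_lt_one (by positivity)]; linarith
  have hsub : {ω : Fin N → Δ | ENNReal.ofReal ε < Q.violation P (Q.optimizerHull S ω)} ⊆
      ⋃ k, {ω | ENNReal.ofReal (ε / m) <
        (ChanceProgram.isScenarioValue hQ (hS k) (hζ k)).risk ω} := by
    intro ω hω
    by_contra hno
    simp only [Set.mem_iUnion, Set.mem_ofPred_eq, not_exists, not_lt] at hno
    have h1 := ChanceProgram.violation_convexHull_le (P := P) hQ
      (fun k => Q.optimizers (S k) ω) (fun k => hu k ω) (c := ENNReal.ofReal (ε / m)) (by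
        intro k x hx
        rw [ChanceProgram.measure_violation_optimizer hQ (hS k) (hζ k) (hu k ω) hx]
        exact hno k)
    rw [Fintype.card_fin, ← hm, ← ENNReal.ofReal_natCast, ← ENNReal.ofReal_mul (by positivity),
      mul_div_cancel₀ _ (by positivity)] at h1
    exact absurd hω (not_lt.2 h1)
  -- Since e/(e-1) is the inverse of 1 - 1/e, the assumption on N says precisely that the exponent
  -- is at most log(β/M).
  have hexp : Real.exp (ζ - 1 - (1 - Real.exp (-1)) * N * (ε / m)) ≤ β / M := by
    rw [← Real.exp_log (show 0 < β / M by positivity)]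
    refine Real.exp_le_exp.2 ?_
    rw [Real.log_div (by positivity) (by positivity)] at hlog ⊢
    rw [Real.log_div (by positivity) (by positivity)] at hN
    have h1 := mul_le_mul_of_nonneg_left hN (by positivity :
      0 ≤ (1 - Real.exp (-1)) * (ε / m))
    have h2 : (1 - Real.exp (-1)) * (ε / m) * (Real.exp 1 / (Real.exp 1 - 1) * (m : ℝ) / ε *
        ((ζ : ℝ) - 1 + (Real.log M - Real.log β))) =
        (Real.exp 1 / (Real.exp 1 - 1) * (1 - Real.exp (-1))) *
          ((ζ : ℝ) - 1 + (Real.log M - Real.log β)) := by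
      field_simp
    rw [h2, hc, one_mul] at h1
    linarith
  calc _ ≤ ∑ k, (Measure.pi fun _ : Fin N => P) {ω | ENNReal.ofReal (ε / m) <
        (ChanceProgram.isScenarioValue hQ (hS k) (hζ k)).risk ω} :=
        (measure_mono hsub).trans (measure_iUnion_fintype_le _ _)
    _ ≤ ∑ _k : Fin M, ENNReal.ofReal (β / M) := Finset.sum_le_sum fun k _ =>
        ((ChanceProgram.isScenarioValue hQ (hS k) (hζ k)).measure_risk_gt_le_exp N hεm0 hεm1).trans
          (ENNReal.ofReal_le_ofReal hexp)
    _ = ENNReal.ofReal β := by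
        rw [Finset.sum_const, Finset.card_univ, Fintype.card_fin, nsmul_eq_mul,
          ← ENNReal.ofReal_natCast, ← ENNReal.ofReal_mul (by positivity),
          mul_div_cancel₀ _ (by positivity)]

theorem mainTheorem2 {n M N : ℕ} {Δ : Type*} [MeasurableSpace Δ]
    (P : Measure Δ) [IsProbabilityMeasure P]
    (Q : ChanceProgram n Δ) (hQ : Q.IsRegular)
    (S : Fin M → ConvexScenario n) (hS : ∀ k, (S k).IsRegular)
    (huniq : ∀ k (L : ℕ), 1 ≤ L → ∀ ω : Fin L → Δ, (Q.optimizers (S k) ω).Subsingleton)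
    (ζ : ℕ) (hζ : ∀ k, Q.hellyDim P (S k) ≤ (ζ : ℕ∞))
    (ε β : ℝ) (hε : ε ∈ Set.Ioo (0 : ℝ) 1) (hβ : β ∈ Set.Ioo (0 : ℝ) 1)
    (hN : (Real.exp 1 / (Real.exp 1 - 1)) * (min (n + 1) M : ℕ) / ε
        * ((ζ : ℝ) - 1 + Real.log ((M : ℝ) / β)) ≤ (N : ℝ)) :
    (Measure.pi fun _ : Fin N => P)
        {ω | ENNReal.ofReal ε < Q.violation P (Q.optimizerHull S ω)} ≤ ENNReal.ofReal β ∧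
    ENNReal.ofReal (1 - β) ≤ (Measure.pi fun _ : Fin N => P)
        {ω | Q.violation P (Q.optimizerHull S ω) ≤ ENNReal.ofReal ε} ∧
    ENNReal.ofReal (1 - β) ≤ (Measure.pi fun _ : Fin N => P)
        {ω | Q.approxFeasible S ω ⊆ Q.chanceFeasible P ε} := by
  have h1 := measure_violation_optimizerHull_le P Q hQ S hS huniq ζ hζ ε β hε hβ hN
  have h2 : ENNReal.ofReal (1 - β) ≤ (Measure.pi fun _ : Fin N => P)
        {ω | Q.violation P (Q.optimizerHull S ω) ≤ ENNReal.ofReal ε} := by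
    refine ofReal_one_sub_le_measure hβ.1.le (le_trans (measure_mono ?_) h1)
    intro ω hω
    exact not_le.1 (show ¬ Q.violation P (Q.optimizerHull S ω) ≤ ENNReal.ofReal ε from hω)
  refine ⟨h1, h2, h2.trans (measure_mono fun ω hω => ?_)⟩
  exact ChanceProgram.approxFeasible_subset_chanceFeasible hε.1.le hω
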